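/- For $d\ge 1$ regard $\mathbb{R}^d$ as a graph in which two points are adjacent exactly when their Euclidean distance is $1$, and regard $\mathbb{Q}^d$ as the induced subgraph on the rational points. Write $\chi$ for the chromatic number and $\alpha$ for the independence number of a graph. An embedding of a graph $G$ in $\mathbb{R}^d$ (or $\mathbb{Q}^d$) means an injective map from the vertices of $G$ to points such that two vertices are adjacent if and only if their images are at distance $1$. Let $C(d,u)$ be the graph on $\{0,1\}^d$ in which two distinct points are adjacent when their Hamming distance is $u$. Let $H(d,u)$ be its induced subgraph on the points with even coordinate sum (the half-cube), and let $C(d,u,s)$ be its induced subgraph on the points with $x_1+\dots+x_d=s$. Let $R\subset\mathbb{Z}^8$ be the set of $E_8$ roots, scaled: all vectors with two entries $\pm 2$ and six entries $0$, and all vectors with every entry $\pm1$ and an even number of minus signs. Let $A\subset\mathbb{Z}^8$ consist of the points $$\begin{gathered} (-2,0,-2,0,0,2,0,2), (-2,0,0,0,2,0,-2,2), (-2,0,0,2,2,2,0,0),\\ (-2,0,2,0,0,2,0,2), (-2,0,2,2,0,0,0,2), (-2,2,0,0,-2,2,0,0),\\ (-2,2,0,0,0,0,2,2), (-2,2,2,0,2,0,0,0),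 (0,-2,-2,0,0,2,0,2),\\ (0,-2,-2,0,2,0,0,2), (0,-2,0,2,2,0,0,2), (0,0,-2,0,2,0,-2,2),\\ (0,0,-2,0,2,2,2,0), (0,0,-2,2,2,0,2,0), (0,0,-1,1,-1,0,0,1),\\ (0,0,0,2,0,2,2,2), (0,0,0,2,2,0,-2,2), (0,0,2,0,-2,0,2,2),\\ (0,0,2,0,2,-2,-2,0), (0,0,2,2,2,0,2,0), (0,2,0,0,-2,-2,0,2),\\ (0,2,0,0,2,0,-2,-2), (0,2,0,2,0,2,0,-2), (0,2,0,2,2,2,0,0),\\ (1,-1,1,-1,1,1,-1,3), (1,0,0,1,1,1,0,0), (1,0,1,0,1,1,0,0),\\ (1,1,0,1,1,0,0,0), (1,1,1,0,0,0,0,1), (1,1,1,1,0,0,0,0),\\ (2,-2,-2,0,0,0,2,0), (2,-2,-2,0,0,2,0,0), (2,-2,0,-2,0,0,2,0),\\ (2,-2,0,0,-2,0,0,2), (2,-2,0,0,2,0,-2,0), (2,0,0,0,0,-2,2,-2),\\ (2,0,0,0,0,2,2,-2), (2,0,0,0,2,-2,0,-2), (2,0,0,0,2,2,0,-2),\\ (2,0,0,0,2,2,2,0),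 (2,0,0,2,0,-2,2,0), (2,0,0,2,2,0,0,-2),\\ (2,0,0,2,2,0,0,2), (2,0,2,-2,-2,0,0,0), (2,0,2,0,0,0,2,-2),\\ (2,0,2,2,0,0,0,2), (2,2,0,0,0,0,2,2), (3,-1,1,-1,1,-1,1,1),\\ (3,-1,1,1,-1,-1,-1,-1). \end{gathered}$$ Let $G$ be the graph on $R\cup A$ in which two points are adjacent when their Euclidean distance is $4$. **Theorem.** One has $$\chi(\mathbb{R}^8)\ge 19,\quad \chi(\mathbb{R}^9)\ge 21,\quad \chi(\mathbb{R}^{10})\ge 26,\quad \chi(\mathbb{R}^{11})\ge 32,\quad \chi(\mathbb{R}^{12})\ge 32,\quad \chi(\mathbb{Q}^8)\ge 19.$$ Moreover, these bounds are already valid for the following finite unit-distance graphs: 1. $H(10,4)$ has $512$ vertices, $\alpha(H(10,4))=20$ and $\chi(H(10,4))\ge 26$, and it embeds in $\mathbb{R}^{10}$. 2. $H(11,4)$ has $1024$ vertices, $\alpha(H(11,4))=32$ and $\chi(H(11,4))\ge 32$, and it embeds in $\mathbb{R}^{11}$ and in $\mathbb{R}^{12}$. 3. $C(10,4,5)$ has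 $252$ vertices, $\alpha(C(10,4,5))=12$ and $\chi(C(10,4,5))\ge 21$, and it embeds in $\mathbb{R}^{9}$. 4. $|R|=240$, $|A|=49$, $G$ has $289$ vertices, $\alpha(G)=16$ and $\chi(G)\ge 19$, and $G$ embeds in $\mathbb{R}^8$ and in $\mathbb{Q}^8$. -/

import Mathlib

/-- The unit-distance graph on Euclidean space `ℝ^d`: all points are vertices, and two points are
adjacent when their Euclidean distance is `1`. -/
def unitDistanceGraph (d : ℕ) : SimpleGraph (EuclideanSpace ℝ (Fin d)) where
  Adj p q := dist p q = 1
  symm := ⟨fun p q h => by rw [dist_comm]; exact h⟩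
  loopless := ⟨fun p h => by simp at h⟩

/-- The unit-distance graph on `ℚ^d`: the rational points of `ℝ^d`, adjacent when their Euclidean
distance is `1`. -/
def rationalUnitDistanceGraph (d : ℕ) : SimpleGraph (Fin d → ℚ) :=
  (unitDistanceGraph d).comap fun p => WithLp.toLp 2 fun i => (p i : ℝ)

/-- The hypercube graph `C(d,u)`: its vertices are the points of `{0,1}^d`, and two distinct
vertices are adjacent when their Hamming distance is `u`. -/
def hypercubeGraph (d u : ℕ) : SimpleGraph (Fin d → Fin 2) where
  Adj x y := x ≠ y ∧ hammingDist x y = u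
  symm := ⟨fun x y h => ⟨h.1.symm, by rw [hammingDist_comm]; exact h.2⟩⟩
  loopless := ⟨fun x h => h.1 rfl⟩

/-- The half-cube: the points of `{0,1}^d` with even coordinate sum. -/
def halfCube (d : ℕ) : Set (Fin d → Fin 2) :=
  {x | Even (∑ i, (x i : ℕ))}

/-- The half-cube graph `H(d,u)`, the subgraph of `C(d,u)` induced on the half-cube. -/
def halfCubeGraph (d u : ℕ) : SimpleGraph (halfCube d) :=
  (hypercubeGraph d u).induce (halfCube d)

/-- The points of `{0,1}^d` on the hyperplane `x_1 + ... + x_d = s`. -/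
def cubeSlice (d s : ℕ) : Set (Fin d → Fin 2) :=
  {x | ∑ i, (x i : ℕ) = s}

/-- The graph `C(d,u,s)`, the subgraph of `C(d,u)` induced on the slice at height `s`. -/
def cubeSliceGraph (d u s : ℕ) : SimpleGraph (cubeSlice d s) :=
  (hypercubeGraph d u).induce (cubeSlice d s)

/-- The shortest nonzero vectors of the `E8` lattice, scaled to have integer coordinates: the
vectors with two entries `±2` and six entries `0`, and the vectors with all entries `±1` and an even
number of minus signs. -/
def e8Roots : Set (Fin 8 → ℤ) :=
  {x | ∃ i j, i ≠ j ∧ (x i = 2 ∨ x i = -2) ∧ (x j = 2 ∨ x j = -2) ∧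
      ∀ k, k ≠ i → k ≠ j → x k = 0} ∪
  {x | (∀ i, x i = 1 ∨ x i = -1) ∧ Even (Finset.univ.filter fun i => x i = -1).card}

/-- The integer points that are added to the `E8` roots. -/
def addedPoints : Finset (Fin 8 → ℤ) :=
  {![-2, 0, -2, 0, 0, 2, 0, 2],
   ![-2, 0, 0, 0, 2, 0, -2, 2],
   ![-2, 0, 0, 2, 2, 2, 0, 0],
   ![-2, 0, 2, 0, 0, 2, 0, 2],
   ![-2, 0, 2, 2, 0, 0, 0, 2],
   ![-2, 2, 0, 0, -2, 2, 0, 0],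
   ![-2, 2, 0, 0, 0, 0, 2, 2],
   ![-2, 2, 2, 0, 2, 0, 0, 0],
   ![0, -2, -2, 0, 0, 2, 0, 2],
   ![0, -2, -2, 0, 2, 0, 0, 2],
   ![0, -2, 0, 2, 2, 0, 0, 2],
   ![0, 0, -2, 0, 2, 0, -2, 2],
   ![0, 0, -2, 0, 2, 2, 2, 0],
   ![0, 0, -2, 2, 2, 0, 2, 0],
   ![0, 0, -1, 1, -1, 0, 0, 1],
   ![0, 0, 0, 2, 0, 2, 2, 2],
   ![0, 0, 0, 2, 2, 0, -2, 2],
   ![0, 0, 2, 0, -2, 0, 2, 2],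
   ![0, 0, 2, 0, 2, -2, -2, 0],
   ![0, 0, 2, 2, 2, 0, 2, 0],
   ![0, 2, 0, 0, -2, -2, 0, 2],
   ![0, 2, 0, 0, 2, 0, -2, -2],
   ![0, 2, 0, 2, 0, 2, 0, -2],
   ![0, 2, 0, 2, 2, 2, 0, 0],
   ![1, -1, 1, -1, 1, 1, -1, 3],
   ![1, 0, 0, 1, 1, 1, 0, 0],
   ![1, 0, 1, 0, 1, 1, 0, 0],
   ![1, 1, 0, 1, 1, 0, 0, 0],
   ![1, 1, 1, 0, 0, 0, 0, 1],
   ![1, 1, 1, 1, 0, 0, 0, 0],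
   ![2, -2, -2, 0, 0, 0, 2, 0],
   ![2, -2, -2, 0, 0, 2, 0, 0],
   ![2, -2, 0, -2, 0, 0, 2, 0],
   ![2, -2, 0, 0, -2, 0, 0, 2],
   ![2, -2, 0, 0, 2, 0, -2, 0],
   ![2, 0, 0, 0, 0, -2, 2, -2],
   ![2, 0, 0, 0, 0, 2, 2, -2],
   ![2, 0, 0, 0, 2, -2, 0, -2],
   ![2, 0, 0, 0, 2, 2, 0, -2],
   ![2, 0, 0, 0, 2, 2, 2, 0],
   ![2, 0, 0, 2, 0, -2, 2, 0],
   ![2, 0, 0, 2, 2, 0, 0, -2],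
   ![2, 0, 0, 2, 2, 0, 0, 2],
   ![2, 0, 2, -2, -2, 0, 0, 0],
   ![2, 0, 2, 0, 0, 0, 2, -2],
   ![2, 0, 2, 2, 0, 0, 0, 2],
   ![2, 2, 0, 0, 0, 0, 2, 2],
   ![3, -1, 1, -1, 1, -1, 1, 1],
   ![3, -1, 1, 1, -1, -1, -1, -1]}

/-- The vertex set consisting of the `E8` roots and the added points. -/
def extendedE8 : Set (Fin 8 → ℤ) :=
  e8Roots ∪ (addedPoints : Set (Fin 8 → ℤ))

/-- The graph on the `E8` roots and the added points, with two vertices adjacent when their Euclidean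
distance is `4`, that is, when their squared distance is `16`. -/
def extendedE8Graph : SimpleGraph extendedE8 where
  Adj x y := ∑ i, (x.1 i - y.1 i) ^ 2 = 16
  symm := ⟨fun x y h => by
    rw [← h]
    exact Finset.sum_congr rfl fun i _ => by ring⟩
  loopless := ⟨fun x h => by simp at h⟩

/-! In a proper colouring every class is independent, so a graph with `N` vertices and independence
number `a` has chromatic number at least `N / a`. The four graphs give 512/20, 1024/32, 252/12 and
289/16, which round up to 26, 32, 21 and 19. Each is a unit-distance graph after scaling, so
everything rests on four upper bounds for independence numbers, each matched by an explicit
independent set.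

For the cube graphs an independent set is a binary code without distance 4. In the half-cube and in
the slice all distances are even. Hence "distance at most 2" is transitive on the code: the code
splits into clusters with mutual distances 2, and different clusters are at least 6 apart. A cluster
is a star (all words at distance 1 from a common centre) or a tetrahedron (`star_or_tetrahedron`),
and the balls of radius 2 around different clusters are disjoint (`AvoidsFour.card_mul_le`). Packing
settles the codes with small clusters. If there are close words, symmetry moves a few of them to
standard position and a finite search bounds the rest. For `H(11,4)` a large star with centre `c`
pushes all other words, with at most one exception, to distance at least 7 from `c`. Their
translates by the complement of `c` have weights 0, 2 and 4, where the bound is 21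
(`card_le_twentyOne`), and 11 + 21 = 32. The slice needs only one search and a count of common
triples.

For the `E8` graph, roots have squared norm 8, so two roots are at distance 4 exactly when they are
orthogonal, whatever their signs. At most eight lines spanned by roots are pairwise non-orthogonal
(`bound_lines`), so an independent set of roots has at most 16 elements. The 49 added points do not
raise this number. To see it, let `X` consist of the added points of an independent set and the
lines with both roots in it, and count all lines that meet the set once more; the two counts add up
to the size of the set. A search over `X`, which keeps track of the lines still possible, bounds the
sum by 16 (`card_add_card_lines_le`).

The searches are branch and bound: a set with more than `k` elements cannot be covered by `k`
cliques, so it suffices to branch on the vertices outside `k` greedily chosen cliques. The programs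
are proved sound once (`bound_sound`, `boundPair_sound`, `boundFew_sound`) and are then evaluated by
the kernel. -/

noncomputable section

/-! ### Branch and bound on bitmasks, in a form that the kernel evaluates quickly -/

namespace Mask

/-- `casesZero x z s` is `z` for `x = 0` and `s x` otherwise. The recursion on a salted copy of `x`
makes the kernel evaluate `x` once, and gives distinct values of `x` distinct hashes. -/
def casesZero {α : Type} (x : ℕ) (z : α) (s : ℕ → α) : α :=
  Nat.rec (motive := fun _ => α) z (fun n _ => s (Nat.shiftRight (Nat.succ n) 32))
    (Nat.add (Nat.shiftLeft x 32) (Nat.mod x 4146110323))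

theorem casesZero_eq {α : Type} (x : ℕ) (z : α) (s : ℕ → α) :
    casesZero x z s = if x = 0 then z else s x := by
  have hdecode : ∀ y, y = Nat.add (Nat.shiftLeft x 32) (Nat.mod x 4146110323) →
      y >>> 32 = x := by
    rintro y rfl
    -- The salt is below `2 ^ 32`, so shifting by 32 removes it and recovers `x`.
    have h : x % 4146110323 < 2 ^ 32 :=
      (Nat.mod_lt _ (by norm_num)).trans (by norm_num)
    change ((x <<< 32) + x % 4146110323) >>> 32 = x
    rw [Nat.shiftRight_eq_div_pow, Nat.shiftLeft_eq]
    omega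
  unfold casesZero
  generalize hy : Nat.add (Nat.shiftLeft x 32) (Nat.mod x 4146110323) = y at hdecode ⊢
  have hx := hdecode y rfl
  cases y with
  | zero => simp at hx; simp [← hx]
  | succ n =>
    have hx0 : x ≠ 0 := by
      rintro rfl
      have h0 : Nat.add (Nat.shiftLeft 0 32) (Nat.mod 0 4146110323) = 0 := by decide
      omega
    have h2 : Nat.shiftRight (Nat.succ n) 32 = x := hx
    simp only [if_neg hx0, h2]

/-- `q` without its lowest bit. -/
abbrev dropLow (q : ℕ) : ℕ := Nat.land q (Nat.sub q 1)

/-- The lowest bit of `q`. -/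
abbrev low (q : ℕ) : ℕ := Nat.xor q (dropLow q)

theorem testBit_land (a b i : ℕ) : (Nat.land a b).testBit i = (a.testBit i && b.testBit i) :=
  Nat.testBit_and a b i

theorem testBit_xor (a b i : ℕ) : (Nat.xor a b).testBit i = (a.testBit i ^^ b.testBit i) :=
  Nat.testBit_xor a b i

/-- Subtracting 1 clears the lowest set bit and changes otherwise only the zeros below it, so the
bitwise "and" with `q` removes that bit alone. The induction halves `q`: an odd `q` loses bit 0, and
for `q = 2 * j` the halves of `q` and `q - 1` are `j` and `j - 1`. -/
theorem exists_low (q : ℕ) (hq : q ≠ 0) : ∃ v, q.testBit v = true ∧ low q = 2 ^ v ∧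
    ∀ i, (dropLow q).testBit i = (q.testBit i && !decide (i = v)) := by
  have key : ∃ v, q.testBit v = true ∧
      ∀ i, (dropLow q).testBit i = (q.testBit i && !decide (i = v)) := by
    induction q using Nat.strongRecOn with
    | ind q ih =>
      rcases Nat.even_or_odd' q with ⟨j, rfl | rfl⟩
      · obtain ⟨v, hv, h⟩ := ih j (by omega) (by omega)
        refine ⟨v + 1, by simpa [Nat.testBit_succ] using hv, fun i => ?_⟩
        cases i with
        | zero => simp [dropLow]
        | succ i =>
          have h1 : (Nat.sub (2 * j) 1) / 2 = Nat.sub j 1 := by change (2 * j - 1) / 2 = j - 1; omega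
          have h2 : 2 * j / 2 = j := by omega
          have := h i
          rw [dropLow, testBit_land] at this ⊢
          rw [Nat.testBit_succ, Nat.testBit_succ, h1, h2]
          simpa using this
      · refine ⟨0, by simp, fun i => ?_⟩
        cases i with
        | zero => simp [dropLow]
        | succ i =>
          have h1 : (Nat.sub (2 * j + 1) 1) / 2 = j := by change (2 * j + 1 - 1) / 2 = j; omega
          have h2 : (2 * j + 1) / 2 = j := by omega
          rw [dropLow, testBit_land]
          rw [Nat.testBit_succ, Nat.testBit_succ, h1, h2]
          simp
  obtain ⟨v, hv, h⟩ := key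
  refine ⟨v, hv, Nat.eq_of_testBit_eq fun i => ?_, h⟩
  rw [low, testBit_xor, h, Nat.testBit_two_pow]
  by_cases hi : i = v
  · subst hi; simp [hv]
  · simp [hi, Ne.symm hi]

/-- All elements of `I` are bits of the mask `c`. -/
def In (I : Finset ℕ) (c : ℕ) : Prop := ∀ i ∈ I, c.testBit i = true

/-- All bits of the mask `c` are below `N`. -/
def Below (N c : ℕ) : Prop := ∀ i, c.testBit i = true → i < N

/-- The row of a bit `b = 2 ^ v` in a table with slots of width `W`, addressed by `2 ^ v % P`. -/
def row (T P W b : ℕ) : ℕ := Nat.shiftRight T (Nat.mul (Nat.mod b P) W)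

/-- The rows of the table only list pairs in the relation `R`. -/
def Sound (row : ℕ → ℕ) (N M : ℕ) (R : ℕ → ℕ → Prop) : Prop :=
  ∀ v < N, ∀ i < M, (row (2 ^ v)).testBit i = true → R v i

/-- No two elements of `I` are related. -/
def Indep (R : ℕ → ℕ → Prop) (I : Finset ℕ) : Prop := ∀ i ∈ I, ∀ j ∈ I, ¬ R i j

/-- Removes from `c` the vertices of a greedily chosen clique inside `q`. -/
def dropClique (row : ℕ → ℕ) (fuel : ℕ) : ℕ → ℕ → ℕ :=
  Nat.rec (motive := fun _ => ℕ → ℕ → ℕ) (fun _ c => c) (fun _ ih q c => casesZero q c fun q =>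
    ih (Nat.land (dropLow q) (row (low q))) (Nat.xor c (low q))) fuel

/-- Removes `k` greedily chosen cliques from `u`. -/
def dropCliques (row : ℕ → ℕ) (N k : ℕ) : ℕ → ℕ :=
  Nat.rec (motive := fun _ => ℕ → ℕ) (fun u => u)
    (fun _ ih u => casesZero u 0 fun u => ih (dropClique row N u u)) k

/-- Branches on the vertices of `u`, in the graph on the vertices of `c`. -/
def branch (row : ℕ → ℕ) (F : ℕ → Bool) (fuel : ℕ) : ℕ → ℕ → Bool :=
  Nat.rec (motive := fun _ => ℕ → ℕ → Bool) (fun _ _ => false)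
    (fun _ ih u c => casesZero u true fun u =>
      casesZero (Nat.xor c (low u)) true fun c =>
        Bool.rec (motive := fun _ => Bool) false (ih (dropLow u) c)
          (F (Nat.xor c (Nat.land c (row (low u)))))) fuel

/-- Certifies that independent sets inside `c` have at most `t` elements. -/
def bound (row : ℕ → ℕ) (N t : ℕ) : ℕ → Bool :=
  Nat.rec (motive := fun _ => ℕ → Bool) (fun c => casesZero c true fun _ => false)
    (fun t ih c => casesZero c true fun c =>
      branch row ih (Nat.succ N) (dropCliques row N (Nat.succ t) c) c) t

variable {row : ℕ → ℕ} {N : ℕ} {R : ℕ → ℕ → Prop}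

theorem Below.land {c d : ℕ} (hc : Below N c) : Below N (Nat.land c d) := fun i hi => by
  rw [testBit_land] at hi
  exact hc i (by simp_all)

theorem Below.dropLow {c : ℕ} (hc : Below N c) : Below N (dropLow c) := hc.land

theorem Below.remove {c d : ℕ} (hc : Below N c) : Below N (Nat.xor c (Nat.land c d)) := fun i hi => by
  rw [testBit_xor, testBit_land] at hi
  refine hc i ?_
  cases h : c.testBit i <;> simp_all

theorem testBit_remove (c d i : ℕ) :
    (Nat.xor c (Nat.land c d)).testBit i = (c.testBit i && !d.testBit i) := by
  rw [testBit_xor, testBit_land]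
  cases c.testBit i <;> simp

theorem testBit_removeLow {c b v : ℕ} (hb : b = 2 ^ v) (hv : c.testBit v = true) (i : ℕ) :
    (Nat.xor c b).testBit i = (c.testBit i && !decide (i = v)) := by
  rw [testBit_xor, hb, Nat.testBit_two_pow]
  by_cases hi : i = v
  · subst hi; simp [hv]
  · simp [hi, Ne.symm hi]

theorem testBit_dropClique_le (fuel : ℕ) : ∀ q c : ℕ, (∀ i, q.testBit i = true → c.testBit i = true) →
    ∀ i, (dropClique row fuel q c).testBit i = true → c.testBit i = true := by
  induction fuel with
  | zero => intro q c _ i h; exact h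
  | succ n ih =>
    intro q c hqc i h
    change (casesZero q c fun q =>
      dropClique row n (Nat.land (dropLow q) (row (low q))) (Nat.xor c (low q))).testBit i = true at h
    rw [casesZero_eq] at h
    split_ifs at h with hq
    · exact h
    · obtain ⟨v, hv, hb, hm⟩ := exists_low q hq
      have hc := testBit_removeLow hb (hqc v hv)
      have := ih _ _ (fun j hj => ?_) i h
      · rw [hc] at this; simp_all
      · rw [testBit_land, hm] at hj
        rw [hc]
        have := hqc j
        simp_all

/-- A vertex disappears only by being picked, and all picks come from `q`. Applied after the first
pick, this shows that later picks are neighbours of the first one. -/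
theorem testBit_of_dropClique (fuel : ℕ) : ∀ q c : ℕ, (∀ i, q.testBit i = true → c.testBit i = true) →
    ∀ i, c.testBit i = true → (dropClique row fuel q c).testBit i = false → q.testBit i = true := by
  induction fuel with
  | zero => intro q c _ i h h'; change c.testBit i = false at h'; simp_all
  | succ n ih =>
    intro q c hqc i h h'
    change (casesZero q c fun q =>
      dropClique row n (Nat.land (dropLow q) (row (low q))) (Nat.xor c (low q))).testBit i = false at h'
    rw [casesZero_eq] at h'
    split_ifs at h' with hq
    · simp_all
    · obtain ⟨v, hv, hb, hm⟩ := exists_low q hq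
      have hc := testBit_removeLow hb (hqc v hv)
      by_cases hi : i = v
      · exact hi ▸ hv
      · have := ih _ _ (fun j hj => ?_) i (by rw [hc]; simp [h, hi]) h'
        · rw [testBit_land, hm] at this; simp_all
        · rw [testBit_land, hm] at hj
          rw [hc]
          have := hqc j
          simp_all

/-- The removed vertices form a clique. If the first pick `v` is in `I`, every later pick is related
to `v` and hence outside `I`; otherwise the induction continues without `v`. Running out of fuel
only makes the clique smaller. -/
theorem card_dropClique_le (hrow : Sound row N N R) (fuel : ℕ) : ∀ q c : ℕ, Below N q →
    (∀ i, q.testBit i = true → c.testBit i = true) → ∀ I : Finset ℕ, Indep R I → In I c →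
    (I.filter fun i => (dropClique row fuel q c).testBit i = false).card ≤ 1 := by
  induction fuel with
  | zero =>
    intro q c _ _ I _ hIc
    rw [Finset.filter_eq_empty_iff.2]
    · simp
    · intro i hi
      change ¬ c.testBit i = false
      simp [hIc i hi]
  | succ n ih =>
    intro q c hqN hqc I hI hIc
    change (I.filter fun i => (casesZero q c fun q =>
      dropClique row n (Nat.land (dropLow q) (row (low q))) (Nat.xor c (low q))).testBit i
        = false).card ≤ 1
    rw [casesZero_eq]
    split_ifs with hq
    · rw [Finset.filter_eq_empty_iff.2]
      · simp
      · intro i hi; simp [hIc i hi]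
    · obtain ⟨v, hv, hb, hm⟩ := exists_low q hq
      have hc := testBit_removeLow hb (hqc v hv)
      have hsub : ∀ j, (Nat.land (dropLow q) (row (low q))).testBit j = true →
          (Nat.xor c (low q)).testBit j = true := by
        intro j hj
        rw [testBit_land, hm] at hj
        rw [hc]
        have := hqc j
        simp_all
      by_cases hvI : v ∈ I
      · rw [Finset.card_le_one]
        have huniq : ∀ i ∈ I.filter fun i => (dropClique row n (Nat.land (dropLow q) (row (low q)))
            (Nat.xor c (low q))).testBit i = false, i = v := by
          intro i hi
          rw [Finset.mem_filter] at hi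
          by_contra hne
          have h1 := testBit_of_dropClique n _ _ hsub i (by rw [hc]; simp [hIc i hi.1, hne]) hi.2
          rw [testBit_land, hm, hb] at h1
          simp only [Bool.and_eq_true] at h1
          exact hI v hvI i hi.1 (hrow v (hqN v hv) i (hqN i h1.1.1) h1.2)
        intro a ha b hb'
        rw [huniq a ha, huniq b hb']
      · refine ih _ _ hqN.dropLow.land hsub I hI fun i hi => ?_
        rw [hc, hIc i hi]
        simp only [Bool.true_and, Bool.not_eq_true', decide_eq_false_iff_not]
        rintro rfl
        exact hvI hi

theorem dropCliques_le (k : ℕ) : ∀ u i, (dropCliques row N k u).testBit i = true →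
    u.testBit i = true := by
  induction k with
  | zero => intro u i h; exact h
  | succ k ih =>
    intro u i h
    change (casesZero u 0 fun u => dropCliques row N k (dropClique row N u u)).testBit i = true at h
    rw [casesZero_eq] at h
    split_ifs at h with hu
    · simp at h
    · exact testBit_dropClique_le N u u (fun _ h => h) i (ih _ i h)

theorem card_dropCliques_le (hrow : Sound row N N R) (k : ℕ) : ∀ u : ℕ, Below N u →
    ∀ I : Finset ℕ, Indep R I → In I u →
    (I.filter fun i => (dropCliques row N k u).testBit i = false).card ≤ k := by
  induction k with
  | zero =>
    intro u _ I _ hIu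
    rw [Finset.filter_eq_empty_iff.2]
    · simp
    · intro i hi
      change ¬ u.testBit i = false
      simp [hIu i hi]
  | succ k ih =>
    intro u huN I hI hIu
    change (I.filter fun i => (casesZero u 0 fun u =>
      dropCliques row N k (dropClique row N u u)).testBit i = false).card ≤ k + 1
    rw [casesZero_eq]
    split_ifs with hu
    · rw [Finset.eq_empty_of_forall_notMem (s := I)]
      · simp
      · intro i hi
        have := hIu i hi
        simp [hu] at this
    · set d := dropClique row N u u with hd
      have hdu := testBit_dropClique_le (row := row) N u u (fun _ h => h)
      have h1 := card_dropClique_le hrow N u u huN (fun _ h => h) I hI hIu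
      have h2 := ih d (fun i hi => huN i (hdu i hi)) (I.filter fun i => d.testBit i = true)
        (fun i hi j hj => hI i (Finset.mem_filter.1 hi).1 j (Finset.mem_filter.1 hj).1)
        (fun i hi => (Finset.mem_filter.1 hi).2)
      calc _ ≤ ((I.filter fun i => d.testBit i = false) ∪ ((I.filter fun i => d.testBit i = true).filter
              fun i => (dropCliques row N k d).testBit i = false)).card := by
            refine Finset.card_le_card fun i hi => ?_
            simp only [Finset.mem_union, Finset.mem_filter] at hi ⊢
            cases h : d.testBit i <;> simp_all
        _ ≤ 1 + k := (Finset.card_union_le _ _).trans (add_le_add h1 h2)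
        _ = k + 1 := add_comm _ _

/-- Let `v` be the lowest vertex of `u`. If `v` is in `I`, the rest of `I` lies among the
non-neighbours of `v`, where `F` allows at most `t` elements. If not, `v` may be deleted from `c` in
all later branches. Exhausted fuel gives `false`, so it never certifies anything. -/
theorem branch_sound (hrow : Sound row N N R) {F : ℕ → Bool} {t : ℕ}
    (hF : ∀ c, Below N c → F c = true → ∀ I, Indep R I → In I c → I.card ≤ t) (fuel : ℕ) :
    ∀ u c, Below N c → (∀ i, u.testBit i = true → c.testBit i = true) →
    branch row F fuel u c = true → ∀ I, Indep R I → In I c →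
    (∃ i ∈ I, u.testBit i = true) → I.card ≤ t + 1 := by
  induction fuel with
  | zero => intro u c _ _ h; exact absurd h (by simp [branch])
  | succ n ih =>
    intro u c hcN huc h I hI hIc ⟨i₀, hi₀, hui₀⟩
    change (casesZero u true fun u => casesZero (Nat.xor c (low u)) true fun c =>
        Bool.rec (motive := fun _ => Bool) false (branch row F n (dropLow u) c)
          (F (Nat.xor c (Nat.land c (row (low u)))))) = true at h
    rw [casesZero_eq] at h
    split_ifs at h with hu
    · simp [hu] at hui₀
    · obtain ⟨v, hv, hb, hm⟩ := exists_low u hu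
      have hc := testBit_removeLow hb (huc v hv)
      rw [casesZero_eq] at h
      split_ifs at h with hc0
      · have : I ⊆ {v} := by
          intro i hi
          have h1 := hc i
          rw [hc0, hIc i hi] at h1
          simpa using h1
        exact (Finset.card_le_card this).trans (by simp)
      · have hc'N : Below N (Nat.xor c (low u)) := fun i hi => hcN i (by rw [hc] at hi; simp_all)
        cases hFv : F (Nat.xor (Nat.xor c (low u)) (Nat.land (Nat.xor c (low u)) (row (low u)))) with
        | false => rw [hFv] at h; exact absurd h (by simp)
        | true =>
          rw [hFv] at h
          by_cases hvI : v ∈ I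
          · have := hF _ hc'N.remove hFv (I.erase v)
              (fun i hi j hj => hI i (Finset.mem_of_mem_erase hi) j (Finset.mem_of_mem_erase hj)) ?_
            · rw [Finset.card_erase_of_mem hvI] at this; omega
            · intro i hi
              have hiI := Finset.mem_of_mem_erase hi
              rw [testBit_remove, hc, hIc i hiI, hb]
              simp only [Finset.ne_of_mem_erase hi, decide_false, Bool.not_false, Bool.and_self,
                Bool.true_and, Bool.not_eq_true']
              by_contra hR
              exact hI v hvI i hiI (hrow v (hcN v (huc v hv)) i (hcN i (hIc i hiI))
                (by simpa using hR))
          · have hne : ∀ i ∈ I, i ≠ v := fun i hi hiv => hvI (hiv ▸ hi)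
            refine ih _ _ hc'N (fun i hi => ?_) h I hI (fun i hi => ?_) ⟨i₀, hi₀, ?_⟩
            · rw [hm] at hi; rw [hc]
              have := huc i
              simp_all
            · rw [hc]; simp [hIc i hi, hne i hi]
            · rw [hm]; simp [hui₀, hne i₀ hi₀]

theorem bound_sound (hrow : Sound row N N R) (t : ℕ) : ∀ c, Below N c → bound row N t c = true →
    ∀ I, Indep R I → In I c → I.card ≤ t := by
  induction t with
  | zero =>
    intro c _ h I _ hIc
    change casesZero c true (fun _ => false) = true at h
    rw [casesZero_eq] at h
    split_ifs at h with hc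
    rw [Finset.eq_empty_of_forall_notMem (s := I)]
    · simp
    · intro i hi
      have := hIc i hi
      simp [hc] at this
  | succ t ih =>
    intro c hcN h I hI hIc
    change (casesZero c true fun c =>
      branch row (bound row N t) (Nat.succ N) (dropCliques row N (Nat.succ t) c) c) = true at h
    rw [casesZero_eq] at h
    split_ifs at h with hc
    · rw [Finset.eq_empty_of_forall_notMem (s := I)]
      · simp
      · intro i hi
        have := hIc i hi
        simp [hc] at this
    -- A set with more than `t + 1` elements has a vertex outside the `t + 1` cliques, which is
    -- where the program branches.
    · by_contra hlt
      have hcard := card_dropCliques_le hrow (t + 1) c hcN I hI hIc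
      refine hlt (branch_sound hrow ih _ _ c hcN (dropCliques_le (t + 1) c) h I hI hIc ?_)
      by_contra hno
      push Not at hno
      rw [Finset.filter_true_of_mem fun i hi => by simpa using hno i hi] at hcard
      exact hlt hcard

end Mask

/-! ### Searches for points together with signed lines -/

namespace Mask

/-- The lines hit by a mask `s` of `2 * N` signed lines. -/
abbrev lines (N s : ℕ) : ℕ := Nat.mod (Nat.lor s (Nat.shiftRight s N)) (Nat.pow 2 N)

/-- `f x`, with `x` evaluated once. -/
abbrev force {α : Type} (x : ℕ) (f : ℕ → α) : α := casesZero x (f 0) f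

theorem force_eq {α : Type} (x : ℕ) (f : ℕ → α) : force x f = f x := by
  rw [force, casesZero_eq]
  split_ifs with h
  · rw [h]
  · rfl

/-- Branches on the vertices of `u`, keeping track of the candidates `c` and of the signed
lines `s`. -/
def branchPair (row rowX : ℕ → ℕ) (F : ℕ → ℕ → Bool) (fuel : ℕ) : ℕ → ℕ → ℕ → Bool :=
  Nat.rec (motive := fun _ => ℕ → ℕ → ℕ → Bool) (fun _ _ _ => false)
    (fun _ ih u c s => casesZero u true fun u =>
      force (Nat.xor c (low u)) fun c =>
        Bool.rec (motive := fun _ => Bool) false (ih (dropLow u) c s)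
          (F (Nat.xor c (Nat.land c (row (low u)))) (Nat.xor s (Nat.land s (rowX (low u)))))) fuel

/-- Certifies that an independent set of candidates and the lines compatible with it have at most
`t` elements together. -/
def boundPair (row rowX : ℕ → ℕ) (N t : ℕ) : ℕ → ℕ → Bool :=
  Nat.rec (motive := fun _ => ℕ → ℕ → Bool)
    (fun c s => casesZero c (casesZero s true fun _ => false) fun _ => false)
    (fun t ih c s => force s fun s =>
      Bool.rec (motive := fun _ => Bool) false
        (force c fun c => branchPair row rowX ih (Nat.succ N) c c s)
        (bound row N (Nat.succ t) (lines N s))) t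

/-- Certifies that an independent set of candidates and at most `L + 1` lines compatible with it
have at most `e + L + 1` elements together. -/
def boundFew (row rowX : ℕ → ℕ) (N L e : ℕ) : ℕ → ℕ → Bool :=
  Nat.rec (motive := fun _ => ℕ → ℕ → Bool)
    (fun c s => force c fun c => force s fun s =>
      branchPair row rowX (boundPair row rowX N L) (Nat.succ N) c c s)
    (fun e ih c s => force c fun c => force s fun s =>
      branchPair row rowX ih (Nat.succ N) (dropCliques row N (Nat.succ e) c) c s) e

variable {row rowX : ℕ → ℕ} {N : ℕ} {R RX : ℕ → ℕ → Prop}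

/-- An independent set `X` of candidates in `c`, and a compatible set `Z` of signed lines in `s`
whose lines are independent. -/
structure Config (N : ℕ) (R RX : ℕ → ℕ → Prop) (X Z : Finset ℕ) (c s : ℕ) : Prop where
  belowC : Below N c
  belowS : Below (2 * N) s
  indepX : Indep R X
  compat : ∀ v ∈ X, ∀ z ∈ Z, ¬ RX v z
  indepZ : Indep R (Z.image (· % N))
  inC : In X c
  inS : In Z s

/-- Picking `v` from `X` deletes from `c` and `s` only what cannot occur together with `v`, so the
rest of `X` and all of `Z` survive. -/
theorem Config.pick {X Z : Finset ℕ} {c s v b : ℕ} (h : Config N R RX X Z c s)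
    (hrow : Sound row N N R) (hrowX : Sound rowX N (2 * N) RX) (hv : v ∈ X) (hb : b = 2 ^ v) :
    Config N R RX (X.erase v) Z (Nat.xor (Nat.xor c b) (Nat.land (Nat.xor c b) (row b)))
      (Nat.xor s (Nat.land s (rowX b))) := by
  have hc := testBit_removeLow hb (h.inC v hv)
  have hvN := h.belowC v (h.inC v hv)
  have hcN : Below N (Nat.xor c b) := fun i hi => h.belowC i (by rw [hc] at hi; simp_all)
  refine ⟨hcN.remove, h.belowS.remove, fun i hi j hj => h.indepX i (Finset.mem_of_mem_erase hi) j
    (Finset.mem_of_mem_erase hj), fun i hi => h.compat i (Finset.mem_of_mem_erase hi), h.indepZ,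
    fun i hi => ?_, fun z hz => ?_⟩
  · have hiI := Finset.mem_of_mem_erase hi
    rw [testBit_remove, hc, h.inC i hiI, hb]
    simp only [Finset.ne_of_mem_erase hi, decide_false, Bool.not_false, Bool.and_self,
      Bool.true_and, Bool.not_eq_true']
    by_contra hR
    exact h.indepX v hv i hiI (hrow v hvN i (h.belowC i (h.inC i hiI)) (by simpa using hR))
  · rw [testBit_remove, h.inS z hz, hb]
    simp only [Bool.true_and, Bool.not_eq_true']
    by_contra hR
    exact h.compat v hv z hz (hrowX v hvN z (h.belowS z (h.inS z hz)) (by simpa using hR))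

/-- The set `Z` stays fixed during the branching; `q` stands for its number of lines and passes
through unchanged. Only the mask `s` of lines still possible shrinks. -/
theorem branchPair_sound (hrow : Sound row N N R) (hrowX : Sound rowX N (2 * N) RX)
    {F : ℕ → ℕ → Bool} {Z : Finset ℕ} {q t : ℕ}
    (hF : ∀ c s, F c s = true → ∀ X, Config N R RX X Z c s → X.card + q ≤ t) (fuel : ℕ) :
    ∀ u c s, (∀ i, u.testBit i = true → c.testBit i = true) →
    branchPair row rowX F fuel u c s = true → ∀ X, Config N R RX X Z c s →
    (∃ i ∈ X, u.testBit i = true) → X.card + q ≤ t + 1 := by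
  induction fuel with
  | zero => intro u c s _ h; exact absurd h (by simp [branchPair])
  | succ n ih =>
    intro u c s huc h X hX ⟨i₀, hi₀, hui₀⟩
    change (casesZero u true fun u => force (Nat.xor c (low u)) fun c =>
        Bool.rec (motive := fun _ => Bool) false (branchPair row rowX F n (dropLow u) c s)
          (F (Nat.xor c (Nat.land c (row (low u)))) (Nat.xor s (Nat.land s (rowX (low u)))))) = true
      at h
    rw [casesZero_eq] at h
    split_ifs at h with hu
    · simp [hu] at hui₀
    · obtain ⟨v, hv, hb, hm⟩ := exists_low u hu
      have hc := testBit_removeLow hb (huc v hv)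
      rw [force_eq] at h
      cases hFv : F (Nat.xor (Nat.xor c (low u)) (Nat.land (Nat.xor c (low u)) (row (low u))))
          (Nat.xor s (Nat.land s (rowX (low u)))) with
      | false => rw [hFv] at h; exact absurd h (by simp)
      | true =>
        rw [hFv] at h
        by_cases hvX : v ∈ X
        · have := hF _ _ hFv _ (hX.pick hrow hrowX hvX hb)
          rw [Finset.card_erase_of_mem hvX] at this
          have := Finset.card_pos.2 ⟨v, hvX⟩
          omega
        · have hne : ∀ i ∈ X, i ≠ v := fun i hi hiv => hvX (hiv ▸ hi)
          refine ih _ _ _ (fun i hi => ?_) h X ?_ ⟨i₀, hi₀, ?_⟩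
          · rw [hm] at hi; rw [hc]
            have := huc i
            simp_all
          · refine { hX with
              belowC := fun i hi => hX.belowC i (by rw [hc] at hi; simp_all)
              inC := fun i hi => ?_ }
            rw [hc]; simp [hX.inC i hi, hne i hi]
          · rw [hm]; simp [hui₀, hne i₀ hi₀]

theorem Config.in_lines {X Z : Finset ℕ} {c s : ℕ} (h : Config N R RX X Z c s) :
    In (Z.image (· % N)) (lines N s) := by
  intro i hi
  obtain ⟨z, hz, rfl⟩ := Finset.mem_image.1 hi
  have hzs := h.inS z hz
  have hzN := h.belowS z hzs
  have hN : 0 < N := by omega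
  change ((s ||| s >>> N) % 2 ^ N).testBit (z % N) = true
  rw [Nat.testBit_mod_two_pow, Nat.testBit_or, Nat.testBit_shiftRight]
  simp only [Nat.mod_lt _ hN, decide_true, Bool.true_and, Bool.or_eq_true]
  rcases Nat.lt_or_ge z N with h1 | h1
  · left; rwa [Nat.mod_eq_of_lt h1]
  · right
    rw [Nat.mod_eq_sub_mod h1, Nat.mod_eq_of_lt (by omega)]
    rwa [show N + (z - N) = z by omega]

theorem below_lines (s : ℕ) : Below N (lines N s) := by
  intro i hi
  change ((s ||| s >>> N) % 2 ^ N).testBit i = true at hi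
  rw [Nat.testBit_mod_two_pow] at hi
  simp_all

/-- If `X` is empty, only lines still present in `s` are counted and the plain bound applies to
them. Otherwise some element of `X` is met while branching on all of `c`. -/
theorem boundPair_sound (hrow : Sound row N N R) (hrowX : Sound rowX N (2 * N) RX) (t : ℕ) :
    ∀ c s, boundPair row rowX N t c s = true → ∀ X Z, Config N R RX X Z c s →
    X.card + (Z.image (· % N)).card ≤ t := by
  induction t with
  | zero =>
    intro c s h X Z hX
    change casesZero c (casesZero s true fun _ => false) (fun _ => false) = true at h
    rw [casesZero_eq, casesZero_eq] at h
    split_ifs at h with hc hs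
    have h1 : X = ∅ := Finset.eq_empty_of_forall_notMem fun i hi => by
      have := hX.inC i hi; simp [hc] at this
    have h2 : Z = ∅ := Finset.eq_empty_of_forall_notMem fun i hi => by
      have := hX.inS i hi; simp [hs] at this
    simp [h1, h2]
  | succ t ih =>
    intro c s h X Z hX
    change force s (fun s => Bool.rec (motive := fun _ => Bool) false
        (force c fun c => branchPair row rowX (boundPair row rowX N t) (Nat.succ N) c c s)
        (bound row N (Nat.succ t) (lines N s))) = true at h
    rw [force_eq, force_eq] at h
    cases hb : bound row N (Nat.succ t) (lines N s) with
    | false => rw [hb] at h; exact absurd h (by simp)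
    | true =>
      rw [hb] at h
      rcases X.eq_empty_or_nonempty with rfl | ⟨i, hi⟩
      · simpa using bound_sound hrow (t + 1) _ (below_lines s) hb _ hX.indepZ hX.in_lines
      · exact branchPair_sound hrow hrowX (fun c s h X hX => ih c s h X Z hX) _ c c s
          (fun _ h => h) h X hX ⟨i, hi, hX.inC i hi⟩

/-- The cap of `L + 1` on the lines turns an excess of the sum into an excess of `X`: a sum above
`(e + 1) + L + 1` forces more than `e + 1` elements in `X`, so `X` leaves the `e + 1` cliques. For
`e = 0` it only forces `X` to be nonempty, and `boundPair` takes over. -/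
theorem boundFew_sound (hrow : Sound row N N R) (hrowX : Sound rowX N (2 * N) RX) (L e : ℕ) :
    ∀ c s, boundFew row rowX N L e c s = true → ∀ X Z, Config N R RX X Z c s →
    (Z.image (· % N)).card ≤ L + 1 → X.card + (Z.image (· % N)).card ≤ e + L + 1 := by
  induction e with
  | zero =>
    intro c s h X Z hX hZ
    change (force c fun c => force s fun s =>
      branchPair row rowX (boundPair row rowX N L) (Nat.succ N) c c s) = true at h
    rw [force_eq, force_eq] at h
    rcases X.eq_empty_or_nonempty with rfl | ⟨i, hi⟩
    · simpa using hZ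
    · simpa using branchPair_sound hrow hrowX
        (fun c s h X hX => boundPair_sound hrow hrowX L c s h X Z hX) _ c c s
        (fun _ h => h) h X hX ⟨i, hi, hX.inC i hi⟩
  | succ e ih =>
    intro c s h X Z hX hZ
    change (force c fun c => force s fun s => branchPair row rowX (boundFew row rowX N L e)
      (Nat.succ N) (dropCliques row N (Nat.succ e) c) c s) = true at h
    rw [force_eq, force_eq] at h
    by_contra hlt
    have hcard := card_dropCliques_le hrow (e + 1) c hX.belowC X hX.indepX hX.inC
    have := branchPair_sound hrow hrowX (fun c s h X hX => ih c s h X Z hX hZ) _ _ c s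
      (dropCliques_le (e + 1) c) h X hX ?_
    · omega
    · by_contra hno
      push Not at hno
      rw [Finset.filter_true_of_mem fun i hi => by simpa using hno i hi] at hcard
      omega

/-- `f i` for all `i < M`. -/
def allBelow (f : ℕ → Bool) (M : ℕ) : Bool :=
  Nat.rec (motive := fun _ => Bool) true
    (fun i ih => Bool.rec (motive := fun _ => Bool) false ih (f i)) M

theorem of_allBelow {f : ℕ → Bool} {M : ℕ} (h : allBelow f M = true) : ∀ i < M, f i = true := by
  induction M with
  | zero => intro i hi; omega
  | succ M ih =>
    have hs : allBelow f (M + 1) =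
      Bool.rec (motive := fun _ => Bool) false (allBelow f M) (f M) := rfl
    rw [hs] at h
    intro i hi
    cases hM : f M with
    | false => rw [hM] at h; exact absurd h (by simp)
    | true =>
      rw [hM] at h
      rcases Nat.lt_succ_iff_lt_or_eq.1 hi with h1 | rfl
      · exact ih h i h1
      · exact hM

/-- Whether `f i` is true, in case the bit `i` of `h` is set. -/
def ifBit (h i : ℕ) (f : Bool) : Bool :=
  Bool.rec (motive := fun _ => Bool) true f (Nat.beq (Nat.mod (Nat.shiftRight h i) 2) 1)

theorem of_ifBit {h i : ℕ} {f : Bool} (hf : ifBit h i f = true) (hi : h.testBit i = true) :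
    f = true := by
  have : Nat.beq (Nat.mod (Nat.shiftRight h i) 2) 1 = true := by
    rw [Nat.beq_eq]
    change (h >>> i) % 2 = 1
    rw [Nat.testBit_eq_decide_div_mod_eq] at hi
    rw [Nat.shiftRight_eq_div_pow]
    simpa using hi
  rw [ifBit, this] at hf
  exact hf

/-- Certifies that the rows of a table only list pairs that satisfy `f`. -/
def check (row : ℕ → ℕ) (N M : ℕ) (f : ℕ → ℕ → Bool) : Bool :=
  allBelow (fun v => force (row (Nat.pow 2 v)) fun h => allBelow (fun i => ifBit h i (f v i)) M) N

theorem sound_of_check {row : ℕ → ℕ} {N M : ℕ} {f : ℕ → ℕ → Bool} {R : ℕ → ℕ → Prop}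
    (h : check row N M f = true) (hf : ∀ v i, f v i = true → R v i) : Sound row N M R := by
  intro v hv i hi hbit
  have h1 := of_allBelow h v hv
  rw [force_eq] at h1
  exact hf v i (of_ifBit (of_allBelow h1 i hi) hbit)

end Mask

/-! ### The search for independent sets among the `E8` roots and the added points -/

namespace ExtendedE8

/-- The integer points with index below `338`: each point fills 24 bits, three for each coordinate,
which is raised by `4`. The indices below `169` are for the added points and for one root on each
line through the origin, and index `z + 169` is for the negative of the point with index `z`. -/
def pointTable : ℕ := 0x926922914914b5b6db76d75badbadbd22924aedb6b924d1452292476d6eb8a4922b6d76b922922addaeb75d6dbca49249a4524514924894924b6badb6ddb6baebb5b6ed76b9a2924d249226db76badbb6b6dd6eb934524d24914524524b6b75b6ddadb914524b6b6eb924894924994b6d6dbadb75b8a452452492276b76bb6bb6badb6eb5248a4924d22b6db5b9348a475bb6bb5bb5b9249329249126dd75b6ed6db76bb5b6dbaebb5b76b5269329148a46edaeb9949246edb5b76baebd2452492252475badb922914b5d75baed6eb7248dbb6daebaeb6dbd248a48a48a44a4924914922aebaeb9245149268a475d76b6ebadb8a49149329246ebae98a2924d149244a68a45229b49248a2b5d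b6b76b6db924ca476dadb9228a45148a675daeb9246db9b28a46dbb5b75db5b6eb75b9125268a4d324a49125149a68b452235baeb934922da2914b5baeb8929229244a45149b45a29a48a25a48a49b28a24a45244a292371b5244a6536914ca48a29a2932b6d6e9c94922cb49226ebb6bd12922d22522934914b5dadb7257649228969265249149b2add76baed75b4a49169a49228929a491b8e391b7236eb6eb9269146db6db5249145a252475b6eb9a48a4b5d6eb52253476db6b924522912924d329225a292675b75b9249a2916916926ca24945249a4914522522aeb76badd6dbaddb5baedadb912514d145149229269349346edb6dadbaed76d76d52692475b6dd924534d26924adbb5d9a49266dbadd92692676b75daebb6d5a49248a4d24d349249b49246dd76db6b6dd75d6edb5badd8a6924524926b6dadd76d6ddb6bb5d914d24524934d24d246ddaedb6b76d934d246ddb5d9249b49248b46dbb6d76daed9a4d24d24926addadd6dd6dd76db5dd249a49245266db6ed9149a4aed6dd6ed6ed924916924936b6baedb5bb6dadd6edb6d75d6edaddd229169349a4b5b75d8b4924b5b6edadd75d524d24926d24aed76d9269346ebaed75bb5db2496d6db75d75db6d5249a49a49a4da492493492675d75d924d349229a4aebaddb5d76d9a4934916924b5d75f9a6924534924da29a4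d268949249a66eb6ddaddb6d9245a4adb76d9269a4d349a2aeb75d924b6d8969a4b6d6edaeb6edb5daed936d229a4516da4936d348a2994d26eed75d9149264a69346ed75d9b6926924da4d34894ca68a49a6ca49a48969a6da4d24da6925b2dd24da2d129345a49a68a69166dbb5f5b4926594926b5d6dd536926526d269149346eb76db23ae49269b2922d2493489676badd75baedda49328a49269b68a492d96592db25b5db5d922934b6db6dd24934ca6d24aedb5d8a49a46ebb5dd26d14adb6dd924d26936924516926ca6922aedaed9248a69329329225a6db4d248a4934d26d2675dadd76bb6d76b6ed75b76d936d34534d34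

/-- The indices below `169` of the roots. -/
def lineMask : ℕ := 0x1ffffffffffffff7ff7ffd9fa702a0004cb47bb98bc

/-- For each index below `169` the indices below `169` of the points that cannot be chosen
together with it, if choosing a line means choosing both of its roots. -/
def conflictTable : ℕ := 0x76e305cc3f3debaa95c8a734419bd4593541f7bbc5b68e5afb449f4371dc9a27bcd073eade2f1222ded1f3a18bc139b0af6657c1b3b50c8cce74999a27c7df7d91daffcbdcba0822a5808075b9e3b10eba467bdf385a5be1f29dbb834e44fe0e35da0ec6c6de0147d4fee72caeeb6092d98973d5bd7452c0be82083b8f2b687f14cedafe59af3b46e5d204d0a0028001486a40e18ab086a6bcf95cdf289816a1a2f571d8831fa983f14d562ba8b574752c65d7911d85455f3f2673fe5ed4b9e58a4c0e91111dfd919dbdff885c95fb821cc8478ccdba751ab94d1022c8b4321cf2bb6af6dafe4b0e1ae77f315a9588d8fca64e454d2232ddccdc07477d1ed911abd829af7463390d1d144082409c5219b88a507f277edd8958bb89b06cca618840000346051844ce244296a0dddff1135c91b66ee8f2bbe78ebe1aa9cdecc7ea398658e53d54f7119a527a5fc70e9bcec9944558b383a26d375babf964a9b9dc4356f383c41ef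77a9980a83645908fd78cdc7efb76d95a3aad4b7d36495bf4207a6814b3c1c6f45f8429275569eeefd04de988972c13c7d7575ecf26b3dc196d9637f1331c502fbc823e801df1169bfa9d067a832160489d199a0aa85e999e62785fc93bf2dcb68b4627dcd1d2740abc7df9b677dca092a7656f984a01f40b20c382c737ef98af7612b4517b8fe7b50a3ba6036edaa9a9d855c9cf050492a2db575dbf3c4c62d33733970d936efd7aa373aef21908f714d335bb586920450664a58e59651a4a56cef982cf43e2c2f1ccffe7e7891ea6fe0f52411b71fc47b9440156facb3fea51d1ba8f7d15f51c9a8e9ab99318b0ff141ced5a919160870858e063319fae1181a59fc277df4b636a1d66ad7bda3f41386e420a742be924c17e1bf33757e2798c31c37bd24b5b963e37e5df42836d0bb133cef630d5e2f682ed98f11ed865922dcc9e27c494771a3acd9c7ec9d58bd47ffd807d62be39fb357cbc055d509b5597af7c487c0987d1d4a791e57f55fd9cc05f65324c88000002e00a8029386414c57a70868ffff87ce5f60429192e3bad6e828d5799f3e50c1d2d073fae689d34f38370d0d2d191bff76b693ea1a1874b228bebc8ad219c5295eee9274f376e13cefb401027bdce26c580e81102655981a241ac52d6a5fccd02a2e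d39ad52193f4ac1fe34b90f7b7f7250b4f45b8e5a7d5bc15218844a8150422589faa15fcdfc79f545267364af801940750023c16bce220000000000000000000000000000000000000000001ecdd550e6933341e3ed9fb3048c250491c8853150119b08915c5db19cf0f27efabd0afd5981d216fad1f48df70ff1769e1427f5f3af342481925bd6ea29959d3c503430c467a4efcc7c16b8fc6fc799367ba5f09c1b57ade985e686ee2bacf55c133e177e14387dc4c6b0e6ed683953fed4b1f38f01c4bc8b469b70986d9163a85dd4f32de0dbef32e0c3a7434e5b291abc003e3519949f632fbd55d551cc52ec260039a257a0420119746c39666513c3309fcc79500c1084f1a09bfb0f855f96feeacd04be44c4d89609be9c38dbf013dc6146909f46f7b79c3ab45ecd732ebcd7dce5252fa08512ced824125bd2b552d256fcc46db05845a59fa7ccde35c0faf2d4f8949c1483bf361efe919fde6c3c4672011fc943dc7f270726bdf7d6ee03492a8453ac355fc3f3ec55d6cb1211b943ba2873fb215a830681afde16c3c4bb4d8c64e0fa7ba42af982cbf056a8ee0cf6c26f0ef34ad5f8f5eaf831d58acd0ce514678859e9ffff2a064084a17ee42ec88aef0a612a0d2c67111b601aed5fbac095d88583ab1b2aa2ef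3f9f7df5c8bd669aca2e99368fc1ae2367e7888829e297a8244323528740ad765f2b5a9780c911adb10f66e787a2f756370675baa37a4d7281de9eb72aead68a812dfb753ce6cbe302625195ac4e4a99ccccf2e5e1372547fd43afe9abf50f6e85861e8f72a3ade9f4beee39e8378027adabda6841aa635e85ff8b7943572f6ca6b92a53ea129dbcb36d72c96bf34705c06f738dfc029f42d960b8dffd81d5b01b6a4967e0624b4140c023de2fb109207b6bfbd58fa531275c129d5f51e858ced226da909bf95e1626a0b159fde533d3955ff53aa672a1940c34af23dede86c5959b604ade80fec5d45fabaa82fce8e6eb6db424b2f60c2d307f6276f1d242ca3ff740edaf14bdb7c9f7eea960a6009e48c83274c54fc0aeab6fefe1e5e07d8cc9790916c063119f77cf297568f66da9d70e5e1eac52145f75bd1eb03e7f57055ce5081da6898bfe3b98821f8d2d24c481a018f6ca37d29c26ecd77a91d9601ccb1ea0f74082b024128678646573fb7b3296f324c6d0c26e9a9394e95dbb415559749f72d4d9dbc11d053cdd9ecaa998420a406357918092e11fb59407fd89fc68bf197c2853a00c70974180046da782142d2ad931768f98dfa979ded8eac889f61f459e7b4c5aae6be5cb5370092936765655763c77a8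37c2ffb43ac4935cacd2e8633c75c66e98b58dad91500000000000000000000000000000000000000000065624f7a743ccb26adba161ed4b30b3a0212c8d2b936b9df87836186c89be30a69cf46fcc68b26aac8db7f2597690caa97499573af001f238711fdcf24ff3d547b20f85a69d472284dd6a5aad97af00657a5bc86b491f5094709a8756652d5d7f5d4aabb6cf90767f58a7770e3defbf8ec0e8a184af89ea7e3841d3786d837993d265ece7f686a8583f103340024358204b19898b96c83201b5476d6b446cffc4d4f4552b77f2f966d3ae92807be35e171fb43933fea46b788f71ebab5d00f20fd42f1c2d78b7478ab4f8f3ae1736923229e4bec44ad18b75b661f907e0afd3b4f48b62d075b27dadda6e377218637c68265b7be68fdceadd6067987d4721da50242ea3d9952f2a607936d9d7b734ff4e47e7e47d591ea27bebd08392fad65fa4a73e1770d8090d9b97ae78b05807334ec73de369da9a4a1d77ac491e701279c97b9ec3a4311ede3f318e9ea3ebb226e95fcce7e85d6de647a8034f12c73fd4357c6d95db513ba2da23d4dafd16dce4184f7050495c2846861b16a55082cfc9ff8fc9edb21c6ca81759752fc7c448cd74f6b6071397517a24ba954d35fd42b4f31963ef1180fb5bd4e3367eb9bcb964bbcb2684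b804880a10370446000000000000000000000000000000000000000000066cf863ac6357f04c76f7ba842e6d045604280892ed2f780288ad8a5fd9c565f43bc0133778adbd7cf1c4a32567bb739964a49f7be2164adbb13ac0392ca9782043b8da1d7af87fcf69979912c00400b0057b3141dea7f369e87fc326b8b2231d2006b9092aea66c79ef0942b48b5d1add3daf416fc17eeb649b133e3dac82ca922772f4f98b089cec6ec9fb88967fc2763d3d8b2db3930afea8fe37671c90970010000fb4b825a0067a571e7b21b1afdaa2a36a4ca60796ccbb0e656cf9065a0ddb8f46227819b5d5be3004c4224527eb583e503f7f531de1c5b6dc00726dc08282c00a31e026ed195695911deaf733d44876c31d26cce5c7bae6f10c55d77f7d5abc9099382637cd48770dfe46af10786373c0abc67d2ee19e69035ff7f8e2c9c0ae871b927053eb5fbaaf7680dbba645014d73a85b5d82409d6cfdb29375e63f673c6184a8db1f07087bc894222036361cf99e2473abd981e79bb1d0653200300f203330d20eefd2c4f5836bc1b0063a13e3405400060f24cda986e1a1d54cb92af289ff75ead7e0965cbd3a0208b6c85f465c1cf5a8195ebfbb60f32cc65fca334d2447ce54ebfd36871a8472dfe32de3de67f00326f95b7a4163045b9ff8edfef7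489415b0075512ddd9cc52afaf3a69b1aa9f2c86741ef1b61304d11c3eade5ff7d6cf80e0a406f846cffdf54bae3edfe3ab3d079435d5653aaae3375636b981d6a281ff2addc2489761a5d04e242f1d764b95de5e859e26a91de71926f21b183acf419e394e237e26a418e3729e99038015881caee42b07520c176bf477f0c57cff267e3b1396199bc1a8ea25b024d76c1847b9254fdc1fa6062a004432a3699909aa70676538ed73870579e5b89488ec7759ca34cea6a55991f7f2239c6afb5112a8650800124b46ce94317a9a7739f7413a45484be355904501f122c94d13617189722c990fbe2c6debafc8454e17f29ce92eb25c1023e0eae5ff8daf14f80698d717f813b2ff38b53ebafa7fe143d89b559407466b88409581345cd90e425450aad6367063cfb811fecf6f9af4a89783eed2f03a7ad46e591dcd7ecac642a34c25cc8367e5ab8bccbe90f5ba280a337a39b656c9828a1302056963d5c742796838965fe355f722cf22baf373b6241a1699eca734c11b532cdba6f46bed6044cfb366eaba741dd86c9f489cfdb4321aeb5b1d6c2dd952de079f3fc0c77cdd9c409fc0f6f791bd5da54293fa853c5e4be1d98a4aa2cfd69622f14f8c459b0d8a3a10a5f6f897022b5b1be2ca2cb06b26da67f9ec4a2ba9258357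1b2e4e4a0ca6e9ec05b6a7be3541199401000c0ce63ab583b7c4ac40face6d57c87ee48833a7fe1d7b077b14882cd14706bced8a25df184b2581c50c1111ad2aba2321eee2cf89d1cd7a1073a25898996638da3d6f03b13e2eb1bcd6511ec339cc5314faf3ed1c6b805cf49fa2f80b27dfdcb0804fba7088f12017004c470b490d1661bd529ce1973aed780a7434e09c1c4ee7fdd978fa64e5b6c6ad39a9db123a68b9b55f4671998ad50c789b977b810f2359b2551608b6219232416ce530a19aea868bf5d4747c13a91532a9782b1577fbea239f6af0498eeb662b4380a1c5f165e8c2f943e00d1eaa614e17bcd8af717c22ed86918700d118600a468e1f338c6834a4a2ab614f72d7df13361e6cb8ce9c618b96e1e7ca5eee66843807e614352babde852e7fc97cd1942b5b39fc7d47784750e44619b3848008375997d4c47bbee0e0a8fb1214f7ba8265bdfac48bcb1fa2eb270e8b454725770d646e8687ccf76ca43742e6d9b49e24fa2e1b321c3f93d73071dbc296dd050412305241a466f75a38c9bbc57ae8d263e940d9401c40838407503b0eaa0477f7eeb28ee3806410640026962e132910000000000000000000000000000000000000000000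

/-- For each index below `169` the indices of the roots at distance `4`. -/
def signedTable : ℕ := 0xedc60b987e7bd6552b91026080140000028367310876e305cc3f3deb2a95c88130400a00000141b39884b68e5afb449f4331d89a24bc10110002250200cc505b472d7da24fa198ec4d125e08088001128100662839d0c5e09cd857a32ae0d91a0604400008481363079ce862f04e6c2bd195706c8d03022000042409b183cf6476bff2f72e8208a9600011005000020a119cc5c7b23b5ff97b97410454b00008802800010508ce62e30b4b7c3e53b77069c89f81c4a0400008928020301985a5be1f29dbb834e44fc0e250200004494010180cee72caeeb6092d98933d48d500040000208398c016773965775b0496cc499ea46a800200001041cc600b01202052d2d0002048010a00020000000000001204016c4312029166a4c91b100802028000000421a001862ac21a9af3e5737ca2604a8281500022083c8405c315610d4d79f2b9be5130254140a80011041e4202e29aac57516ae8ea58cbaf22300000000804877431294d562ba8b574752c65d79118000000040243ba1894b9e58a4c0e91111df9918cbd3800000061821cc8465cf2c5260748888efcc8c65e9c00000030c10e64230666dd3a8d5ca68810645a190e014000196877210703336e9d46ae534408322d0c8700a0000cb43b908386b9dfcc56a562323f29928153000000221201d0c5435cefe62b52b1191f94c940a9800000110900e862a04302042801240808000080a0000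000010001240101cc1018a98208f3423390918040080000410109882406f017e9009583908b0088a4080400000020118400008130026c00041408032200080000001200200026312214b506eeff889ae48933460500001860f0510618910a5a83777fc44d724499a30280000c3078288307b31fa8e6196390f513dc4641014000041a2d180443d98fd4730cb1c87a89ee232080a000020d168c02208ab1670744da6eb747f281506010000986070031684558b383a26d375ba3f940a830080004c3038018b47a9980a83645908fd38ccc7c3814000220a1494c163d4cc0541b22c847e9c6663e1c0a00011050a4a60b24adfa103d340a49e0e37a2f4204000090607760069256fd081e9a0524f071bd17a102000048303bb0034a6225cb04f1f5d1d7b3c88cd300500004580cc404053112e58278fae8ebd9e44669802800022c06620200419003c0039a225068400004404000081280120050db002208001200418389d06000020000800190808085e999e62785fc93bb2dc86830000000052340884642f4ccf313c2fe49dd96e434180000000291a044232fcdb3bee504952b2a7cc2100e004000180031331497e6d9df72824a95953e6108070020000c0018998a42bdd84ad145ee3b9e9428ce900110002602215405215eec2568a2f71dcf4a146748008800130110aa02920a092545b6aeba7e689881a460440009068d723141050492a2db575d3f344c40d2302200048346b918a04180600008000000202048002000000000004040001917490c807b8a4988cd80348002800012c10c820d252b677cc167a1e16078e23f4201400011680721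009295b3be60b3d0f0b03c711fa100a00008b403908046dc7f11ee510051beb2ceca9000400006403d4404a36e3f88f7288028df5967654800200003201ea2025041420020100c000008080020000000011004240100c90a99218309f141c2d18908100800040204211838e1181a59fc277db4b236a0d428150002640384c400708c0d2cfe13beda591b506a140a80013201c2620013a15f49260bf0cf98babb134c010000980052501189d0afa49305f867cc5d5d89a60080004c00292808c8df977d0a0db42ac48f3ac8c3010000021221c441646fcbbe8506da1562479d6461808000010910e220b0cb245b993c4f8828ee34319020540009168877310065922dcc9e27c414771a18c8102a00048b443b98807d62be39fb357cbc015d40991015000040200984503eb15f1cfd9abe5e00aea04c880a8000201004c2280a0348701888384a6026021100000000004005000410284041539163420004d8040302000000900020084e1905315e9c21a3ffbe1e0951810000020a295880a70c8298af4e10d1ffdf0f04a8c08000010514ac4051aaf33e7ca183a4a0e7f58110a0140008120a523030d5799f3e50c1d25073fac088500a00040905291818ff76b693ea1a1834b228acbc081000002102cc80547fbb5b49f50d0c1a5914565e04080000108166402a3089509c32c00001040c51100c000000012040010204991001228d00401c7110130002a000080442000806b14b5a97f3340a8bb4e68540005000065810c405e358a5ad4bf99a0545da7342a0002800032c086202f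24c4020002093083048040024000000008084001110595240b4e4120a425159c1401000000000002180308052c85849c0040410240000180000000181418c00108682d2181aa09131a056400000000010000420010000000000000000000000000000000000000000000000000000000000000000000000000000000000000690115011a00400181846c04000000004000004040091b202140264683051900640808000102910a420023361122b8bb6329e0e4f9354a0540000120257103919b08915c5db194f0727c9aa502a000009012b881c48df70ff1769e1027b5f28f1000000002522808858246fb87f8bb4f0813daf947880000000129140442c29e281a186233d277e63e035460140008920d5230494f140d0c3119e93bf31f01aa300a00044906a9182406d5eb7a6179a1bb8aeb2c550005000205021d4010036af5bd30bcd0ddc575962a8002800102810ea008161cddad072a7fca963e71200805000091681301120b0e6ed683953fe54b1f38900402800048b4098089063a85dd4f32de09beb32e0c12001000221029c001e31d42eea7996f04df59970609000800110814e000f10008a04b002020a0008c0004400000001005000000546202580caee507550111481008000481440108044101200499000c040066000000000000448040000e12684870804a2184610c907280080001000106e6080abf2dfdd59a096c8889b12c020500009160273002855f96feeacd04b64444d8960102800048b013980146909f46f7b79c3ab41ecc430280500024002d808503484fa37bdbce1d5a0f662181402800120016c04281676c12092de95aa9692b326020500000928f532068b3b6090496f4ad54b4959930102800004947a990348d703e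bcb53e25270120eccd0015000265830d001c46b81f5e5a9f129380907666800a800132c186800e0023f9287b8fe4e0e4d7ba3a4c00400010087502038011fc943dc7f270726bdd1d2600200008043a8101cc3f3ec55d6cb1211b943a828301100020102818c5e61f9f62aeb658908dca1d41418088001008140c62f0b61e25da6c632607c3dd2154c014000094077021305b0f12ed36319303e1ee90aa600a00004a03b8109809bc3bcd2b57e397abe0c45428140000418201440604de1de695abf1cbd5f0622a140a000020c100a2033e7a1404810142cd885d90054e0440001808c6221280c220040004001020000088000000000020000002001aed5fbac095d88583aa0b02804000065835c885600d76afdd604aec42c1d50581402000032c1ae442b104010400000300810000114440100000800021010124b209a64da2702b00d9d140000200048a01000814a1d02b5d97cad6a5e03244692801000061a09dc40c50e815aecbe56b52f01922349400800030d04ee20620ceb7546f49ae403ad3d2254c004000012866231490675baa37a4d7201d69e912a6002000009433118a4cbe302625195ac0e4a99cccc300500022503dd400e65f1813128cad607254ce666180280011281eea00734d5fa87b742c30f46b951164400400018601340139a6afd43dba16187a35ca88b220020000c3009a009cb6af69a106a98d3a13fe2ce50814000200a0894c085b57b4d08354c69d09ff1672840a0001005044a604253b7966dae592c7e68e0b0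04e0500000128853201129dbcb36d72c963f347058027028000009442990088d3d18050a00b284121804003014000221a00100120061600c28808210403300120000000002016c000003db5fdeac7d29893ae0902a4a054000100036500481edafef563e94c49d7048152502a00008001b28024fe578589a82c563f794ce4e51015000004a045000c7f2bc2c4d4162b1fbca67272880a8000025022800615e47bdbd0d8b2a36c095b100e00000091605053150af23dede86c5951b604ad880700000048b028298a8e6eb6db424b2f60c29306c60301100024023d5404c7375b6da12597b0614983630180880012011eaa026178a5edbe4fbf744b053000f040400000020e053158bc52f6df27dfba25829800782020000001070298acbfbf879781f63325e02448010804000224a1d580585fdfc3cbc0fb1992f0122400840200011250eac02c1b53ae1cbc3d58a428beeb3a0c0040008808b142100da9d70e5e1eac52145f759d06002000440458a1080d868909fe3990821f8d2c00c0810000064a35c0842010004100010400000000020000000010000008000010420400808002240a001100001000000000300001b314dca436180620c2a8115020200004810601181cfedecca5bcc931b4309ba4a4201000024001544c067f6f6652de6498da184dd252100800012000aa260322480b292001800502b29114000000000860400002060948092c1110514c00a400810020000004591808061029104040900286086003c000100006001400000400e924801fa44ca041c842014080000004100c00236d3c10a16956c88ba47c82f4404400011604473079b69e0850b4ab6445d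23e417a202200008b0223983c1679ed316ab9af97294dc024201100004580d1cc000b3cf698b55cd7cb94a6e0121008800022c068e6002f85ff68758926a958a5d00648010000116813530297c2ffb43ac49354ac52e8032400800008b409a9814000000000000000000000000000000000000000000000000000000000000000000000000000000000000100020011200000244010100000000000100400010115883de140f32c0896e0507a500800000041230824dae77e1e0d861b226b8c28a538110002248289004c6d73bf0f06c30d9135c614529c08800112414480263e4b2ed219552e832ae75a000e05000099084172129f2597690caa97419573ad00070280004c8420b909407100585240542020088205800140000602009004220510500414c0290402aa400140080000281286404248fa84a384d43ab3296aa3f0e05400001483333041247d4251c26a1d5994b551f8702a00000a419998209ddc38f7befe3b03a28600bc200100000501c1840c4eee1c7bdf7f1d81d143005e100080000280e0c2061020a040900220081000400044000000000016121011838245a4e6e682a0581d100100000048204010818b96c83201b547696b046ccfc0805000225230d844c5cb641900daa3b4b5823667e04028001129186c2261d749403df1af0a8fca1c91f4401400019085552000eba4a01ef8d78547e50e48fa200a0000c842aa90003c83f50bc70b5e2dd1e2ac3c38010000248088480e1e41fa85e385af16e8f1561e1c008000124044240718895a316eb6cc2f20fc113a460400001808b643158c44ad18b75b6617907e089d2302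00000c045b218acda6e377218637c28225b68e4081400006023984c466d371bb90c31be14112db472040a00003011cc262310ed28121751ecca9695303c0a0440009868a72313887694090ba8f6654b4a981e050220004c34539189c91f5647a89efaf020a4be85938100000458340041648fab23d44f7d7810525f42c9c08000022c1a0020b372f5cf160b00e669c8e7b064205000018685012149b97ae78b05807334e473d83210280000c3428090a401279c97b9ec3a0311ede0f11801000221224c845c0093ce4bdcf61d0188f6f0788c008001109126422e273f42eb6f323d401a7892394e0100000828d20115139fa175b7991ea00d3c491ca7008000041469008a81080c102084082080001000010000000000041084053041a1a5b829a988109660a000a800010c142400a1059f93ff1f93da6428d91024a0400009808112216882cfc9ff8fc9ed32146c881250200004c0408910b4b6071397517a24ba914d24fd0014000061a311805a5b0389cba8bd125d48a6927e800a000030d188c02d01c041090208900000000110000000000000000001161518491eaa2726592ef001a10200000084098101000000000000000000000000000000000000000000000000000000000000000000000000000000000000000c140010000800000a08114000000000800400001860c58632c6317f04c26b5108402200040040808820d2f780288ad8a5bd98564c41380100020083d5cc1c697bc014456c52decc2b26209c0080010041eae60e25192b3ddb9ccb2524fbdb10020440009000c16103928c959eedce6592927ded8801022000480060b081c08102e3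487163c1513da44c00010000024010484100000600100244105700010120000000000002c24203bd4fe6d3d0ff864d61640230400400001484450139dea7f369e87fc326b0b20118200200000a4222809cf0942b48b5d1ad93daf404fc100400002123c1c848784a15a45ae8d6c9ed7a027e080200001091e0e4241654913b97a7cc4844e763364e0440009800b161040b2a489dcbd3e6242273b19b270220004c0058b08208264604281882d0408430001000000020502010000248442401f110944e8c212120002000030100424000f4ae3cf643635eb54546909040040009160c4211707a571e7b21b1af5aa2a34848200200048b062108b8061004890f0200001984440000000000450100001e002504a94022111c0018c05e18020001001164a400080625290a90a0826c000910000100000008001314100ccd4042302124810018132000200000807800014655a564477abdc8f5121c80c3011000204a399c41032ad2b223bd5ee47a890e406180880010251cce2082baefefab5792122704c6b1a00040000894820700695d77f7d5abc90913826358d0002000044a410380343c0abc67d2ee19a69035ec7d0804000260219904041e055e33e9770cd3481af63e840200013010cc82021f5afdd57bb406cdd22280260804000081204632168fad7eeabdda0366e911401304020000409023190b4ca0514809c045004128244581000000040800000480024618c30cc50c100109412040080010000406408299324484115b002c626412040040000084006610408300c0053210180840891000500000008003000000ae7d040d103634130042a03c0005000060a20c8018204014212400440400108000180000000000202400370d0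eaa65c957844efbab160e04000089401041161b86875532e4abc2277dd58b0702000044a008208b017d197073d6a0617abeec83c0811000204834900520be8cb839eb5030bd5f7641e040880010241a480290a9d7fa6d0e3508e5afc613c4a0440000048236300054ebfd36871a8472d7e309e25022000002411b180063045b9ff8edfeb7489404b0001500004180508c0e31822dcffc76ff5ba44a0258000a800020c02846071d34d8d54f96432a0e78db09020000001060f732160e9a6c6aa7cb2195073c6d848100000008307b990b0e0382901be11b3bf7952e88d3010000241a10d4458701c1480df08d9dfbca974469808000120d086a22c27555c66eac6d7203ad4503f44010000106834320193aaae3375636b901d6a281fa200800008341a1900c242f1d764b95de1e819e24a918050002600318084e12178ebb25caef0f40cf12548c02800130018c042700400403010201000871b80f00004000000052001090478c52085e89210200008026008000400402b90281d48305dafd1df8311f3ec993804000064230480080ea4182ed7e8efc188f9f64c9c02000032118240040b404122480085004a93b82f00044000082042001200100446481805310006000826000000402002298009aa70676538ed73870578c59080000026580814c4a4d53833b29c76b9c382bc62c8400000132c040a625250a448b0b911ca146c20810020000009048006001881044025a000021080c4002a000200000001b080005ca295ce7dd04e815010e8842011000040a25044580102040000000008010100288000000000000080002e312e459321f7c58c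bd713908014000110825520397189722c990fbe2c65eb89c8400a000088412a901c1023e0eae5ff8daf10f804981015000220a318841e0811f07572ffc6d7887c024c080a800110518c420f045d07a021284d808202a0344400000098284001010c901c28406200152400818080002000000012010005142ab58d9c18f3ee047e83d38010002440399484028a155ac6ce0c79f7023f41e9c0080012201cca42034f5a8dcb23b9aed948c81060801000089485713111a7ad46e591dcd76ca4640830400800044a42b89888e9071080800314211b4444980001000044800c004400042591005011c14010940014000000000108a60813cb41c4b2ff1aafb8167915460100000040b4430509e5a0e2597f8d57dc0b3c8aa300800000205a21828cd3046d4cb36e9bd1afb481130040002248105441a6698236a659b74de8d7da40898020001124082a20d13e9139fb686434d6a63a9050a0040009160f0100789f489cfdb4321a6b531d4828500200048b0780803cdd9c409fc0f6f791b95da440101000004403c1c80a6ece204fe07b7bc8dcaed220080800002201e0e405255167eb4b1178a7c622c90644050000996843011592a8b3f5a588bc53e3116483220280004cb421808ac6c6f8b28b2c1ac9b699fe4b12804000205004c88183637c5945960d64db4cff25894020001028026440c0410008280024105000880020000000011005040000804a6a8ac0496253e31011884000000042412918387c4ac40face6d53c83ee48813815000220239148023e256207d6736a9e41f724409c0a8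0011011c8a401228808252544410c40c2112400004000096041000102011808611408115c0024040700000040040a288807bb8b3e274735e8418e88424201100020503c0cc4e3ddc59f13a39af420c744212100880010281e0662705d6379aca23d867388a621f4e050000100896131402eb1bcd6511ec339c45310fa702800008044b098a07002010f5c000009b0000020000100004401480800440493684058400305384468900a0000008100820b30dea94e70cb9d66bc053a1a400400001168e43015186f54a73865ceb35e029d0d2002000008b472180a89396db1ab4e6a72c48e9a0e410150002642354004249cb6d8d5a7353962474d072080a80013211aa00212404a4020c0281048220002c4004400019084140108995298009221930140608800100000040201001828a868bf5d4747c13a915328950011000224a219c40e54345faea3a3e09d48a9944a8008800112510ce207004012002002000500088006440000000000504000010632ad88ac0e00071385948102a0000034528981081461000940f003a408000c010040000002105004202549315a4280440909230001000000100c14066000d069494556c29ee5afbe22642050000910831721406834a4a2ab614f72d7df11321028000488418b90a0e7ca5eee66843807e21424292814000265815cc01473e52f7733421c03f10a1214940a000132c0ae600a11299c7c3ca33c22a872230c4800400008088322020242004101004000800000000000000008902020000eefb8382a3ec4813daea0894300100022422898c1c777dc1c151f62409ed75044a18008001121144c60e1d168a8e4aee1ac8dc0d0b194e0140008148b361140e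8b454725770d646e06858ca700a00040a459b08a04ca2e1b321c0f92971050ca4280500000122040418018000000001800a0101000c000000002000808001201502800009c8018202801640040000800000000081915c28e3220b152a2209848500200000000a1009002c00a0000eda3040228a0190010000000020000000601d0408e882c5450c820000000800012c0c264220000000000000000000000000000000000000000000000000000000000000000000000000000000000000

/-- The row of a bit in `conflictTable`. -/
abbrev conflictRow : ℕ → ℕ := Mask.row conflictTable 173 169

/-- The row of a bit in `signedTable`. -/
abbrev signedRow : ℕ → ℕ := Mask.row signedTable 173 338

/-- The indices of the roots, with either sign. -/
def signedLineMask : ℕ := 0x3fffffffffffffeffefffb3f4e0540009968f773179ffffffffffffff7ff7ffd9fa702a0004cb47bb98bc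

/-- Between lines a conflict is orthogonality, so at most eight lines spanned by roots are pairwise
non-orthogonal. -/
theorem bound_lines : Mask.bound conflictRow 169 8 lineMask = true := by decide +kernel

/-- The indices below `169`. -/
def allMask : ℕ := 0x1ffffffffffffffffffffffffffffffffffffffffff

/-- The first of five parts of the indices outside eight cliques. -/
def partA : ℕ := 0x20400000

/-- The second part of the indices outside eight cliques, see `partA`. -/
def partB : ℕ := 0x3400000000

/-- The third part of the indices outside eight cliques, see `partA`. -/
def partC : ℕ := 0xb0000000000

/-- The fourth part of the indices outside eight cliques, see `partA`. -/
def partD : ℕ := 0xdf00000000000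

/-- The fifth part of the indices outside eight cliques, see `partA`. -/
def partE : ℕ := 0x1e377cad4fdf8feb9f346cbbf87c5f0000000000000

/-- A set `X` with more than eight elements meets this remainder. The five parts follow each other
in the order of the bits, which is the order of branching, so each search may leave out the parts
before it. -/
theorem dropCliques_allMask : Mask.dropCliques conflictRow 169 8 allMask =
    partA ||| partB ||| partC ||| partD ||| partE := by decide +kernel

/-- After one choice from the part, the parameters 7 and 7 certify a sum of at most 7 + 7 + 1 = 15,
given at most 8 lines; with the chosen element this makes 16. -/
theorem branch_partA : Mask.branchPair conflictRow signedRow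
    (Mask.boundFew conflictRow signedRow 169 7 7) 170 partA
    allMask signedLineMask = true := by
  decide +kernel

theorem branch_partB : Mask.branchPair conflictRow signedRow
    (Mask.boundFew conflictRow signedRow 169 7 7) 170 partB
    (Nat.xor allMask partA) signedLineMask = true := by
  decide +kernel

theorem branch_partC : Mask.branchPair conflictRow signedRow
    (Mask.boundFew conflictRow signedRow 169 7 7) 170 partC
    (Nat.xor (Nat.xor allMask partA) partB) signedLineMask = true := by
  decide +kernel

theorem branch_partD : Mask.branchPair conflictRow signedRow
    (Mask.boundFew conflictRow signedRow 169 7 7) 170 partD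
    (Nat.xor (Nat.xor (Nat.xor allMask partA) partB) partC) signedLineMask = true := by
  decide +kernel

theorem branch_partE : Mask.branchPair conflictRow signedRow
    (Mask.boundFew conflictRow signedRow 169 7 7) 170 partE
    (Nat.xor (Nat.xor (Nat.xor (Nat.xor allMask partA) partB) partC) partD) signedLineMask = true := by
  decide +kernel

end ExtendedE8

/-! ### Octal codes of points and verification of the conflict tables -/

namespace ExtendedE8

/-- The code of the point with index `z`. -/
def pointCode (z : ℕ) : ℕ := Nat.mod (Nat.shiftRight pointTable (Nat.mul 24 z)) 16777216

/-- The point with index `z`. -/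
def point (z : ℕ) : Fin 8 → ℤ := fun k => ((pointCode z / 8 ^ (k : ℕ) % 8 : ℕ) : ℤ) - 4

/-- The squared distance of two points with the codes `a` and `b`, in `d` coordinates. -/
def codeDistSq (d : ℕ) : ℕ → ℕ → ℕ :=
  Nat.rec (motive := fun _ => ℕ → ℕ → ℕ) (fun _ _ => 0) (fun _ ih a b =>
    Nat.add (Nat.add (Nat.pow (Nat.sub (Nat.mod a 8) (Nat.mod b 8)) 2)
      (Nat.pow (Nat.sub (Nat.mod b 8) (Nat.mod a 8)) 2)) (ih (Nat.div a 8) (Nat.div b 8))) d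

theorem codeDistSq_eq (d : ℕ) : ∀ a b, (codeDistSq d a b : ℤ) =
    ∑ k ∈ Finset.range d, (((a / 8 ^ k % 8 : ℕ) : ℤ) - ((b / 8 ^ k % 8 : ℕ) : ℤ)) ^ 2 := by
  induction d with
  | zero => intro a b; simp [codeDistSq]
  | succ d ih =>
    intro a b
    rw [Finset.sum_range_succ']
    have h : codeDistSq (d + 1) a b =
      ((a % 8 - b % 8) ^ 2 + (b % 8 - a % 8) ^ 2) + codeDistSq d (a / 8) (b / 8) := rfl
    -- Of the two truncated differences one is zero and the other is the absolute difference.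
    have hsq : (((a % 8 - b % 8) ^ 2 + (b % 8 - a % 8) ^ 2 : ℕ) : ℤ) =
        (((a % 8 : ℕ) : ℤ) - ((b % 8 : ℕ) : ℤ)) ^ 2 := by
      rcases le_total (a % 8) (b % 8) with h1 | h1
      · rw [Nat.sub_eq_zero_of_le h1, Nat.cast_add, Nat.cast_pow, Nat.cast_pow, Nat.cast_sub h1]
        push_cast; ring
      · rw [Nat.sub_eq_zero_of_le h1, Nat.cast_add, Nat.cast_pow, Nat.cast_pow, Nat.cast_sub h1]
        push_cast; ring
    rw [h, Nat.cast_add, ih, hsq, add_comm]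
    congr 1
    · refine Finset.sum_congr rfl fun k _ => ?_
      rw [Nat.div_div_eq_div_mul, Nat.div_div_eq_div_mul, pow_succ' 8 k]
    · simp

/-- The squared distance of two points. -/
def distSq (x y : Fin 8 → ℤ) : ℤ := ∑ i, (x i - y i) ^ 2

theorem distSq_point (v z : ℕ) :
    distSq (point v) (point z) = codeDistSq 8 (pointCode v) (pointCode z) := by
  rw [codeDistSq_eq, distSq, Finset.sum_range]
  exact Finset.sum_congr rfl fun k _ => by simp [point]

theorem eq_of_digits (d : ℕ) : ∀ a b, a < 8 ^ d → b < 8 ^ d →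
    (∀ k < d, a / 8 ^ k % 8 = b / 8 ^ k % 8) → a = b := by
  induction d with
  | zero => intro a b ha hb _; simp at ha hb; omega
  | succ d ih =>
    intro a b ha hb h
    have h0 := h 0 (by omega)
    have := ih (a / 8) (b / 8) (by rw [pow_succ] at ha; omega) (by rw [pow_succ] at hb; omega)
      fun k hk => by
        have := h (k + 1) (by omega)
        rwa [pow_succ', ← Nat.div_div_eq_div_mul, ← Nat.div_div_eq_div_mul] at this
    simp at h0
    omega

theorem pointCode_eq_of_point_eq {v z : ℕ} (h : point v = point z) :
    pointCode v = pointCode z := by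
  refine eq_of_digits 8 _ _ (Nat.mod_lt _ (by norm_num)) (Nat.mod_lt _ (by norm_num)) fun k hk => ?_
  have := congrFun h ⟨k, hk⟩
  simp only [point] at this
  omega

/-- The points with indices `v` and `z` are at distance `4`. -/
def Conflict (v z : ℕ) : Prop := distSq (point v) (point z) = 16

/-- The points or lines with indices `v` and `i` cannot be chosen together. -/
def PairConflict (v i : ℕ) : Prop :=
  Conflict v i ∨ ((lineMask.testBit v = true ∨ lineMask.testBit i = true) ∧ Conflict v (i + 169))

/-- `Conflict`, computed. -/
def conflictBool (v z : ℕ) : Bool := Nat.beq (codeDistSq 8 (pointCode v) (pointCode z)) 16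

theorem conflict_of_conflictBool {v z : ℕ} (h : conflictBool v z = true) : Conflict v z := by
  rw [Conflict, distSq_point, Nat.eq_of_beq_eq_true h]
  rfl

/-- The modulus 173 is a prime with primitive root 2, so the slots `2 ^ v % 173` are distinct for `v
< 169`. Soundness does not depend on this: every pair read off the table is recomputed from
coordinates, and a missing pair would only weaken the search. -/
theorem sound_signedRow : Mask.Sound signedRow 169 (2 * 169) Conflict :=
  Mask.sound_of_check (f := conflictBool) (by decide +kernel) fun _ _ => conflict_of_conflictBool

theorem sound_conflictRow : Mask.Sound conflictRow 169 169 PairConflict := by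
  refine Mask.sound_of_check (f := fun v i => or (conflictBool v i) (and
    (or (lineMask.testBit v) (lineMask.testBit i)) (conflictBool v (Nat.add i 169))))
    (by decide +kernel) fun v i h => ?_
  simp only [Bool.or_eq_true, Bool.and_eq_true] at h
  exact h.imp conflict_of_conflictBool fun h => ⟨h.1, conflict_of_conflictBool h.2⟩

end ExtendedE8

/-! ### The vertex set, and independent sets as configurations of points and lines -/

namespace ExtendedE8

/-- The indices of the roots. -/
def rootIndices : Finset ℕ := (Finset.range 338).filter fun z => signedLineMask.testBit z = true

/-- The indices of the added points. -/
def addedIndices : Finset ℕ := (Finset.range 169).filter fun z => lineMask.testBit z = false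

theorem card_rootIndices : rootIndices.card = 240 := by decide +kernel

theorem card_addedIndices : addedIndices.card = 49 := by decide +kernel

theorem card_addedPoints : addedPoints.card = 49 := by decide +kernel

theorem nodup_pointCode : (((List.range 338).filter fun z => signedLineMask.testBit z ||
    (Nat.blt z 169)).map pointCode).Nodup := by decide +kernel

theorem point_mem_addedPoints : ∀ z ∈ addedIndices, point z ∈ addedPoints := by decide +kernel

theorem point_root : ∀ z ∈ rootIndices, (∃ i j, i ≠ j ∧ (point z i = 2 ∨ point z i = -2) ∧
      (point z j = 2 ∨ point z j = -2) ∧ ∀ k, k ≠ i → k ≠ j → point z k = 0) ∨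
    ((∀ i, point z i = 1 ∨ point z i = -1) ∧
      Even (Finset.univ.filter fun i => point z i = -1).card) := by decide +kernel

theorem point_add (z : ℕ) (hz : z < 169) : point (z + 169) = -point z := by
  have h : ∀ z ∈ Finset.range 169, ∀ k, point (z + 169) k = - point z k := by decide +kernel
  exact funext fun k => h z (Finset.mem_range.2 hz) k

theorem signedLineMask_eq : signedLineMask = lineMask ||| lineMask <<< 169 := by decide +kernel

theorem lineMask_lt : lineMask < 2 ^ 169 := by decide +kernel

theorem below_lineMask : Mask.Below 169 lineMask := fun i hi => by
  by_contra h
  rw [Nat.testBit_lt_two_pow (lineMask_lt.trans_le (Nat.pow_le_pow_right (by norm_num)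
    (not_lt.1 h)))] at hi
  exact absurd hi (by simp)

theorem testBit_signedLineMask (z : ℕ) : signedLineMask.testBit z =
    (lineMask.testBit z || (decide (169 ≤ z) && lineMask.testBit (z - 169))) := by
  rw [signedLineMask_eq, Nat.testBit_or, Nat.testBit_shiftLeft]

theorem below_signedLineMask : Mask.Below (2 * 169) signedLineMask := fun i hi => by
  rw [testBit_signedLineMask] at hi
  simp only [Bool.or_eq_true, Bool.and_eq_true, decide_eq_true_eq] at hi
  rcases hi with hi | ⟨h, hi⟩
  · have := below_lineMask i hi; omega
  · have := below_lineMask _ hi; omega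

theorem testBit_allMask {i : ℕ} : allMask.testBit i = true ↔ i < 169 := by
  rw [show allMask = 2 ^ 169 - 1 by decide +kernel, Nat.testBit_two_pow_sub_one]
  simp

theorem injOn_point : Set.InjOn point (rootIndices ∪ addedIndices : Finset ℕ) := by
  intro v hv z hz h
  have hmem : ∀ z ∈ (rootIndices ∪ addedIndices : Finset ℕ), z ∈ ((List.range 338).filter fun z =>
      signedLineMask.testBit z || (Nat.blt z 169)) := by
    intro z hz
    simp only [rootIndices, addedIndices, Finset.mem_union, Finset.mem_filter,
      Finset.mem_range] at hz
    simp only [List.mem_filter, List.mem_range, Bool.or_eq_true]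
    rcases hz with ⟨h1, h2⟩ | ⟨h1, -⟩
    · exact ⟨h1, Or.inl h2⟩
    · exact ⟨by omega, Or.inr (by simpa [Nat.blt_eq] using h1)⟩
  exact List.inj_on_of_nodup_map nodup_pointCode (hmem v hv) (hmem z hz) (pointCode_eq_of_point_eq h)

theorem disjoint_indices : Disjoint rootIndices addedIndices := by
  rw [Finset.disjoint_left]
  intro z h1 h2
  simp only [rootIndices, addedIndices, Finset.mem_filter, Finset.mem_range,
    testBit_signedLineMask] at h1 h2
  have : ¬ 169 ≤ z := by omega
  simp_all

/-- The roots, as a finite set. -/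
def roots : Finset (Fin 8 → ℤ) := rootIndices.image point

theorem card_roots : roots.card = 240 := by
  rw [roots, Finset.card_image_of_injOn, card_rootIndices]
  exact injOn_point.mono (by simp)

theorem image_addedIndices : addedIndices.image point = addedPoints := by
  refine Finset.eq_of_subset_of_card_le (Finset.image_subset_iff.2 point_mem_addedPoints) ?_
  rw [Finset.card_image_of_injOn (injOn_point.mono (by simp)), card_addedIndices, card_addedPoints]

/-- A squeeze by cardinality: the 240 tabulated points are roots, and all roots lie in the
enumerated set `B` of at most 4 · 28 + 128 = 240 vectors. -/
theorem coe_roots : (roots : Set (Fin 8 → ℤ)) = e8Roots := by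
  let f : (Fin 8 × Fin 8) × Bool × Bool → Fin 8 → ℤ := fun p k =>
    if k = p.1.1 then (if p.2.1 then 2 else -2) else
      if k = p.1.2 then (if p.2.2 then 2 else -2) else 0
  let g : Finset (Fin 8) → Fin 8 → ℤ := fun S k => if k ∈ S then -1 else 1
  let B : Finset (Fin 8 → ℤ) :=
    (((Finset.univ : Finset (Fin 8 × Fin 8)).filter fun p => p.1 < p.2) ×ˢ Finset.univ).image f ∪
      ((Finset.univ : Finset (Finset (Fin 8))).filter fun S => Even S.card).image g
  have hB : e8Roots ⊆ B := by
    rintro x (⟨i, j, hij, hi, hj, hk⟩ | ⟨h, heven⟩)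
    · have key : ∀ i j : Fin 8, i < j → (x i = 2 ∨ x i = -2) → (x j = 2 ∨ x j = -2) →
          (∀ k, k ≠ i → k ≠ j → x k = 0) → x ∈ (B : Set (Fin 8 → ℤ)) := by
        intro i j hij hi hj hk
        refine Finset.mem_coe.2 (Finset.mem_union_left _ (Finset.mem_image.2
          ⟨((i, j), decide (x i = 2), decide (x j = 2)), by simpa using hij, ?_⟩))
        funext k
        simp only [f]
        split_ifs with h1 h2 h3 h4
        · subst h1; simp_all
        · subst h1; simp_all
        · subst h3; simp_all
        · subst h3; simp_all
        · exact (hk k h1 h3).symm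
      rcases lt_or_gt_of_ne hij with h | h
      · exact key i j h hi hj hk
      · exact key j i h hj hi fun k h1 h2 => hk k h2 h1
    · refine Finset.mem_coe.2 (Finset.mem_union_right _ (Finset.mem_image.2
        ⟨Finset.univ.filter fun i => x i = -1, by simpa using heven, ?_⟩))
      funext k
      simp only [g, Finset.mem_filter, Finset.mem_univ, true_and]
      rcases h k with h | h <;> simp [h]
  have hcard : B.card ≤ 240 := by
    refine (Finset.card_union_le _ _).trans ((add_le_add Finset.card_image_le
      Finset.card_image_le).trans ?_)
    decide +kernel
  have hsub : (roots : Set (Fin 8 → ℤ)) ⊆ e8Roots := by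
    intro x hx
    obtain ⟨z, hz, rfl⟩ := Finset.mem_image.1 (Finset.mem_coe.1 hx)
    exact point_root z hz
  have : roots = B := Finset.eq_of_subset_of_card_le
    (Finset.coe_subset.1 (hsub.trans hB)) (by rw [card_roots]; exact hcard)
  exact hsub.antisymm (by rw [this]; exact hB)

/-- All the points, as a finite set. -/
def points : Finset (Fin 8 → ℤ) := (rootIndices ∪ addedIndices).image point

theorem coe_points : (points : Set (Fin 8 → ℤ)) = extendedE8 := by
  rw [points, Finset.image_union, image_addedIndices, Finset.coe_union, extendedE8, ← coe_roots]
  rfl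

theorem card_points : points.card = 289 := by
  rw [points, Finset.card_image_of_injOn injOn_point,
    Finset.card_union_of_disjoint disjoint_indices, card_rootIndices, card_addedIndices]

theorem distSq_neg_neg (x y : Fin 8 → ℤ) : distSq (-x) (-y) = distSq x y :=
  Finset.sum_congr rfl fun i _ => by simp only [Pi.neg_apply]; ring

/-- The parallelogram law. For two roots the right side is 32, so one of the two squared distances
is 16 exactly when the other is; this makes conflicts of roots independent of signs. -/
theorem distSq_add_distSq_neg (x y : Fin 8 → ℤ) :
    distSq x y + distSq x (-y) = 2 * ∑ i, x i ^ 2 + 2 * ∑ i, y i ^ 2 := by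
  simp only [distSq, Finset.mul_sum, ← Finset.sum_add_distrib]
  exact Finset.sum_congr rfl fun i _ => by simp only [Pi.neg_apply]; ring

theorem normSq_point (z : ℕ) (hz : lineMask.testBit z = true) : ∑ i, point z i ^ 2 = 8 := by
  have h : ∀ z ∈ Finset.range 169, lineMask.testBit z = true → ∑ i, point z i ^ 2 = 8 := by
    decide +kernel
  exact h z (Finset.mem_range.2 (below_lineMask z hz)) hz

/-- Two roots are at distance `4` if and only if they are after a change of signs. -/
theorem conflict_mod {z z' : ℕ} (hz : signedLineMask.testBit z = true)
    (hz' : signedLineMask.testBit z' = true)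
    (h : PairConflict (z % 169) (z' % 169)) : Conflict z z' := by
  have key : ∀ z, signedLineMask.testBit z = true → lineMask.testBit (z % 169) = true ∧
      (point z = point (z % 169) ∨ point z = -point (z % 169)) := by
    intro z hz
    rw [testBit_signedLineMask] at hz
    simp only [Bool.or_eq_true, Bool.and_eq_true, decide_eq_true_eq] at hz
    rcases hz with hz | ⟨h1, hz⟩
    · rw [Nat.mod_eq_of_lt (below_lineMask z hz)]
      exact ⟨hz, Or.inl rfl⟩
    · have h2 := below_lineMask _ hz
      have h3 : z % 169 = z - 169 := by omega
      rw [h3, ← point_add _ h2, Nat.sub_add_cancel h1]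
      exact ⟨hz, Or.inr rfl⟩
  obtain ⟨h1, h2⟩ := key z hz
  obtain ⟨h1', h2'⟩ := key z' hz'
  have hsum := distSq_add_distSq_neg (point (z % 169)) (point (z' % 169))
  rw [normSq_point _ h1, normSq_point _ h1'] at hsum
  have h0 : distSq (point (z % 169)) (point (z' % 169)) = 16 := by
    rcases h with h | ⟨-, h⟩
    · exact h
    · rw [Conflict, point_add _ (Nat.mod_lt _ (by norm_num))] at h
      omega
  rw [Conflict]
  rcases h2 with h2 | h2 <;> rcases h2' with h2' | h2' <;> rw [h2, h2']
  · exact h0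
  · omega
  · rw [← distSq_neg_neg, neg_neg]; omega
  · rw [distSq_neg_neg]; exact h0

theorem config_diff {N : ℕ} {R RX : ℕ → ℕ → Prop} {X Z : Finset ℕ} {c s u : ℕ}
    (h : Mask.Config N R RX X Z c s) (hu : ∀ i, u.testBit i = true → c.testBit i = true)
    (hX : ∀ i ∈ X, u.testBit i = false) : Mask.Config N R RX X Z (Nat.xor c u) s := by
  refine { h with belowC := fun i hi => h.belowC i ?_, inC := fun i hi => ?_ }
  · rw [Mask.testBit_xor] at hi
    have := hu i
    cases hc : c.testBit i <;> simp_all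
  · rw [Mask.testBit_xor, hX i hi, h.inC i hi]
    rfl

/-- There are at most eight lines, so a sum above 16 needs at least nine elements in `X`. Eight
cliques contain at most eight of them, and the five searches exclude every vertex outside the
cliques. -/
theorem card_add_card_lines_le {X Z : Finset ℕ}
    (h : Mask.Config 169 PairConflict Conflict X Z allMask signedLineMask) :
    X.card + (Z.image (· % 169)).card ≤ 16 := by
  have hZ : (Z.image (· % 169)).card ≤ 8 := by
    refine Mask.bound_sound sound_conflictRow 8 lineMask below_lineMask bound_lines _ h.indepZ ?_
    intro i hi
    obtain ⟨z, hz, rfl⟩ := Finset.mem_image.1 hi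
    have hz := h.inS z hz
    rw [testBit_signedLineMask] at hz
    simp only [Bool.or_eq_true, Bool.and_eq_true, decide_eq_true_eq] at hz
    rcases hz with hz | ⟨h1, hz⟩
    · rwa [Nat.mod_eq_of_lt (below_lineMask z hz)]
    · have h2 := below_lineMask _ hz
      rwa [show z % 169 = z - 169 by omega]
  by_contra hlt
  -- A sum above 16 keeps `X` away from the searched part `u`, which may then be deleted before the
  -- next search.
  have step : ∀ u c, (∀ i, u.testBit i = true → c.testBit i = true) →
      Mask.branchPair conflictRow signedRow (Mask.boundFew conflictRow signedRow 169 7 7) 170 u c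
        signedLineMask = true → Mask.Config 169 PairConflict Conflict X Z c signedLineMask →
      Mask.Config 169 PairConflict Conflict X Z (Nat.xor c u) signedLineMask ∧
        ∀ i ∈ X, u.testBit i = false := by
    intro u c huc hb hX
    have havoid : ∀ i ∈ X, u.testBit i = false := by
      intro i hi
      by_contra hui
      exact hlt (Mask.branchPair_sound sound_conflictRow sound_signedRow (t := 15)
        (fun c s h X hX => Mask.boundFew_sound sound_conflictRow sound_signedRow 7 7 c s h X Z hX hZ)
        _ u c _ huc hb X hX ⟨i, hi, by simpa using hui⟩)
    exact ⟨config_diff hX huc havoid, havoid⟩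
  have hsub : ∀ u c : ℕ, c &&& u = u → ∀ i, u.testBit i = true → c.testBit i = true := by
    intro u c h i hi
    rw [← h, Nat.testBit_and] at hi
    simp_all
  obtain ⟨hB, hA'⟩ := step _ _ (hsub _ _ (by decide +kernel)) branch_partA h
  obtain ⟨hC, hB'⟩ := step _ _ (hsub _ _ (by decide +kernel)) branch_partB hB
  obtain ⟨hD, hC'⟩ := step _ _ (hsub _ _ (by decide +kernel)) branch_partC hC
  obtain ⟨hE, hD'⟩ := step _ _ (hsub _ _ (by decide +kernel)) branch_partD hD
  obtain ⟨-, hE'⟩ := step _ _ (hsub _ _ (by decide +kernel)) branch_partE hE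
  have hcard := Mask.card_dropCliques_le sound_conflictRow 8 allMask h.belowC X h.indepX h.inC
  rw [dropCliques_allMask, Finset.filter_true_of_mem] at hcard
  · omega
  · intro i hi
    simp [Nat.testBit_or, hA' i hi, hB' i hi, hC' i hi, hD' i hi, hE' i hi]

/-- `Ta` indexes the added points in `I`, and `Tl` and `T'` index the lines whose tabulated root,
respectively its negative, is in `I`. Added points and lines with both roots go into `X`, all roots
of `I` into `Z`. By inclusion and exclusion `|Ta| + |Tl ∩ T'| + |Tl ∪ T'| = |Ta| + |Tl| + |T'|`,
which is at least `|I|`. -/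
theorem card_le_of_indep (I : Finset (Fin 8 → ℤ)) (hI : I ⊆ points)
    (hdist : ∀ x ∈ I, ∀ y ∈ I, distSq x y ≠ 16) : I.card ≤ 16 := by
  classical
  set T := (Finset.range 169).filter fun v => point v ∈ I with hT
  set T' := (Finset.range 169).filter fun v => lineMask.testBit v = true ∧ point (v + 169) ∈ I
    with hT'
  set Ta := T.filter fun v => ¬ lineMask.testBit v = true with hTa
  set Tl := T.filter fun v => lineMask.testBit v = true with hTl
  have hTsplit : Tl.card + Ta.card = T.card := Finset.card_filter_add_card_filter_not _
  have hIcard : I.card ≤ T.card + T'.card := by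
    have : I ⊆ T.image point ∪ T'.image fun v => point (v + 169) := by
      intro x hx
      obtain ⟨z, hz, rfl⟩ := Finset.mem_image.1 (hI hx)
      simp only [Finset.mem_union, Finset.mem_image]
      simp only [rootIndices, addedIndices, Finset.mem_union, Finset.mem_filter, Finset.mem_range,
        testBit_signedLineMask] at hz
      rcases lt_or_ge z 169 with h | h
      · exact Or.inl ⟨z, by simp [hT, h, hx], rfl⟩
      · rcases hz with ⟨-, hz⟩ | ⟨h1, -⟩
        · right
          have hno : lineMask.testBit z = false := by
            by_contra hb
            have := below_lineMask z (by simpa using hb)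
            omega
          simp only [hno, Bool.false_or, Bool.and_eq_true] at hz
          refine ⟨z - 169, ?_, by rw [Nat.sub_add_cancel h]⟩
          simp only [hT', Finset.mem_filter, Finset.mem_range, Nat.sub_add_cancel h]
          exact ⟨below_lineMask _ hz.2, hz.2, hx⟩
        · omega
    exact (Finset.card_le_card this).trans ((Finset.card_union_le _ _).trans
      (add_le_add Finset.card_image_le Finset.card_image_le))
  have hmod : (Tl ∪ T'.image (· + 169)).image (· % 169) = Tl ∪ T' := by
    rw [Finset.image_union, Finset.image_image]
    congr 1
    · refine (Finset.image_congr fun v hv => ?_).trans Finset.image_id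
      simp only [hTl, hT, Finset.coe_filter, Finset.mem_filter, Finset.mem_range,
        Set.mem_ofPred_eq] at hv
      exact Nat.mod_eq_of_lt hv.1.1
    · refine (Finset.image_congr fun v hv => ?_).trans Finset.image_id
      simp only [hT', Finset.coe_filter, Finset.mem_range, Set.mem_ofPred_eq] at hv
      simp [Nat.mod_eq_of_lt hv.1]
  have hX : ∀ v ∈ Ta ∪ (Tl ∩ T'), v < 169 ∧ point v ∈ I ∧
      (lineMask.testBit v = true → point (v + 169) ∈ I) := by
    intro v hv
    simp only [hTa, hTl, hT, hT', Finset.mem_union, Finset.mem_inter, Finset.mem_filter,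
      Finset.mem_range] at hv
    tauto
  have hZ : ∀ z ∈ Tl ∪ T'.image (· + 169), signedLineMask.testBit z = true ∧ point z ∈ I := by
    intro z hz
    simp only [Finset.mem_union, Finset.mem_image] at hz
    rw [testBit_signedLineMask]
    rcases hz with hz | ⟨v, hv, rfl⟩
    · simp only [hTl, hT, Finset.mem_filter] at hz
      simp [hz.2, hz.1.2]
    · simp only [hT', Finset.mem_filter] at hv
      simp [hv.2.1, hv.2.2]
  have hcfg : Mask.Config 169 PairConflict Conflict (Ta ∪ (Tl ∩ T')) (Tl ∪ T'.image (· + 169))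
      allMask signedLineMask := by
    refine ⟨fun i hi => testBit_allMask.1 hi, below_signedLineMask, ?_, ?_, ?_,
      fun i hi => testBit_allMask.2 (hX i hi).1, fun z hz => (hZ z hz).1⟩
    · rintro v hv i hi (h | ⟨hl | hl, h⟩)
      · exact hdist _ (hX v hv).2.1 _ (hX i hi).2.1 h
      -- Here `v` is the line with both roots in `I`; the distance from `v` to the negative of `i`
      -- is that from the negative of `v` to `i`.
      · refine hdist _ ((hX v hv).2.2 hl) _ (hX i hi).2.1 ?_
        rw [Conflict, point_add i (hX i hi).1] at h
        rw [point_add v (hX v hv).1, ← distSq_neg_neg, neg_neg]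
        exact h
      · exact hdist _ (hX v hv).2.1 _ ((hX i hi).2.2 hl) h
    · intro v hv z hz h
      exact hdist _ (hX v hv).2.1 _ (hZ z hz).2 h
    · intro i hi j hj h
      obtain ⟨z, hz, rfl⟩ := Finset.mem_image.1 hi
      obtain ⟨z', hz', rfl⟩ := Finset.mem_image.1 hj
      exact hdist _ (hZ z hz).2 _ (hZ z' hz').2 (conflict_mod (hZ z hz).1 (hZ z' hz').1 h)
  have hle := card_add_card_lines_le hcfg
  rw [hmod] at hle
  have hdisj : Disjoint Ta (Tl ∩ T') := by
    rw [Finset.disjoint_left]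
    intro v h1 h2
    simp only [hTa, hTl, Finset.mem_inter, Finset.mem_filter] at h1 h2
    exact h1.2 h2.1.2
  rw [Finset.card_union_of_disjoint hdisj] at hle
  have := Finset.card_union_add_card_inter Tl T'
  omega

end ExtendedE8

/-! ### Binary words as finite sets -/

namespace Word

open Finset
open scoped symmDiff

/-- The word of length `n` whose letters are the binary digits of `x`. -/
def ofNat (n x : ℕ) : Finset (Fin n) := univ.filter fun i => x.testBit i = true

/-- The number of nonzero letters among the last `n` binary digits of `x`. -/
def weight (n : ℕ) : ℕ → ℕ :=
  Nat.rec (motive := fun _ => ℕ → ℕ) (fun _ => 0)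
    (fun _ ih x => Nat.add (Nat.mod x 2) (ih (Nat.div x 2))) n

theorem mem_ofNat {n x : ℕ} {i : Fin n} : i ∈ ofNat n x ↔ x.testBit i = true := by simp [ofNat]

theorem card_ofNat (n : ℕ) : ∀ x, (ofNat n x).card = weight n x := by
  induction n with
  | zero => intro x; rfl
  | succ n ih =>
    intro x
    have h : weight (n + 1) x = x % 2 + weight n (x / 2) := rfl
    rw [h, ← ih, ofNat, ofNat, Finset.card_filter, Finset.card_filter, Fin.sum_univ_succ]
    congr 1
    · rcases Nat.mod_two_eq_zero_or_one x with h | h <;> simp [h]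
    · simp [Nat.testBit_succ]

theorem ofNat_xor (n x y : ℕ) : ofNat n (x ^^^ y) = ofNat n x ∆ ofNat n y := by
  ext i
  simp only [mem_ofNat, Finset.mem_symmDiff, Nat.testBit_xor]
  cases x.testBit i <;> cases y.testBit i <;> simp

theorem exists_ofNat {n : ℕ} (s : Finset (Fin n)) : ∃ x < 2 ^ n, ofNat n x = s := by
  classical
  refine ⟨Nat.ofBits fun i => decide (i ∈ s), Nat.ofBits_lt_two_pow _, ?_⟩
  ext i
  rw [mem_ofNat, Nat.testBit_ofBits_lt _ _ i.2]
  simp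

/-- No two words of `S` have Hamming distance `4`. -/
def AvoidsFour {n : ℕ} (S : Finset (Finset (Fin n))) : Prop :=
  ∀ s ∈ S, ∀ t ∈ S, (s ∆ t).card ≠ 4

theorem AvoidsFour.mono {n : ℕ} {S T : Finset (Finset (Fin n))} (hT : AvoidsFour T) (h : S ⊆ T) :
    AvoidsFour S := fun s hs t ht => hT s (h hs) t (h ht)

/-- A bound on codes of words with distance other than `4`, from a search. -/
theorem card_le_of_bound {n N t : ℕ} {row word : ℕ → ℕ}
    (hrow : Mask.Sound row N N fun v i => weight n (word v ^^^ word i) = 4)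
    (hb : Mask.bound row N t (2 ^ N - 1) = true) {S : Finset (Finset (Fin n))}
    (hS : AvoidsFour S) (hcov : ∀ s ∈ S, ∃ i < N, ofNat n (word i) = s) : S.card ≤ t := by
  classical
  set I := (range N).filter fun i => ofNat n (word i) ∈ S with hI
  have hsub : S ⊆ I.image fun i => ofNat n (word i) := by
    intro s hs
    obtain ⟨i, hi, rfl⟩ := hcov s hs
    exact mem_image_of_mem _ (by simp [hI, hi, hs])
  refine (card_le_card hsub).trans (card_image_le.trans ?_)
  refine Mask.bound_sound hrow t _ (fun i hi => ?_) hb I (fun i hi j hj h => ?_) fun i hi => ?_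
  · rw [Nat.testBit_two_pow_sub_one] at hi
    simpa using hi
  · simp only [hI, mem_filter] at hi hj
    refine hS _ hi.2 _ hj.2 ?_
    rw [← ofNat_xor, card_ofNat]
    exact h
  · simp only [hI, mem_filter, mem_range] at hi
    simp [Nat.testBit_two_pow_sub_one, hi.1]

/-- Two colourings with colour classes of the same sizes differ by a permutation. -/
theorem exists_perm_of_card_fiber_eq {α κ : Type*} [Fintype α] [DecidableEq κ] (f g : α → κ)
    (h : ∀ c, (univ.filter fun a => f a = c).card = (univ.filter fun a => g a = c).card) :
    ∃ σ : Equiv.Perm α, ∀ a, g (σ a) = f a := by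
  have e : ∀ c, Nonempty ({a // f a = c} ≃ {a // g a = c}) := fun c => by
    refine ⟨Fintype.equivOfCardEq ?_⟩
    rw [Fintype.card_subtype, Fintype.card_subtype, h]
  refine ⟨((Equiv.sigmaFiberEquiv f).symm.trans
    (Equiv.sigmaCongrRight fun c => (e c).some)).trans
    (Equiv.sigmaFiberEquiv g), fun a => ?_⟩
  simp only [Equiv.trans_apply]
  exact ((e (f a)).some ⟨a, rfl⟩).2

/-- Two pairs of sets of the same sizes, with intersections of the same size, differ by a
permutation. -/
theorem exists_perm_map {n : ℕ} (X Y X' Y' : Finset (Fin n)) (hX : X.card = X'.card)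
    (hY : Y.card = Y'.card) (hXY : (X ∩ Y).card = (X' ∩ Y').card) :
    ∃ σ : Equiv.Perm (Fin n), X.map σ.toEmbedding = X' ∧ Y.map σ.toEmbedding = Y' := by
  classical
  -- The three given sizes determine the sizes of all four cells of the Venn diagram.
  have key : ∀ X Y : Finset (Fin n), ∀ c : Bool × Bool,
      (univ.filter fun a => (decide (a ∈ X), decide (a ∈ Y)) = c).card =
        match c with
        | (true, true) => (X ∩ Y).card
        | (true, false) => X.card - (X ∩ Y).card
        | (false, true) => Y.card - (X ∩ Y).card
        | (false, false) => n - (X.card + Y.card - (X ∩ Y).card) := by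
    rintro X Y ⟨_ | _, _ | _⟩
    · have := card_union_add_card_inter X Y
      rw [show X.card + Y.card - (X ∩ Y).card = (X ∪ Y).card by omega]
      change _ = n - (X ∪ Y).card
      have hc := card_compl (X ∪ Y)
      rw [Fintype.card_fin] at hc
      rw [← hc]
      congr 1
      ext a; simp
    · rw [inter_comm, ← card_sdiff_of_subset inter_subset_left]
      congr 1
      ext a; simp; tauto
    · rw [← card_sdiff_of_subset inter_subset_left]
      congr 1
      ext a; simp
    · congr 1
      ext a; simp
  obtain ⟨σ, hσ⟩ := exists_perm_of_card_fiber_eq (fun a => (decide (a ∈ X), decide (a ∈ Y)))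
    (fun a => (decide (a ∈ X'), decide (a ∈ Y'))) fun c => by rw [key, key, hX, hY, hXY]
  refine ⟨σ, ?_, ?_⟩
  · ext a
    have := hσ (σ.symm a)
    simp only [Equiv.apply_symm_apply, Prod.mk.injEq, decide_eq_decide] at this
    rw [mem_map_equiv, this.1]
  · ext a
    have := hσ (σ.symm a)
    simp only [Equiv.apply_symm_apply, Prod.mk.injEq, decide_eq_decide] at this
    rw [mem_map_equiv, this.2]

theorem map_symmDiff' {n : ℕ} (σ : Equiv.Perm (Fin n)) (s t : Finset (Fin n)) :
    (s ∆ t).map σ.toEmbedding = s.map σ.toEmbedding ∆ t.map σ.toEmbedding := by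
  ext a; simp [mem_symmDiff, mem_map_equiv]

/-- The words of `S`, with permuted letters. -/
def permute {n : ℕ} (σ : Equiv.Perm (Fin n)) (S : Finset (Finset (Fin n))) :
    Finset (Finset (Fin n)) := S.map (Finset.mapEmbedding σ.toEmbedding).toEmbedding

theorem mem_permute {n : ℕ} {σ : Equiv.Perm (Fin n)} {S : Finset (Finset (Fin n))}
    {s : Finset (Fin n)} : s ∈ permute σ S ↔ ∃ t ∈ S, t.map σ.toEmbedding = s := by
  simp [permute]

theorem card_permute {n : ℕ} (σ : Equiv.Perm (Fin n)) (S : Finset (Finset (Fin n))) :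
    (permute σ S).card = S.card := card_map _

theorem AvoidsFour.permute {n : ℕ} {S : Finset (Finset (Fin n))} (hS : AvoidsFour S)
    (σ : Equiv.Perm (Fin n)) : AvoidsFour (permute σ S) := by
  intro s hs t ht
  obtain ⟨s', hs', rfl⟩ := mem_permute.1 hs
  obtain ⟨t', ht', rfl⟩ := mem_permute.1 ht
  rw [← map_symmDiff', card_map]
  exact hS s' hs' t' ht'

/-- The words of `S`, translated by `c`. -/
def translate {n : ℕ} (c : Finset (Fin n)) (S : Finset (Finset (Fin n))) :
    Finset (Finset (Fin n)) := S.image (c ∆ ·)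

theorem mem_translate {n : ℕ} {c : Finset (Fin n)} {S : Finset (Finset (Fin n))}
    {s : Finset (Fin n)} : s ∈ translate c S ↔ ∃ t ∈ S, c ∆ t = s := by
  simp [translate]

theorem card_translate {n : ℕ} (c : Finset (Fin n)) (S : Finset (Finset (Fin n))) :
    (translate c S).card = S.card :=
  card_image_of_injective _ (symmDiff_right_injective c)

theorem symmDiff_symmDiff_left {n : ℕ} (c s t : Finset (Fin n)) : (c ∆ s) ∆ (c ∆ t) = s ∆ t := by
  rw [symmDiff_symmDiff_symmDiff_comm, symmDiff_self, bot_symmDiff]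

theorem AvoidsFour.translate {n : ℕ} {S : Finset (Finset (Fin n))} (hS : AvoidsFour S)
    (c : Finset (Fin n)) : AvoidsFour (translate c S) := by
  intro s hs t ht
  obtain ⟨s', hs', rfl⟩ := mem_translate.1 hs
  obtain ⟨t', ht', rfl⟩ := mem_translate.1 ht
  rw [symmDiff_symmDiff_left]
  exact hS s' hs' t' ht'

theorem card_symmDiff_add {n : ℕ} (s t : Finset (Fin n)) :
    (s ∆ t).card + 2 * (s ∩ t).card = s.card + t.card := by
  have h1 := card_sdiff_add_card_inter s t
  have h2 := card_sdiff_add_card_inter t s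
  have h3 : (s ∆ t).card = (s \ t).card + (t \ s).card := by
    rw [symmDiff_def, sup_eq_union, card_union_of_disjoint disjoint_sdiff_sdiff]
  rw [inter_comm] at h2
  omega

end Word

/-! ### Tables and certified searches for codes without distance 4 -/

namespace Word

/-- The words of length `10` with weight `5` that are different from
`31` and `47` and not at distance `4` from them, each in `10` bits. -/
def sliceWords : ℕ := 0xf83d0f23c4f0bc1ec3a8e93a2e8798e5392e478ce2b89e1b85e0f70da364d8b61d6354d4b51d334ad2746d1743ce334ccb31bc2e8b92e2b86d8b52d2b46ccb2ac9b1ac5b0eb8ad2b2ac6789d2729c60f7c1e8791e2785d8751d2745cc729c9719c570db86d1b26c5785d1725c50f3e0f43c8f123c4f0f83d0ec37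

/-- The word with index `i` in `sliceWords`. -/
def sliceWord (i : ℕ) : ℕ := Nat.mod (Nat.shiftRight sliceWords (Nat.mul 10 i)) 1024

/-- For each word in `sliceWords` the indices of the words at distance `4`. -/
def sliceTable : ℕ := 0x2d96ab2d549a156ea5aa91340ae97352e64583376a5cc88b03c19bc3378066f00399019cf09f0fc61f88380eeec3f110701bda4c0b66f69325b69325900e8ab6956d02ada00d520ab5c326eaadd5424406ea4406e88b7bc25f84b10769dcf09622e01d06d5d2577a4ae93a4ae90805ef1c01c77bc710ebc710e803a2adbaa414ab682cab682c10e4cd999b30336600cc90cd6c326eab22036440691baa86b4bd17732ee60a20176a20176437c19bc3378399019c66f000f077a4af495206d5bae92a44d036b30899ce5339c85339c84206c16ced26bda4d68da4d6840364ce699cc2cc24cd339802703dfe0003f07f81e07f81e0f027c3f187e230fc440e03bb9c0e4cd9e648633660d33660d04329100dd575baae8244016b4bd9339a67304ce600b309339c0000000000000000000000000d17735100ba201685dcc16b34f7f80ff03c01f801fe07f800e0efc1df80c400eec400ee83b45dcd4402d77305a8805a2cde8ab6956d0d520ab2ada005c00007e00fc001f8000000000f6f6936d26405b376da4c88b017b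c7178e22f1c4400e3bb9c0d6aa12aada555b41555b41082e70691e2fa3c5f0a3c5f08405c0e3de387bc70f0bc70f08031888111005dc5f71dc5f7007d5556aaad0aa8555555a00ac2b58334b9ae9735a29735a100f39900cde319bc6119bc610800bb8f771e2ee3c42ee3c42007bc25f84b1f096220769dce000f769eed07dda08bdda08840d9339d98494ce6134ce61304329100dd576440169baae834bd28802ee6b5dcd60a20096b374a201440117735d97735d80dd5556aaad0555a00aa8555ac2e8f16e0d3a3c58f23c58f0400000000000000000000000002e8f171e2c5c1a7723c588b80e0efc62007c400f03bf00e739de92a0dab7a4a96ba4a96880c5dc5bb8b08881dc8881dc11de0769e12fbc25f0bc25f0840f066f7320319bc0719bc07043177171103a220709dc587387e0efc620073bf00ec400f073b9cc9066cd8cd9b04cd9b0420e4cd999b30cc90cd3366006c2ba5cd4b99297322160cddac0c62203b8be7717c088803ce1c007fe0fffc1ffff81ffffbc05ef1c5e388038eeebc711070326eab22035baa86a4406934b3dfe03fc0f7f81fe007e00001bda4db499369322016cddac0ce660b31ec663d81663d810800007e0000001f80001f8000fb5a154b55d96aba496aba42000ddb3bb65376ca2376ca21003c01fbfc007f801e7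f801ef0318880ee2fa2200f1dc5f0387ca440488026eabba6eabba02f3663d3307198f06598f06410cd98f331e0998399663c00cc1ef0960ed3bc258f3c258f0409ce03e1f87c3f0f0c3f0f08038c40077e1f100438efc381ceeb548156d52adaa12adaa1082d96ab2d54a5aa911a156eb4001e1fbc3ff787ffe787ffef031771711039dc587222070b8777a4af4952e92a4406d5bad000000000fc001f80001f8000f03bb5776a2eed444eed4442000007e00fc000000001f8000fd5556d542a555a15555a150427c3f0701df0fc43b0fc43a00d28802ee6ba200965dcd60b36e8f171e2c63c5889c1a77380e31001df873bf0e0c4010e7380000000038000774000777b0e3100620083bf0ee3bf0ee03aba5ccb066e97325a97325900cd98f331e0663c00998399cc000000000340006ec0006ef70b65aab42ad96aa5a96aa5a200000000002c0005dc0005def000000000070000ef0000ef7c0000000000000000000000000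

/-- As before, 2 is a primitive root modulo the prime 101, and also modulo 163, which serves the two
larger tables. -/
theorem sound_slice : Mask.Sound (Mask.row sliceTable 101 98) 98 98
    fun v i => weight 10 (sliceWord v ^^^ sliceWord i) = 4 :=
  Mask.sound_of_check (f := fun v i => Nat.beq (weight 10 (Nat.xor (sliceWord v) (sliceWord i))) 4)
    (by decide +kernel) fun _ _ => Nat.eq_of_beq_eq_true

theorem bound_slice : Mask.bound (Mask.row sliceTable 101 98) 98 10 (2 ^ 98 - 1) = true := by
  decide +kernel

/-- The words of length `10` with even weight that are different from
`0`, `3`, `5` and not at distance `4` from them, each in `10` bits. -/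
def tenWords : ℕ := 0x3ffff3fafe7f6fd7f3fc3eefb7ebfa3e7f93e2f87def77dbf63d7f53d2f47cff33caf27c6efbbdeefb8edfb4ecbb1ebfaceaba9e9b9fe739ae6796e3b7edf77bde377dd372dc76fdb36ada766d7f5cd6b59d5b4ecff3cceb39cdb2ec7afebf6fbbe2f7bd2f2bc6efbb2eaba6e6b7edcb6ad9b5aceafebcaeab9adaaea7a7f9f27a9e6769ba5e8fa017f9fd7edf87ddf47c9f17bdec7a9e9799df771da765d6739bf6f1ba6e5b66b99e5fd7c5e9795d96e5793e404ff3f0fa3e4f63b8de2f8811f8410841102406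

/-- The word with index `i` in `tenWords`. -/
def tenWord (i : ℕ) : ℕ := Nat.mod (Nat.shiftRight tenWords (Nat.mul 10 i)) 1024

/-- For each word in `tenWords` the indices of the words at distance `4`. -/
def tenTable : ℕ := 0x11dcfceee7739cee71c044638f1ee7738e1c11e81376f6edb76b36ed658044a69d3db76b2c5813d073b8b889c44247738e0e221047023b9c700ff03e2bbdbdd5eeb4bdd69a008a5972f5eeb4d1a02f417ba8577d445e57702f6a22f437ad445e86f484836ecac8964421377befb2210437c9bbdf78037c00838b8f1c79cb8f39e6e3ce79f39c79cf3e773a0177e7eebf77b7eef7dc044208103f77befde1000fc2fd0f1703dd0f85ef43e17b0ae87c2f6150a01fba05dfd107c5de03ee883f05f5d107e0bea09015dedee808a5deeb42f7bad0be8af75a17d16880bdd4d446a2102bbdf7f510820bf15defbe00bf01b69a9a0b2ded65bd89d96f6264cb2dec4c984c00223a3b91dce23b9c708ee71c3811dce387038005eea15df5117ea22f43a88bd0a10aee05ebd5ea0e8807eebf7447ee8822001df6ec4003bedd80342e3ce20ee78bbcf1762f3c5d8b14e78bb16291403a1f9f8501de9f842747e109d042fc213a084426596deda76d296da5249b6949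224082d6dbb75ba0e7718ee4770371171c63b8186e3477030dc60c43cf1ce3c8e0f2e3c139470790bca8e0f2179414845df9fba02211fbbd887eef623b8fddec4773b905eea6a20aef795def01a8842fdf351085fbe20a07ee8e8874420177beffa210407f0bbdf7e007f01d0fcfc27e10901deba4077ae80e80ef5d01c0e06f4acac1a97bb52f723d4bdc8d19a97b91a31180743f4075f85d40741eafc2e8475203a0f5057521044d4dda6ef74ddefbd377befdf26ef7dfbedf41cf1d1c171e731c10b9c7042e61271e722399cc85fba05dfd107fa20fc1e883f06082ef01f3e9f500b80bf09f85d3f0baeafc2ebaf59f85d75eb75a0e87e80ebf0ba7e1742203a0f5ea40741ebd40543cf1ce3c8e0f31c1e42b8f04e5ca8e0f21429ca863b9c223cee8f9dd1b9e7746e5c9cee8dcb91c8074404001fbbdc0000eefddec4771fbbd88ee0801d4bdbd2a06b5bd295aef4a56b295e94ad6522901b7649bb4dd81644df759137dc46b226fb88c4601c79f9e3cf18b9e3144e78c5122020e75dbb9dd03f740bbfa20ff441f822ef01f3eba20fc1823ea0e78e71e38f048e0f3c9c78208e4b8f0411c9103565b7b69db4a5b69492105adb76edb4a491216e839dc63b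8e22e23b81f171170238ae22e0471440b6da6d96d341b596c9db65b27692acb64ed251280e771711477388ee701e3b9c070e477380e1c0e03a97a81abd2eb7a5d4ade9752a54bd2ea54a85401fba3a202ef7c5def80e8840fdf9d1081fbf205015dedeeaf75a0114b2f7bad3417af75a682f6820e8807eebf74480077da001df6033f74411d8ec42fdd1d10177bfd1081f8bbdf00fce8840fe04fc839e39c78e3c12383cf28e0f3c82d1c1e790582c0f43f3f09f8423f0841101deba745f8420810745c7e17170743dee87bd0fa1ef4386743de870c8601b7656444ddef644237a6ef701bcb2211bc85bc839e3a382e3ce638217371e7223991c10b984b990f4403f75fba23f74410fdd104085fba208108858022b2bb95def2bbdf7caef7dfbf15defbf7ebf416441b76dbb27b764d36dd934c98dbb26993098039dc5c451dce1c4427071109c0411dce03f0f86773c74706382138f39e6e3ce79882382104e77381e7718ee477038ee061a3b81860c388b8e3c6e342000000000000000000000000000000000000000203a3a1fd0f7ba1ef3ce87bcf1e1d0f79e3c1e0073c738f2383cc70790b1c1e42851c78272e572a1e78e8e0b8f3971e7222382173e647042e7cc09431c11cf1e78bbcf175d73c5d74e8e78bae9d0e8039dc63b8e22e1c45c088ee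07c78ae22e040838ab38f3f3c79e310839d77cf18a23bb9e31447744204ddb044edd93dbb27676ec9d9b26dd93b364b2017ba9a882bbdfa8842fea210be822bbde02f97c83a201fbb000ee001d817ee89dbb4fdd13b768400f3b8b889c44238884111dce387023b9c70e007feb2dbdb4905addb4a56f6d295b496da52b6924901b765644b22109bbdf7a6ef7de00b2210437dbe02f750aee577035117ded445f790da88bef2190c000008088044200884100221040800000000000018ee7e7773b9ce7738e39dce3870044638f1e8f41b69b65bb2d9365b249596c924484d06db76db6839dc63b91dc0e3b818671171c78d1dc0c30638d0bf747443a21074420802ef7dfbf85defbf7f0000db4db2dd96c94d06db6cb6492db596c925b624400000000000000000000000000000000000000001c79f9e3cf18b9e31441073aedddcf18a2441dd073c74706382138f39e71c1082739c79cf3107381dbb24ddd91374dd81bac89b91dd5913723ba2240416565bb2ded65bdb6596f6d9b0b2dedb361b002f4af52e560bb52e8ddd4ba37515a9746ea2914026ededd81129eddac4fb76b13d8b6ed627b15880e78e8e0b8f3971e7221c79c8810b8f39102110a5b7649bbb226f644dc8d913722444dd81bb75ba82cb6c82db69b76d36a5db4da9529b69b52a512806a5ede96f4a55e94a297a528a1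41035aebd76ba0e87e7e14077a7e109d203bd03e94077a07d20643b7656444ddee9bbdc059108dfbcb2211bf7842805df9fbafddec0442087eef7dc40fddefb883bc074403f75fba24003becfdd104762001df6037621e87e80ebf0ba80e83d603a0f5053f0ba11d4ea4256057a5bd2eb7a5d755e975d5a8bd2ebab51a803a1f9f8501dea03bd037e109d3a501de81833a508000808804420000000022104000044208000801e7718ee4770371171c5c45c7110b88b8e221108d7ba8577d445fa88bd095dc0bd7ad445e85097a8352f6f4b7a52af4a51440d6baf5d7a528a1435d073c738f2383cb8f04e4e3c139085c7827210884ae87e80ebf0ba7e17421f85d0810bf0ba102110a89bb7b76dbb580894d3eddacb09edbb59613d6082f753510577bf51085f2bbde02f9a8842fa0af903f0bf43fa1f0f43e1842e079ebdba1f0c2843da0e7717114773871109c23b9c07e1b8884e020e19c2efc0227ee88fdd13b3f744edda7ee89dbb5da835102f757ba2ef74596bdd1658b17ba2cb160b00743f407603a0bf0baeafc2eba88203a082eb758101171778bbdf177befc5defbf7f0bbdf7efe7f41d0fcfc280ef501de81c077a060c7e109d3a5d285c4439ddcee8f9dd1c6e77471a31cee8e3462300596deda76d29105adb7b694925bb6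d2924b72420dbb2b2226ef7b2211bec8846f2126ef701bcde41cf1d1c18e0851c108238f39e7ce71e73cf9c20079dc5c44e22123b9c708ee71c03ee2210470381f0bbf3f75fbbdbf77beefddefbf78044208100800e78e71e38f0471e0821c782081047079e5c9e4b57ba9a88d4421a8841015defbf7e2bbdf7efc0000000000000000000000000000000000000000000743f407603a0bf0baeb01d041759f85d7510758140d4d4bea5eed4bdd7352f75cb86a5eeb970b8011dcfcee088c7cee723f3b9c8ee2e77391dc4e2039dc63b8e22e1c45c087117020411dc0f8f178ab743f3f09f8423f08410fc210408203bd74e8f45ce771711477388ee701dc44270e1b8884e1c3101cfdd1d10e88402ef7df8bbdf7e00e884101fcfe0134136d3b69b76d36dadb4db6ad1b69b6d5a2d007440400200003f77beefddefb881fbbdf7100801dbb24ddd9137b226e4537606edd591372244dd41cee31dc711711dc0f8c7703e21a8ee07c4341a063b9f9ddcee702231c7e7738e23dcee71c479c105e95ea5f52e8ea5d144560baeddb52e8a2445da02bbd022dee8bbdd17a6f745e9d25ee8bd3a4d201d100fdd80076fdd13b3f744ec208007607b5da05fba3a202ef7fa2103fe8840fe042ef7c03f1f906a5ede96f4a5206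b5d77a528a6baf4a514d71420e87e80ec074180e8209f85d75eb3f0baebd61002577b7babdd697bad345eeb4d1a0022965cbc5e836ecac8964422c884104ddefbf7c9bbdf7ef800074403f76001dbf744ed000ec0f69fba27610768171e7e788839de78c4ef9e313b8973c6277128900fc2fd0fe87c3d0f861743e185081703cf5ecf682f753511a8840aef7df2bbdf7c01a884105fafc000008088000000884000221000800442001008017ee81778bbc0e883efba20fbe837441f7d068301b69b65bb2d9365b24926836dbb6b2d924891b683a202000fddedfbbd887eef6204100003bf73b80f43f3f09f8424077ae8fc2104745f84208e8881c4ddbdbb6ddacdbb59636ed658b0022534e9e4f41d1010007eef6fddec440000efdc7eef62041dc06f4af52fa974752e8a2d4ba28910560baeddaed00000800004400088010022004080044008100801e78e71e38f0471e0822383cf2e4b8f041020e4b4fc2fd0fe87c22e079ef43e184f6e87c309ed08800004044022100442080000000000221040800008000008004020080410020104080040208100801bd2bd4bea5d12b05d7752e8a2bb6a5d145764440000000200108002104000841020001082040200400000020010c002187000861c3e0010c387c3ff0000000000000000000000000000000000000000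

theorem sound_ten : Mask.Sound (Mask.row tenTable 163 159) 159 159
    fun v i => weight 10 (tenWord v ^^^ tenWord i) = 4 :=
  Mask.sound_of_check (f := fun v i => Nat.beq (weight 10 (Nat.xor (tenWord v) (tenWord i))) 4)
    (by decide +kernel) fun _ _ => Nat.eq_of_beq_eq_true

theorem bound_ten : Mask.bound (Mask.row tenTable 163 159) 159 17 (2 ^ 159 - 1) = true := by
  decide +kernel

/-- The words of length `11` with weights `0`, `2`, `4` that are different
from `15` and `23` and not at distance `4` from them, each in `11` bits. -/
def elevenWords : ℕ := 0x780e81c8388708e09c0b80ec0d41a4344684d05a0730650c9191321641c618a312622c43863005c0b41642c4584b05606b0550a91512a1541a614a292522a43462804e09a1322624c29832c2544a49452864c4808e11a2324628c31622043884101de03a0720e21c2382702d81a8348688d09a0b30650c9191321630c01702d0590b11612c1560aa1522a2542a61402704d0991312614b09011c22040e780e81c8388708e09b0350690d11a1330600b81682c8588b09582804e0901071e03a0720e21c2360600b814021c3c06008e09c0f01d03601802803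

/-- The word with index `i` in `elevenWords`. -/
def elevenWord (i : ℕ) : ℕ := Nat.mod (Nat.shiftRight elevenWords (Nat.mul 11 i)) 2048

/-- For each word in `elevenWords` the indices of the words at distance `4`. -/
def elevenTable : ℕ := 0x3dfb108fb10888440001deeef7117dee22c8b019dfb908fb908c8460000dee6f711edee23c8f0000e000001c73a00000038e74000000e74ea000386fde843de84342180002f797bc87af790f43c003f80fff00fff0003f5fe001fff015ffe02bf541f7d041f6fbe0a0fbf65f7c141f7ec7c1023f648e017df057df0507dfb2fbe0a0fbf641f7ec009005fbf07dbf07d83e80401f04f82fb1f05f67d8804fe07fe9f0013ff414c0ffd8007d4ffd053ea802633b1873b1867398518001318414630829854707efff02000fc07efc9ffe07f020401fbf2fc900380006271c1d031624e383a062c4b83a746249c6edd741228bac5d7ad451758baf5a0081084251401f81f9f81fbf03f93f03f7e07f2fc0fe40420150a00415e8bf45f41abd17e8be832e02f8be3003f7ff817ff81fc0810000fc07efc80fdf97e4805dbb03744ec8f6477389d91ec8ee620022088619fbf021407debef415fe042821400fbd05615807bf7df04820fb07dfb2fbe09f0408c1f7ecfb247a1bd0f9bd0f978179a840090f908a1f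21179aa1b2646f6e46f6b7b415012109086d5210dab6ab180000003ffffbffdfafffff7ffbf50008140520eb1627c3627c33e13880300980586300b0cc3138bf81f817e07efc0fe4fc0fdf81fc80fc02fe543ef2187cde78143e7cd430f90020450f9f342250f6edb609249b64dbb6a4936c9b76d0081044128d82fbe0b04101f050a1f7c140f5e9fc1428f4d830001ffe01ffefff01403ffdffe02bffc050140031008846277ac423aac4ef5884754ef5057aab16c1801027e0ff07f034fc1fe0fe063c03f0fc60001f7dedf7dec10912fefbd82122584244b00005070e39d0e39d1ce9d400000000000000000001c739863098630800814cf39c630e14c61c28148e2ddb817246e8f7477348dd1ee8ee62002308c6000000700007003803a000e00700740e00e83a1387dfa10901ef6f7b097f4212109003dec2589602eba8a2fd75c0517ef85145f01020d45fbe106c00e1c7074001880c58938e0ef074e803162589271aea28bea28be02041abae028bf7c517ef841b00a2bb175bb17574175a8801117510a2ea2175aa2bf7e042fe04282140001f7afbd057f7a0ac2b00da342f7f42f7d7be0000a105082fea105fd7f0016f23746dc0b9ba3b9a46e8c8008c6e8ee646300e7cf39c30c61630e14618c2c61c280040a0291c5f3e03d41f82fc17d383f05f82fa60800a02860d870bd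e70bde5ef20a808424213ca842795e558601ffffc00001ffefd7ffff8002057ffbf5029075800c02b13e1601619627c2c02c327c2716189c701f7fee08003ff7ea3effd001028ffdfa81480375145d6eba0a2ebd6a28ba8020428baf5a2128b5f42f8742f86800861780f2f86f35f0de686300d7aeb805145fa2fdf0a28bf45fbe00408320d806437dd1c82006e8d186fba302e5cdba3462e6c0309efa2610403d12243df4481dbb3f44891d9b0afa03dedf4213ef612fe8427dec2584240012c050000000000000000000000000000000000000003b80dee77211ef711eee423dee23c4230011e0019004843237b6421b5646f6c8436a6f682bb558d319d8c260004c610533b18673985318414c2a38c1820807df05f82850fbe0bf050a00f5e9fa6c1800000000000000000000000000000000000000003df7bbdf7b842245fbef708448b1089160000d42840097a1f30f908af43e61f2113c0bcdf3543dfbef82bef827c1022820fb07dfb20fbf67d923af807c15f83ebe0becbf07d7c17d907d00bec403790c3e50c3e4008115e78143e7cd87cf9a1128790df746df74605cb9a410037468c6e8d18b9b00af5e03ca17c3be1bcd42f877c37990010c431803800c20703dfe101fee07bfc203fc7bf001fe0018303ff703ff5ffa0a607febff4147fe8280a18f417e0fb7e0faf82fb2fc1f5f05f63e0bec046477bf6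21101deeef7117ec422211003bdc4591603515d8baa200445d442bb17574175b17510bad5173d860fe79e0307efc30c1f810206c1fbf103600c991bda02421210dab237b5bda0ac8436adaac6bf7e07e81f81fc0fe4fc0fc07e017f03f97e543e2441003bec8f6448877d91ec891006edcf7361b3d860fd860fc081034f3c060fdf8c1fbf1036000161805618053e1c32c300a7c3864f870c38938a4b726db726d6c16da9002126d20a4da416daa30000000000000000000000000000000000000001f7e8427e84242120000f7b7bd84bf7b0962580a01c3081c30807bf7fb86100f7eff1efdfe0000070e07bfe07bf3df800030818407fb080ff3fc00006fbde6fbde210e1edf7bc421c3c84387800002be85f0d780f2f86f350be1a00218be1bcd0c600bf7e0fa01f04f82fb2fc1f60fa013e0becfb100debcf02430f987cf9a861f30f9f3400811044a1d2240085b936c9b482b726d936904d82db76d51af5e81da17a27d13d9c2f44fa27b30800902430a0e1c73a0000000000038e7473a750000000003862c4ef5c4ef577a82a02211108eaa211d575562dfbf03f3f03f01f80581f81fc0fe5f81fcbf2a1f9cc31873ce718c38518630800814630e140a471613f07ec008183f81a7e0fcf00fc60fe067e3006101084c2f7984279585ef3084f29ef20af9561807efbd7efbd02142bfdf7a0428560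850ac0000c03ffffbffff800205000007ffbf5fff7ea0520e00000380003801c38800070038710070e238938db4926db6d82936eda924da01020a4dbb6904a36da4936a4936804082b6d82936edb26ddb48251a7f03ff703ff6001f51f0013ff4147fe829f54017713b22ec0ddd91dce276444004476477322186cf9e7806183fc1fbf0c307f83f7e00810340d80701f7fe9f7fe800814c10007fefd4ffdfa814803417df0e82002f870c2fbe180f1e6be1c30f36016f2374723746400461b8173747736e8ee646300c477d9188200ec8910efb2206edcfb22446e6c33f00fbd7e042fde82bfc085fbd0560850002b00dec077bbd8847bdc45fb108f7b88b1088004580cfe03ffdfc003ffe02807ff8001fafff80afd5070000000000000000000000000000000000000004c1800167630b18414cec6163082939cc2b0a8e1bc05ef37a10ef790f6f421def21e4218010f00188efb22efb2206edce20803b2244764488dcd866801420d0bdfa105fda17bf420bf97be005fc000007000070000e74000e0001ce80039d000ea0e286f43e5080121f2115e87cbc0bcd87c845e6a86c589dea02211108eab13bd5dea0ac423aaeaac5c2841007be89f44890f7d13e891200edd9f66c2e03ffc0bffc081fbf27ff8103f7e407efc805a1c00000000000000000000000000000000000000001a2841a2840bdfbfb450817bf7f2f7efe0000000efbdcefbd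c211a3ddf7b84234788468f0000037ef42180bde5ef21ede8434218017bc87a1e0028910022ec5d62ea215d8bac5d44274175bd6a8bc1820007dffaffdfa8fbff5ffbf5000814052003871c1d71c1de0e9d0000c4062c480c5896249c5457a2fa8010517d06af45f5c05f145f41af8c00fc001f9ffe040fdf93ffc081fbf2fc0811f9200000000400004002054000080040a800815056c3dd451754517500408575d05175eb62ebd6884a2dec2f44bd03b7a27b385e89080091e89ecc48617417df0d7df0c078f3504005f0e18be1c30f36017713b2313b22200221d81bbb23b9f64773221869f3e002c0ffd7fe82981ffaffd052001f57d50038703df80c206101fee07bf3df8018407f9fe001fff800407ffbffc0500fff7ff80a0007ebfaa0f84f7d12f7d12076ece10403d12247a2448ecd850001c6201c62e311d4038c5c623ab8c4751d41c30e17bc808424213cac2f797bc82b084f2bcab0c01c0189c018b83b8938031707712e0ee2474270019242192420deddab24841bdbb537b76a056c677ee42301bdcdee23ddc8464230037b88f23c0068504002fbe1df0e185f7c3be1c3003c799e6c0292dc9b5200424da415b936b60b6d936905b6a8c000000400004002054000080040a800815056c5be83f057c07af82fa707e0a0800a3e0be9850c1dec2f44c2f448400487a076f44f67e89ecc48615a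342f7c050828417f685efaf7c00a105fd7f00182fbe0afbe0a07af4e08203e0a147c1428f4d8358b13e100c02601619627c33e1389805866189c0062884628843bd7aac510877af54ef5ea815b172241001bee8f7468c37dd1ee8d1802e5cd73600000000400004002054000080040a800815056c6be83f0583f05040050f80f5f05f4fe0be9850c1d84fc1fcfc1f9e01f860040c1fc0d83f819f8c00030c2130c211ef3e5618423de7ca7bcf940ad860c186321863231932830c64632650c64ca32918a8af45faf45f5c05f0a004145f41a8be835f180028514a8514a8a54aa0a29514a9542952a8aa4a00c186341863431a35030c686346a0c68d435260000000000000000000000000000000000000000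

theorem sound_eleven : Mask.Sound (Mask.row elevenTable 163 157) 157 157
    fun v i => weight 11 (elevenWord v ^^^ elevenWord i) = 4 :=
  Mask.sound_of_check (f := fun v i => Nat.beq (weight 11 (Nat.xor (elevenWord v) (elevenWord i))) 4)
    (by decide +kernel) fun _ _ => Nat.eq_of_beq_eq_true

theorem bound_eleven : Mask.bound (Mask.row elevenTable 163 157) 157 19 (2 ^ 157 - 1) = true := by
  decide +kernel

end Word

/-! ### Codes with a close pair or triple of words -/

namespace Word

open Finset
open scoped symmDiff

theorem card_le_of_card_sdiff_le {α : Type*} [DecidableEq α] {S F : Finset α} {t k : ℕ}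
    (h : (S \ F).card ≤ t) (hF : F.card ≤ k) : S.card ≤ t + k := by
  have := card_le_card_sdiff_add_card (s := S) (t := F)
  omega

theorem card_map_mem {n : ℕ} {σ : Equiv.Perm (Fin n)} {S : Finset (Finset (Fin n))}
    {p : ℕ → Prop} (h : ∀ s ∈ S, p s.card) : ∀ s ∈ permute σ S, p s.card := by
  intro s hs
  obtain ⟨t, ht, rfl⟩ := mem_permute.1 hs
  rw [card_map]
  exact h t ht

/-- Two words of weight 5 at distance 2 share four letters, so a permutation moves them to 31 and
47. Of the 98 words compatible with both, the search allows 10. -/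
theorem card_le_twelve_of_pair {S : Finset (Finset (Fin 10))} (hS : AvoidsFour S)
    (hcard : ∀ s ∈ S, s.card = 5) {s t : Finset (Fin 10)} (hs : s ∈ S) (ht : t ∈ S)
    (hst : (s ∆ t).card = 2) : S.card ≤ 12 := by
  obtain ⟨σ, hσs, hσt⟩ := exists_perm_map s t (ofNat 10 31) (ofNat 10 47)
    (by rw [hcard s hs]; decide +kernel) (by rw [hcard t ht]; decide +kernel) (by
      have := card_symmDiff_add s t
      rw [hcard s hs, hcard t ht] at this
      rw [show (ofNat 10 31 ∩ ofNat 10 47).card = 4 by decide +kernel]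
      omega)
  -- Unlike the table of conflicts, the list of candidate words must be complete; all words of
  -- length 10 are checked.
  have hcov : ∀ x ∈ range (2 ^ 10), weight 10 x = 5 → x ≠ 31 → x ≠ 47 → weight 10 (31 ^^^ x) ≠ 4 →
      weight 10 (47 ^^^ x) ≠ 4 → ∃ i ∈ range 98, sliceWord i = x := by decide +kernel
  have hS' := hS.permute σ
  have h31 : ofNat 10 31 ∈ permute σ S := mem_permute.2 ⟨s, hs, hσs⟩
  have h47 : ofNat 10 47 ∈ permute σ S := mem_permute.2 ⟨t, ht, hσt⟩
  rw [← card_permute σ]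
  refine card_le_of_card_sdiff_le (t := 10) (F := {ofNat 10 31, ofNat 10 47})
    (card_le_of_bound sound_slice bound_slice (hS'.mono sdiff_subset) fun w hw => ?_) card_le_two
  obtain ⟨x, hx, rfl⟩ := exists_ofNat w
  simp only [mem_sdiff, mem_insert, mem_singleton, not_or] at hw
  obtain ⟨i, hi, hix⟩ := hcov x (mem_range.2 hx) (by rw [← card_ofNat]; exact card_map_mem (p := (· = 5)) hcard _ hw.1)
    (fun h => hw.2.1 (by rw [h])) (fun h => hw.2.2 (by rw [h]))
    (by rw [← card_ofNat, ofNat_xor]; exact hS' _ h31 _ hw.1)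
    (by rw [← card_ofNat, ofNat_xor]; exact hS' _ h47 _ hw.1)
  exact ⟨i, mem_range.1 hi, by rw [hix]⟩

/-- Translation by `r` keeps distances and even weights and moves `r` to the empty word. The other
two become pairs of letters with one letter in common, permuted to 3 and 5. The search allows 17
further words. -/
theorem card_le_twenty_of_triple {S : Finset (Finset (Fin 10))} (hS : AvoidsFour S)
    (hcard : ∀ s ∈ S, Even s.card) {r s t : Finset (Fin 10)} (hr : r ∈ S) (hs : s ∈ S) (ht : t ∈ S)
    (hrs : (r ∆ s).card = 2) (hrt : (r ∆ t).card = 2) (hst : (s ∆ t).card = 2) : S.card ≤ 20 := by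
  obtain ⟨σ, hσs, hσt⟩ := exists_perm_map (r ∆ s) (r ∆ t) (ofNat 10 3) (ofNat 10 5)
    (by rw [hrs]; decide +kernel) (by rw [hrt]; decide +kernel) (by
      have := card_symmDiff_add (r ∆ s) (r ∆ t)
      rw [symmDiff_symmDiff_left, hrs, hrt, hst] at this
      rw [show (ofNat 10 3 ∩ ofNat 10 5).card = 1 by decide +kernel]
      omega)
  have hcov : ∀ x ∈ range (2 ^ 10), Even (weight 10 x) → x ≠ 0 → x ≠ 3 → x ≠ 5 →
      weight 10 (0 ^^^ x) ≠ 4 → weight 10 (3 ^^^ x) ≠ 4 → weight 10 (5 ^^^ x) ≠ 4 →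
      ∃ i ∈ range 159, tenWord i = x := by decide +kernel
  have hS' := (hS.translate r).permute σ
  have heven : ∀ w ∈ permute σ (translate r S), Even w.card := by
    refine card_map_mem fun w hw => ?_
    obtain ⟨u, hu, rfl⟩ := mem_translate.1 hw
    have h1 := card_symmDiff_add r u
    have h2 : Even ((r ∆ u).card + 2 * (r ∩ u).card) := by
      rw [h1]; exact (hcard r hr).add (hcard u hu)
    exact (Nat.even_add.1 h2).2 (even_two_mul _)
  have h0 : ofNat 10 0 ∈ permute σ (translate r S) :=
    mem_permute.2 ⟨_, mem_translate.2 ⟨r, hr, rfl⟩, by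
      rw [symmDiff_self]; simp [ofNat]⟩
  have h3 : ofNat 10 3 ∈ permute σ (translate r S) :=
    mem_permute.2 ⟨_, mem_translate.2 ⟨s, hs, rfl⟩, hσs⟩
  have h5 : ofNat 10 5 ∈ permute σ (translate r S) :=
    mem_permute.2 ⟨_, mem_translate.2 ⟨t, ht, rfl⟩, hσt⟩
  rw [← card_translate r, ← card_permute σ]
  refine card_le_of_card_sdiff_le (t := 17) (F := {ofNat 10 0, ofNat 10 3, ofNat 10 5})
    (card_le_of_bound sound_ten bound_ten (hS'.mono sdiff_subset) fun w hw => ?_) card_le_three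
  obtain ⟨x, hx, rfl⟩ := exists_ofNat w
  simp only [mem_sdiff, mem_insert, mem_singleton, not_or] at hw
  obtain ⟨i, hi, hix⟩ := hcov x (mem_range.2 hx) (by rw [← card_ofNat]; exact heven _ hw.1)
    (fun h => hw.2.1 (by rw [h])) (fun h => hw.2.2.1 (by rw [h])) (fun h => hw.2.2.2 (by rw [h]))
    (by rw [← card_ofNat, ofNat_xor]; exact hS' _ h0 _ hw.1)
    (by rw [← card_ofNat, ofNat_xor]; exact hS' _ h3 _ hw.1)
    (by rw [← card_ofNat, ofNat_xor]; exact hS' _ h5 _ hw.1)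
  exact ⟨i, mem_range.1 hi, by rw [hix]⟩

/-- The weights are restricted, so only permutations are available. The two words share three
letters and move to 15 and 23; the search allows 19 further words. -/
theorem card_le_twentyOne_of_pair {S : Finset (Finset (Fin 11))} (hS : AvoidsFour S)
    (hcard : ∀ s ∈ S, s.card = 0 ∨ s.card = 2 ∨ s.card = 4) {s t : Finset (Fin 11)} (hs : s ∈ S)
    (ht : t ∈ S) (hs4 : s.card = 4) (ht4 : t.card = 4) (hst : (s ∆ t).card = 2) :
    S.card ≤ 21 := by
  obtain ⟨σ, hσs, hσt⟩ := exists_perm_map s t (ofNat 11 15) (ofNat 11 23)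
    (by rw [hs4]; decide +kernel) (by rw [ht4]; decide +kernel) (by
      have := card_symmDiff_add s t
      rw [hs4, ht4] at this
      rw [show (ofNat 11 15 ∩ ofNat 11 23).card = 3 by decide +kernel]
      omega)
  have hcov : ∀ x ∈ range (2 ^ 11), (weight 11 x = 0 ∨ weight 11 x = 2 ∨ weight 11 x = 4) → x ≠ 15 →
      x ≠ 23 → weight 11 (15 ^^^ x) ≠ 4 → weight 11 (23 ^^^ x) ≠ 4 →
      ∃ i ∈ range 157, elevenWord i = x := by decide +kernel
  have hS' := hS.permute σ
  have h15 : ofNat 11 15 ∈ permute σ S := mem_permute.2 ⟨s, hs, hσs⟩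
  have h23 : ofNat 11 23 ∈ permute σ S := mem_permute.2 ⟨t, ht, hσt⟩
  rw [← card_permute σ]
  refine card_le_of_card_sdiff_le (t := 19) (F := {ofNat 11 15, ofNat 11 23})
    (card_le_of_bound sound_eleven bound_eleven (hS'.mono sdiff_subset) fun w hw => ?_) card_le_two
  obtain ⟨x, hx, rfl⟩ := exists_ofNat w
  simp only [mem_sdiff, mem_insert, mem_singleton, not_or] at hw
  obtain ⟨i, hi, hix⟩ := hcov x (mem_range.2 hx)
    (by rw [← card_ofNat]; exact card_map_mem (p := fun k => k = 0 ∨ k = 2 ∨ k = 4) hcard _ hw.1)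
    (fun h => hw.2.1 (by rw [h])) (fun h => hw.2.2 (by rw [h]))
    (by rw [← card_ofNat, ofNat_xor]; exact hS' _ h15 _ hw.1)
    (by rw [← card_ofNat, ofNat_xor]; exact hS' _ h23 _ hw.1)
  exact ⟨i, mem_range.1 hi, by rw [hix]⟩

end Word

/-! ### Balls around stars and tetrahedra -/

namespace Word

open Finset
open scoped symmDiff

variable {n : ℕ}

theorem ofNat_injOn (n : ℕ) : Set.InjOn (ofNat n) (Set.Iio (2 ^ n)) := by
  intro x hx y hy h
  refine Nat.eq_of_testBit_eq fun i => ?_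
  rcases lt_or_ge i n with hi | hi
  · have := congrArg (fun s => (⟨i, hi⟩ : Fin n) ∈ s) h
    simp only [mem_ofNat, eq_iff_iff] at this
    exact Bool.eq_iff_iff.2 this
  · rw [Nat.testBit_lt_two_pow (lt_of_lt_of_le hx (Nat.pow_le_pow_right two_pos hi)),
      Nat.testBit_lt_two_pow (lt_of_lt_of_le hy (Nat.pow_le_pow_right two_pos hi))]

theorem card_filter_eq (p : Finset (Fin n) → Prop) [DecidablePred p] :
    (univ.filter p).card = ((range (2 ^ n)).filter fun x => p (ofNat n x)).card := by
  rw [← card_image_of_injOn (s := (range (2 ^ n)).filter fun x => p (ofNat n x)) (f := ofNat n)]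
  · congr 1
    ext s
    simp only [mem_filter, mem_univ, true_and, mem_image, mem_range]
    constructor
    · intro h
      obtain ⟨x, hx, rfl⟩ := exists_ofNat s
      exact ⟨x, ⟨hx, h⟩, rfl⟩
    · rintro ⟨x, ⟨-, h⟩, rfl⟩
      exact h
  · exact (ofNat_injOn n).mono fun x hx => by simp at hx; exact hx.1

theorem card_filter_card_eq (p : ℕ → Prop) [DecidablePred p] :
    (univ.filter fun s : Finset (Fin n) => p s.card).card =
      ((range (2 ^ n)).filter fun x => p (weight n x)).card := by
  rw [card_filter_eq]
  simp only [card_ofNat]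

theorem even_card_symmDiff {s t : Finset (Fin n)} :
    Even (s ∆ t).card ↔ (Even s.card ↔ Even t.card) := by
  have h := card_symmDiff_add s t
  have h2 : Even ((s ∆ t).card + 2 * (s ∩ t).card) ↔ Even (s.card + t.card) := by rw [h]
  rwa [Nat.even_add, Nat.even_add, iff_true_right (even_two_mul _)] at h2

theorem card_symmDiff_triangle (r s t : Finset (Fin n)) :
    (r ∆ t).card ≤ (r ∆ s).card + (s ∆ t).card := by
  refine (card_le_card (symmDiff_triangle r s t)).trans ?_
  rw [sup_eq_union]
  exact card_union_le _ _

theorem card_symmDiff_eq_zero {s t : Finset (Fin n)} : (s ∆ t).card = 0 ↔ s = t := by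
  rw [card_eq_zero, ← bot_eq_empty, symmDiff_eq_bot]

theorem card_symmDiff_singleton (v : Finset (Fin n)) (i : Fin n) :
    (i ∈ v ∧ (v ∆ {i}).card + 1 = v.card) ∨ (i ∉ v ∧ (v ∆ {i}).card = v.card + 1) := by
  have h := card_symmDiff_add v {i}
  rw [card_singleton] at h
  by_cases hi : i ∈ v
  · rw [inter_singleton_of_mem hi, card_singleton] at h
    exact Or.inl ⟨hi, by omega⟩
  · rw [inter_singleton_of_notMem hi, card_empty] at h
    exact Or.inr ⟨hi, by omega⟩

/-- The words at distance `0` or `2` from a word of `K`. -/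
def ball (K : Finset (Finset (Fin n))) : Finset (Finset (Fin n)) :=
  univ.filter fun w => ∃ s ∈ K, (w ∆ s).card = 0 ∨ (w ∆ s).card = 2

theorem mem_ball {K : Finset (Finset (Fin n))} {w : Finset (Fin n)} :
    w ∈ ball K ↔ ∃ s ∈ K, (w ∆ s).card = 0 ∨ (w ∆ s).card = 2 := by simp [ball]

theorem card_ball_permute_le (σ : Equiv.Perm (Fin n)) (K : Finset (Finset (Fin n))) :
    (ball (permute σ K)).card ≤ (ball K).card := by
  rw [← card_permute σ (ball K)]
  refine card_le_card fun w hw => ?_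
  obtain ⟨s, hs, h⟩ := mem_ball.1 hw
  obtain ⟨t, ht, rfl⟩ := mem_permute.1 hs
  have hw' : (w.map σ.symm.toEmbedding).map σ.toEmbedding = w := by
    ext a; simp [mem_map_equiv]
  refine mem_permute.2 ⟨w.map σ.symm.toEmbedding, mem_ball.2 ⟨t, ht, ?_⟩, hw'⟩
  rw [← hw', ← map_symmDiff', card_map] at h
  exact h

theorem card_ball_translate_le (c : Finset (Fin n)) (K : Finset (Finset (Fin n))) :
    (ball (translate c K)).card ≤ (ball K).card := by
  rw [← card_translate c (ball K)]
  refine card_le_card fun w hw => ?_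
  obtain ⟨s, hs, h⟩ := mem_ball.1 hw
  obtain ⟨t, ht, rfl⟩ := mem_translate.1 hs
  have hw' : c ∆ (c ∆ w) = w := symmDiff_symmDiff_cancel_left c w
  refine mem_translate.2 ⟨c ∆ w, mem_ball.2 ⟨t, ht, ?_⟩, hw'⟩
  rw [← hw', symmDiff_symmDiff_left] at h
  exact h

theorem ball_mono {K L : Finset (Finset (Fin n))} (h : K ⊆ L) : ball K ⊆ ball L := fun w hw => by
  obtain ⟨s, hs, hw⟩ := mem_ball.1 hw
  exact mem_ball.2 ⟨s, h hs, hw⟩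

/-- The number of words of length `n` at distance `0` or `2` from a word with code in `L`. -/
def ballCard (n : ℕ) (L : List ℕ) : ℕ := ((range (2 ^ n)).filter fun x =>
  L.any (fun y => decide (weight n (x ^^^ y) = 0 ∨ weight n (x ^^^ y) = 2)) = true).card

theorem card_ball_ofNat (L : List ℕ) : (ball (L.map (ofNat n)).toFinset).card = ballCard n L := by
  rw [ball, card_filter_eq, ballCard]
  congr 1
  ext x
  simp only [← card_ofNat, ofNat_xor]
  simp

/-- A set of words with mutual distances `2` is a star or a tetrahedron. -/
theorem star_or_tetrahedron [NeZero n] {K : Finset (Finset (Fin n))} (hK : K.Nonempty)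
    (hdist : ∀ s ∈ K, ∀ t ∈ K, s ≠ t → (s ∆ t).card = 2) :
    (∃ c, ∀ s ∈ K, (c ∆ s).card = 1) ∨
      ∃ a i j k, i ≠ j ∧ i ≠ k ∧ j ≠ k ∧
        K = {a, a ∆ {i, j}, a ∆ {j, k}, a ∆ {i, k}} := by
  obtain ⟨a, ha⟩ := hK
  by_cases hstar : ∃ i, ∀ s ∈ K, s ≠ a → i ∈ a ∆ s
  · obtain ⟨i, hi⟩ := hstar
    refine Or.inl ⟨a ∆ {i}, fun s hs => ?_⟩
    rw [symmDiff_right_comm]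
    by_cases hsa : s = a
    · rw [hsa, symmDiff_self, bot_symmDiff, card_singleton]
    · have h1 := hi s hs hsa
      have h2 := hdist a ha s hs (Ne.symm hsa)
      rcases card_symmDiff_singleton (a ∆ s) i with ⟨-, h⟩ | ⟨h, -⟩
      · omega
      · exact absurd h1 h
  · push Not at hstar
    -- The letter 0 is arbitrary; only some word other than `a` is wanted.
    obtain ⟨e, he, hea, -⟩ := hstar 0
    have key : ∀ s ∈ K, s ≠ a → (a ∆ s).card = 2 := fun s hs h => hdist a ha s hs (Ne.symm h)
    have meet : ∀ s ∈ K, ∀ t ∈ K, s ≠ a → t ≠ a → ((a ∆ s) ∩ (a ∆ t)).Nonempty := by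
      intro s hs t ht hsa hta
      by_cases hst : s = t
      · rw [hst, inter_self, ← card_pos, key t ht hta]; norm_num
      · have h := card_symmDiff_add (a ∆ s) (a ∆ t)
        rw [symmDiff_symmDiff_left, hdist s hs t ht hst, key s hs hsa, key t ht hta] at h
        rw [← card_pos]; omega
    obtain ⟨i, j, hij, hee⟩ := card_eq_two.1 (key e he hea)
    obtain ⟨f, hf, hfa, hif⟩ := hstar i
    obtain ⟨g, hg, hga, hjg⟩ := hstar j
    have hjf : j ∈ a ∆ f := by
      obtain ⟨y, hy⟩ := meet e he f hf hea hfa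
      rw [mem_inter, hee, mem_insert, mem_singleton] at hy
      rcases hy with ⟨rfl | rfl, h⟩
      · exact absurd h hif
      · exact h
    have hig : i ∈ a ∆ g := by
      obtain ⟨y, hy⟩ := meet e he g hg hea hga
      rw [mem_inter, hee, mem_insert, mem_singleton] at hy
      rcases hy with ⟨rfl | rfl, h⟩
      · exact h
      · exact absurd h hjg
    obtain ⟨k, hk⟩ := meet f hf g hg hfa hga
    rw [mem_inter] at hk
    have hik : i ≠ k := fun h => hif (h ▸ hk.1)
    have hjk : j ≠ k := fun h => hjg (h ▸ hk.2)
    have hff : {j, k} = a ∆ f := eq_of_subset_of_card_le (by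
      intro y hy; rw [mem_insert, mem_singleton] at hy
      rcases hy with rfl | rfl; exacts [hjf, hk.1]) (by rw [key f hf hfa, card_pair hjk])
    have hgg : {i, k} = a ∆ g := eq_of_subset_of_card_le (by
      intro y hy; rw [mem_insert, mem_singleton] at hy
      rcases hy with rfl | rfl; exacts [hig, hk.2]) (by rw [key g hg hga, card_pair hik])
    refine Or.inr ⟨a, i, j, k, hij, hik, hjk, ?_⟩
    rw [← hee, hff, hgg, symmDiff_symmDiff_cancel_left, symmDiff_symmDiff_cancel_left,
      symmDiff_symmDiff_cancel_left]
    ext s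
    simp only [mem_insert, mem_singleton]
    constructor
    · intro hs
      by_cases hsa : s = a
      · exact Or.inl hsa
      · right
        -- A two-letter set that meets all three sides of the triangle on `i`, `j`, `k` contains two
        -- of these letters, so it is one of the sides.
        have h1 := meet s hs e he hsa hea
        have h2 := meet s hs f hf hsa hfa
        have h3 := meet s hs g hg hsa hga
        rw [hee] at h1
        rw [← hff] at h2
        rw [← hgg] at h3
        have hpair : ∀ x y, x ≠ y → x ∈ a ∆ s → y ∈ a ∆ s → ({x, y} : Finset (Fin n)) = a ∆ s := by
          intro x y hxy hx hy
          refine eq_of_subset_of_card_le (fun z hz => ?_) (by rw [key s hs hsa, card_pair hxy])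
          rw [mem_insert, mem_singleton] at hz
          rcases hz with rfl | rfl
          exacts [hx, hy]
        have hcases : (i ∈ a ∆ s ∧ j ∈ a ∆ s) ∨ (j ∈ a ∆ s ∧ k ∈ a ∆ s) ∨
            (i ∈ a ∆ s ∧ k ∈ a ∆ s) := by
          have e1 : i ∈ a ∆ s ∨ j ∈ a ∆ s := by
            obtain ⟨y, hy⟩ := h1
            simp only [mem_inter, mem_insert, mem_singleton] at hy
            rcases hy with ⟨h, rfl | rfl⟩ <;> simp [h]
          have e2 : j ∈ a ∆ s ∨ k ∈ a ∆ s := by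
            obtain ⟨y, hy⟩ := h2
            simp only [mem_inter, mem_insert, mem_singleton] at hy
            rcases hy with ⟨h, rfl | rfl⟩ <;> simp [h]
          have e3 : i ∈ a ∆ s ∨ k ∈ a ∆ s := by
            obtain ⟨y, hy⟩ := h3
            simp only [mem_inter, mem_insert, mem_singleton] at hy
            rcases hy with ⟨h, rfl | rfl⟩ <;> simp [h]
          tauto
        rcases hcases with ⟨hx, hy⟩ | ⟨hx, hy⟩ | ⟨hx, hy⟩
        · left
          exact symmDiff_right_injective a ((hpair i j hij hx hy).symm.trans hee.symm)
        · right; left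
          exact symmDiff_right_injective a ((hpair j k hjk hx hy).symm.trans hff)
        · right; right
          exact symmDiff_right_injective a ((hpair i k hik hx hy).symm.trans hgg)
    · rintro (rfl | rfl | rfl | rfl) <;> assumption

/-- A star is a translate of a set of words of weight one. -/
theorem exists_eq_translate {K : Finset (Finset (Fin n))} {c : Finset (Fin n)}
    (hc : ∀ s ∈ K, (c ∆ s).card = 1) :
    ∃ I : Finset (Fin n), I.card = K.card ∧ K = translate c (I.image fun i => {i}) := by
  have hK : K = translate c ((univ.filter fun i => c ∆ {i} ∈ K).image fun i => {i}) := by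
    ext s
    simp only [mem_translate, mem_image, mem_filter, mem_univ, true_and]
    constructor
    · intro hs
      obtain ⟨i, hi⟩ := card_eq_one.1 (hc s hs)
      have : c ∆ {i} = s := by rw [← hi, symmDiff_symmDiff_cancel_left]
      exact ⟨{i}, ⟨i, by rwa [this], rfl⟩, this⟩
    · rintro ⟨-, ⟨i, hi, rfl⟩, rfl⟩
      exact hi
  refine ⟨_, ?_, hK⟩
  conv_rhs => rw [hK]
  rw [card_translate, card_image_of_injective _ (fun a b h => by simpa using h)]

/-- Permutations and translations preserve distances, so the ball of a cluster is at least as large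
as that of the standard words it is moved onto, whose size can be computed. -/
theorem ballCard_le_of_subset {L : List ℕ} {K : Finset (Finset (Fin n))} (σ : Equiv.Perm (Fin n))
    (c : Finset (Fin n)) (h : ∀ x ∈ L, ofNat n x ∈ permute σ (translate c K)) :
    ballCard n L ≤ (ball K).card := by
  rw [← card_ball_ofNat]
  refine (card_le_card (ball_mono (L := permute σ (translate c K)) fun s hs => ?_)).trans
    ((card_ball_permute_le _ _).trans (card_ball_translate_le _ _))
  simp only [List.mem_toFinset, List.mem_map] at hs
  obtain ⟨x, hx, rfl⟩ := hs
  exact h x hx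

/-- Translation by the centre turns the star into one-letter words, and a permutation moves these to
the first `m` letters. -/
theorem ballCard_star_le {m : ℕ} {K : Finset (Finset (Fin n))} {c : Finset (Fin n)}
    (hc : ∀ s ∈ K, (c ∆ s).card = 1) (hK : K.card = m) :
    ballCard n ((List.range m).map (2 ^ ·)) ≤ (ball K).card := by
  obtain ⟨I, hI, hKI⟩ := exists_eq_translate hc
  have hm : m ≤ n := by
    rw [← hK, ← hI]
    exact (card_le_univ I).trans (Fintype.card_fin n).le
  obtain ⟨σ, hσ, -⟩ := exists_perm_map I ∅ (univ.filter fun i : Fin n => (i : ℕ) < m) ∅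
    (by rw [Fin.card_filter_val_lt, hI, hK]; omega) rfl (by simp)
  refine ballCard_le_of_subset σ c fun x hx => ?_
  obtain ⟨i, hi, rfl⟩ := List.mem_map.1 hx
  rw [List.mem_range] at hi
  have hin : i < n := hi.trans_le hm
  refine mem_permute.2 ⟨{σ.symm ⟨i, hin⟩}, mem_translate.2 ⟨c ∆ {σ.symm ⟨i, hin⟩}, ?_,
    symmDiff_symmDiff_cancel_left _ _⟩, ?_⟩
  · rw [hKI]
    refine mem_translate.2 ⟨_, mem_image_of_mem _ ?_, rfl⟩
    have : (⟨i, hin⟩ : Fin n) ∈ I.map σ.toEmbedding := by rw [hσ]; simpa using hi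
    rwa [mem_map_equiv] at this
  · ext a
    simp [mem_ofNat, Nat.testBit_two_pow, Fin.ext_iff, eq_comm]

/-- Translation by `a` leaves the empty word and the sides of a triangle. Moving two sides to 3 and
6 moves the third, their symmetric difference, to 5. -/
theorem ballCard_tetrahedron_le (hn : 3 ≤ n) {K : Finset (Finset (Fin n))} {a : Finset (Fin n)}
    {i j k : Fin n} (hij : i ≠ j) (hik : i ≠ k) (hjk : j ≠ k)
    (hK : K = {a, a ∆ {i, j}, a ∆ {j, k}, a ∆ {i, k}}) : ballCard n [0, 3, 6, 5] ≤ (ball K).card := by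
  have h3 : ofNat n 3 = {⟨0, by omega⟩, ⟨1, by omega⟩} := by
    ext x
    rw [mem_ofNat, show (3 : ℕ) = 2 ^ 0 ||| 2 ^ 1 from rfl, Nat.testBit_or, Nat.testBit_two_pow,
      Nat.testBit_two_pow]
    simp only [Bool.or_eq_true, decide_eq_true_eq, mem_insert, mem_singleton, Fin.ext_iff]
    omega
  have h6 : ofNat n 6 = {⟨1, by omega⟩, ⟨2, by omega⟩} := by
    ext x
    rw [mem_ofNat, show (6 : ℕ) = 2 ^ 1 ||| 2 ^ 2 from rfl, Nat.testBit_or, Nat.testBit_two_pow,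
      Nat.testBit_two_pow]
    simp only [Bool.or_eq_true, decide_eq_true_eq, mem_insert, mem_singleton, Fin.ext_iff]
    omega
  have hinter : ∀ i j k : Fin n, i ≠ j → i ≠ k → j ≠ k →
      ({i, j} : Finset (Fin n)) ∩ {j, k} = {j} := by
    intro i j k hij hik hjk
    ext x
    simp only [mem_inter, mem_insert, mem_singleton]
    constructor
    · rintro ⟨rfl | h1, h2 | rfl⟩ <;> simp_all
    · rintro rfl; simp
  have hsymm : ∀ i j k : Fin n, i ≠ j → i ≠ k → j ≠ k →
      ({i, j} : Finset (Fin n)) ∆ {j, k} = {i, k} := by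
    intro i j k hij hik hjk
    ext x
    simp only [mem_symmDiff, mem_insert, mem_singleton]
    constructor
    · rintro (⟨h1, h2⟩ | ⟨h1, h2⟩) <;> tauto
    · rintro (rfl | rfl)
      · left; exact ⟨Or.inl rfl, by tauto⟩
      · right; exact ⟨Or.inr rfl, by simp [Ne.symm hik, Ne.symm hjk]⟩
  have h01 : (⟨0, by omega⟩ : Fin n) ≠ ⟨1, by omega⟩ := by simp
  have h12 : (⟨1, by omega⟩ : Fin n) ≠ ⟨2, by omega⟩ := by simp
  have h02 : (⟨0, by omega⟩ : Fin n) ≠ ⟨2, by omega⟩ := by simp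
  obtain ⟨σ, hσ, hσ'⟩ := exists_perm_map {i, j} {j, k} (ofNat n 3) (ofNat n 6)
    (by rw [h3, card_pair hij, card_pair h01]) (by rw [h6, card_pair hjk, card_pair h12])
    (by rw [h3, h6, hinter _ _ _ hij hik hjk, hinter _ _ _ h01 h02 h12]; simp)
  have hmem : ∀ d, a ∆ d ∈ K → d.map σ.toEmbedding ∈ permute σ (translate a K) := fun d hd =>
    mem_permute.2 ⟨d, mem_translate.2 ⟨_, hd, symmDiff_symmDiff_cancel_left _ _⟩, rfl⟩
  refine ballCard_le_of_subset σ a fun x hx => ?_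
  simp only [List.mem_cons, List.not_mem_nil, or_false] at hx
  rcases hx with rfl | rfl | rfl | rfl
  · have : ofNat n 0 = (∅ : Finset (Fin n)).map σ.toEmbedding := by simp [ofNat]
    rw [this]
    exact hmem ∅ (by rw [hK, ← bot_eq_empty, symmDiff_bot]; simp)
  · rw [← hσ]; exact hmem _ (by simp [hK])
  · rw [← hσ']; exact hmem _ (by simp [hK])
  · rw [show (5 : ℕ) = 3 ^^^ 6 by rfl, ofNat_xor, ← hσ, ← hσ', ← map_symmDiff',
      hsymm _ _ _ hij hik hjk]
    exact hmem _ (by simp [hK])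

end Word

/-! ### Clusters, packing, and the bounds 12, 20 and 32 -/

namespace Word

open Finset
open scoped symmDiff

variable {n : ℕ}

/-- The words of `S` at distance at most `2` from `s`. -/
def cluster (S : Finset (Finset (Fin n))) (s : Finset (Fin n)) : Finset (Finset (Fin n)) :=
  S.filter fun t => (s ∆ t).card ≤ 2

theorem mem_cluster {S : Finset (Finset (Fin n))} {s t : Finset (Fin n)} :
    t ∈ cluster S s ↔ t ∈ S ∧ (s ∆ t).card ≤ 2 := by simp [cluster]

/-- Distances are even and 4 is excluded. With the triangle inequality this makes "distance at most
2" transitive on `S`. -/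
theorem AvoidsFour.near_trans {S : Finset (Finset (Fin n))} (hS : AvoidsFour S)
    (heven : ∀ s ∈ S, Even s.card) {s t : Finset (Fin n)} (hs : s ∈ S) (ht : t ∈ S)
    (h : (s ∆ t).card ≤ 4) : (s ∆ t).card ≤ 2 := by
  have h1 := hS s hs t ht
  obtain ⟨k, hk⟩ : Even (s ∆ t).card := even_card_symmDiff.2 (iff_of_true (heven s hs) (heven t ht))
  omega

theorem AvoidsFour.dist_cluster {S : Finset (Finset (Fin n))} (hS : AvoidsFour S)
    (heven : ∀ s ∈ S, Even s.card) {r s t : Finset (Fin n)} (hs : s ∈ cluster S r)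
    (ht : t ∈ cluster S r) (hst : s ≠ t) : (s ∆ t).card = 2 := by
  rw [mem_cluster] at hs ht
  have h1 := card_symmDiff_triangle s r t
  rw [symmDiff_comm s r] at h1
  have h2 := hS.near_trans heven hs.1 ht.1 (by omega)
  obtain ⟨k, hk⟩ : Even (s ∆ t).card :=
    even_card_symmDiff.2 (iff_of_true (heven s hs.1) (heven t ht.1))
  have h3 : (s ∆ t).card ≠ 0 := fun h => hst (card_symmDiff_eq_zero.1 h)
  omega

theorem self_mem_cluster {S : Finset (Finset (Fin n))} {s : Finset (Fin n)} (hs : s ∈ S) :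
    s ∈ cluster S s := mem_cluster.2 ⟨hs, by simp⟩

/-- A packing bound: the balls around different clusters are disjoint. -/
theorem AvoidsFour.card_mul_le {S : Finset (Finset (Fin n))} (hS : AvoidsFour S)
    (heven : ∀ s ∈ S, Even s.card) {p q : ℕ}
    (hball : ∀ s ∈ S, p * (cluster S s).card ≤ q * (ball (cluster S s)).card) :
    p * S.card ≤ q * (univ.filter fun w : Finset (Fin n) => Even w.card).card := by
  have hmerge : ∀ s ∈ S, ∀ t ∈ S, (s ∆ t).card ≤ 2 → cluster S s = cluster S t := by
    have key : ∀ s ∈ S, ∀ t ∈ S, (s ∆ t).card ≤ 2 → cluster S s ⊆ cluster S t := by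
      intro s hs t ht hst u hu
      rw [mem_cluster] at hu ⊢
      have := card_symmDiff_triangle t s u
      rw [symmDiff_comm t s] at this
      exact ⟨hu.1, hS.near_trans heven ht hu.1 (by omega)⟩
    exact fun s hs t ht h => (key s hs t ht h).antisymm (key t ht s hs (by rwa [symmDiff_comm]))
  set 𝒦 := S.image (cluster S) with h𝒦
  have hcover : S ⊆ 𝒦.biUnion id := fun s hs =>
    mem_biUnion.2 ⟨_, mem_image_of_mem _ hs, self_mem_cluster hs⟩
  have hdisj : (𝒦 : Set (Finset (Finset (Fin n)))).PairwiseDisjoint ball := by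
    intro K hK L hL hne
    obtain ⟨s, hs, rfl⟩ := mem_image.1 (mem_coe.1 hK)
    obtain ⟨t, ht, rfl⟩ := mem_image.1 (mem_coe.1 hL)
    refine disjoint_left.2 fun w hw hw' => hne ?_
    obtain ⟨u, hu, huw⟩ := mem_ball.1 hw
    obtain ⟨v, hv, hvw⟩ := mem_ball.1 hw'
    rw [mem_cluster] at hu hv
    have h := card_symmDiff_triangle u w v
    rw [symmDiff_comm u w] at h
    rw [hmerge s hs u hu.1 hu.2, hmerge t ht v hv.1 hv.2]
    -- A common word of two balls puts `u` and `v` at distance at most 4, hence at most 2, hence in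
    -- one cluster.
    exact hmerge u hu.1 v hv.1 (hS.near_trans heven hu.1 hv.1 (by omega))
  have hsub : 𝒦.biUnion ball ⊆ univ.filter fun w : Finset (Fin n) => Even w.card := by
    intro w hw
    obtain ⟨K, hK, hw⟩ := mem_biUnion.1 hw
    obtain ⟨s, hs, rfl⟩ := mem_image.1 hK
    obtain ⟨u, hu, huw⟩ := mem_ball.1 hw
    have h1 : Even (w ∆ u).card := by rcases huw with h | h <;> rw [h] <;> decide
    simpa using (even_card_symmDiff.1 h1).2 (heven u (mem_cluster.1 hu).1)
  calc p * S.card ≤ p * ∑ K ∈ 𝒦, K.card :=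
        Nat.mul_le_mul_left _ ((card_le_card hcover).trans card_biUnion_le)
    _ = ∑ K ∈ 𝒦, p * K.card := mul_sum _ _ _
    _ ≤ ∑ K ∈ 𝒦, q * (ball K).card := sum_le_sum fun K hK => by
        obtain ⟨s, hs, rfl⟩ := mem_image.1 hK
        exact hball s hs
    _ = q * (𝒦.biUnion ball).card := by rw [card_biUnion hdisj, mul_sum]
    _ ≤ _ := Nat.mul_le_mul_left _ (card_le_card hsub)

theorem card_even_ten : (univ.filter fun w : Finset (Fin 10) => Even w.card).card = 512 := by
  rw [card_filter_card_eq]; decide +kernel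

theorem card_even_eleven : (univ.filter fun w : Finset (Fin 11) => Even w.card).card = 1024 := by
  rw [card_filter_card_eq]; decide +kernel

theorem card_five_ten : (univ.filter fun w : Finset (Fin 10) => w.card = 5).card = 252 :=
  (card_filter_card_eq (· = 5)).trans (by decide +kernel)

/-- Words of equal weight whose common parts of size `k` are all different. -/
theorem card_mul_choose_le {S : Finset (Finset (Fin n))} {k m : ℕ} (hcard : ∀ s ∈ S, s.card = m)
    (hinter : ∀ s ∈ S, ∀ t ∈ S, s ≠ t → (s ∩ t).card < k) : S.card * m.choose k ≤ n.choose k := by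
  have hdisj : (S : Set (Finset (Fin n))).PairwiseDisjoint (powersetCard k) := by
    intro s hs t ht hne
    refine disjoint_left.2 fun w hw hw' => ?_
    rw [mem_powersetCard] at hw hw'
    have := card_le_card (subset_inter hw.1 hw'.1)
    have := hinter s hs t ht hne
    omega
  have h := card_le_card (subset_univ (S.biUnion (powersetCard k)))
  have h' : S.biUnion (powersetCard k) ⊆ powersetCard k univ := by
    refine biUnion_subset.2 fun s _ => powersetCard_mono (subset_univ s)
  have := card_le_card h'
  rw [card_biUnion hdisj, card_powersetCard, card_univ, Fintype.card_fin,
    sum_congr rfl fun s hs => by rw [card_powersetCard, hcard s hs], sum_const, smul_eq_mul] at this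
  exact this

/-- Without a pair at distance 2 all distances are at least 6, so two words share at most two
letters and no triple lies in both. Counting triples gives `10 * |S| ≤ 120`. -/
theorem card_le_twelve {S : Finset (Finset (Fin 10))} (hS : AvoidsFour S)
    (hcard : ∀ s ∈ S, s.card = 5) : S.card ≤ 12 := by
  by_cases h : ∃ s ∈ S, ∃ t ∈ S, (s ∆ t).card = 2
  · obtain ⟨s, hs, t, ht, hst⟩ := h
    exact card_le_twelve_of_pair hS hcard hs ht hst
  · push Not at h
    have := card_mul_choose_le (k := 3) hcard fun s hs t ht hne => by
      have h1 := card_symmDiff_add s t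
      have h2 := h s hs t ht
      have h3 := hS s hs t ht
      have h4 : (s ∆ t).card ≠ 0 := fun h => hne (card_symmDiff_eq_zero.1 h)
      rw [hcard s hs, hcard t ht] at h1
      omega
    rw [show Nat.choose 5 3 = 10 by rfl, show Nat.choose 10 3 = 120 by rfl] at this
    omega

theorem card_le_twenty {S : Finset (Finset (Fin 10))} (hS : AvoidsFour S)
    (heven : ∀ s ∈ S, Even s.card) : S.card ≤ 20 := by
  by_cases h : ∃ r ∈ S, 2 < (cluster S r).card
  · obtain ⟨r, -, hr⟩ := h
    obtain ⟨s, t, u, hs, ht, hu, hst, hsu, htu⟩ := two_lt_card_iff.1 hr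
    exact card_le_twenty_of_triple hS heven (mem_cluster.1 hs).1 (mem_cluster.1 ht).1
      (mem_cluster.1 hu).1 (hS.dist_cluster heven hs ht hst) (hS.dist_cluster heven hs hu hsu)
      (hS.dist_cluster heven ht hu htu)
  · push Not at h
    -- 25 is the least integer whose product with 21 exceeds 512. Clusters of one or two words have
    -- balls of at least 46 and 74 words, which is more than enough.
    have hpack := hS.card_mul_le heven (p := 25) (q := 1) fun s hs => by
      have hpos : 0 < (cluster S s).card := card_pos.2 ⟨s, self_mem_cluster hs⟩
      have hdist := fun t ht u hu htu =>
        hS.dist_cluster heven (r := s) (s := t) (t := u) ht hu htu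
      rcases star_or_tetrahedron ⟨s, self_mem_cluster hs⟩ hdist with ⟨c, hc⟩ | ⟨a, i, j, k, hij, hik, hjk, hK⟩
      · have h1 := h s hs
        generalize hK : cluster S s = K at *
        obtain hm | hm : K.card = 1 ∨ K.card = 2 := by omega
        · have := ballCard_star_le hc hm
          rw [show ballCard 10 ((List.range 1).map (2 ^ ·)) = 46 by decide +kernel] at this
          omega
        · have := ballCard_star_le hc hm
          rw [show ballCard 10 ((List.range 2).map (2 ^ ·)) = 74 by decide +kernel] at this
          omega
      · have h1 := h s hs
        have := ballCard_tetrahedron_le (by norm_num) hij hik hjk hK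
        rw [show ballCard 10 [0, 3, 6, 5] = 116 by decide +kernel] at this
        omega
    rw [card_even_ten] at hpack
    omega

/-- Words of weights `0`, `2` and `4`. -/
theorem card_le_twentyOne {S : Finset (Finset (Fin 11))} (hS : AvoidsFour S)
    (hcard : ∀ s ∈ S, s.card = 0 ∨ s.card = 2 ∨ s.card = 4) : S.card ≤ 21 := by
  by_cases h : ∃ s ∈ S, ∃ t ∈ S, s.card = 4 ∧ t.card = 4 ∧ (s ∆ t).card = 2
  · obtain ⟨s, hs, t, ht, hs4, ht4, hst⟩ := h
    exact card_le_twentyOne_of_pair hS hcard hs ht hs4 ht4 hst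
  · push Not at h
    -- Words of weight 4 are now at least 6 apart and share at most one letter. Counting pairs of
    -- letters, `6 * m ≤ 55`, leaves at most 9 of them.
    have h4 := card_mul_choose_le (S := S.filter fun s => s.card = 4) (k := 2) (m := 4)
      (fun s hs => (mem_filter.1 hs).2) fun s hs t ht hne => by
        rw [mem_filter] at hs ht
        have h1 := card_symmDiff_add s t
        have h2 := h s hs.1 t ht.1 hs.2 ht.2
        have h3 := hS s hs.1 t ht.1
        have h4 : (s ∆ t).card ≠ 0 := fun h => hne (card_symmDiff_eq_zero.1 h)
        rw [hs.2, ht.2] at h1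
        omega
    -- Words of weights 0 and 2 are at most 4 apart, so at distance 2. They form a star with at most
    -- 11 words or a tetrahedron with 4, and 9 + 11 < 21.
    have h02 : (S.filter fun s => ¬ s.card = 4).card ≤ 11 := by
      rcases (S.filter fun s => ¬ s.card = 4).eq_empty_or_nonempty with h0 | hne
      · rw [h0]; simp
      have hdist : ∀ s ∈ S.filter (fun s => ¬ s.card = 4), ∀ t ∈ S.filter (fun s => ¬ s.card = 4),
          s ≠ t → (s ∆ t).card = 2 := by
        intro s hs t ht hne
        rw [mem_filter] at hs ht
        have h1 := card_symmDiff_add s t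
        have h2 := hcard s hs.1
        have h2' := hcard t ht.1
        have h3 := hS s hs.1 t ht.1
        have h4 : (s ∆ t).card ≠ 0 := fun h => hne (card_symmDiff_eq_zero.1 h)
        have := hs.2
        have := ht.2
        omega
      rcases star_or_tetrahedron hne hdist with ⟨c, hc⟩ | ⟨a, i, j, k, -, -, -, hK⟩
      · obtain ⟨I, hI, -⟩ := exists_eq_translate hc
        rw [← hI]
        exact (card_le_univ I).trans (Fintype.card_fin 11).le
      · rw [hK]
        exact card_le_four.trans (by norm_num)
    have := card_filter_add_card_filter_not (s := S) fun s => s.card = 4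
    rw [show Nat.choose 4 2 = 6 by rfl, show Nat.choose 11 2 = 55 by rfl] at h4
    omega

/-- The star consists of the words `c ∆ {i}` with `i ∈ I`, and every other word `w` is at distance
at least 6 from each of them. So `c ∆ w`, which has odd size, has size at least 5; size 5 forces it
to avoid `I`, hence to be the complement of `I` with `|I| = 6`. The remaining words have `c ∆ w` of
size at least 7. -/
theorem card_le_thirtyTwo_of_star {S : Finset (Finset (Fin 11))} (hS : AvoidsFour S)
    (heven : ∀ s ∈ S, Even s.card) {r c : Finset (Fin 11)} (hr : r ∈ S)
    (hc : ∀ s ∈ cluster S r, (c ∆ s).card = 1) (h6 : 6 ≤ (cluster S r).card) : S.card ≤ 32 := by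
  obtain ⟨I, hI, hKI⟩ := exists_eq_translate hc
  have hI11 : I.card ≤ 11 := (card_le_univ I).trans (Fintype.card_fin 11).le
  have hodd : ¬ Even c.card := fun h => by
    have h1 : Even (c ∆ r).card := even_card_symmDiff.2 (iff_of_true h (heven r hr))
    rw [hc r (self_mem_cluster hr)] at h1
    exact absurd h1 (by decide)
  have hout : ∀ w ∈ S \ cluster S r, ¬ Even (c ∆ w).card ∧ ∀ i ∈ I, 6 ≤ ((c ∆ w) ∆ {i}).card := by
    intro w hw
    rw [mem_sdiff] at hw
    refine ⟨fun h => hodd ((even_card_symmDiff.1 h).2 (heven w hw.1)), fun i hi => ?_⟩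
    have hmem : c ∆ {i} ∈ cluster S r := by
      rw [hKI]; exact mem_translate.2 ⟨_, mem_image_of_mem _ hi, rfl⟩
    have hmem' := mem_cluster.1 hmem
    have hdist : (c ∆ w) ∆ {i} = (c ∆ {i}) ∆ w := symmDiff_right_comm _ _ _
    rw [hdist]
    by_contra hlt
    have h1 : Even ((c ∆ {i}) ∆ w).card :=
      even_card_symmDiff.2 (iff_of_true (heven _ hmem'.1) (heven w hw.1))
    have h2 := hS _ hmem'.1 w hw.1
    have h3 := card_symmDiff_triangle r (c ∆ {i}) w
    obtain ⟨k, hk⟩ := h1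
    exact hw.2 (mem_cluster.2 ⟨hw.1, hS.near_trans heven hr hw.1 (by omega)⟩)
  obtain ⟨i₀, hi₀⟩ : I.Nonempty := card_pos.1 (by omega)
  have hge : ∀ w ∈ S \ cluster S r, 5 ≤ (c ∆ w).card := fun w hw => by
    have h1 := (hout w hw).2 i₀ hi₀
    rcases card_symmDiff_singleton (c ∆ w) i₀ with ⟨-, h⟩ | ⟨-, h⟩ <;> omega
  have hfive : ∀ w ∈ S \ cluster S r, (c ∆ w).card = 5 → I.card = 6 ∧ c ∆ w = Iᶜ := by
    intro w hw h5
    have hsub : c ∆ w ⊆ Iᶜ := by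
      intro i hi
      rw [mem_compl]
      intro hiI
      have h1 := (hout w hw).2 i hiI
      rcases card_symmDiff_singleton (c ∆ w) i with ⟨-, h⟩ | ⟨h, -⟩
      · omega
      · exact h hi
    have hcompl : Iᶜ.card = 11 - I.card := by rw [card_compl, Fintype.card_fin]
    have := card_le_card hsub
    exact ⟨by omega, eq_of_subset_of_card_le hsub (by omega)⟩
  -- Either there is no word at distance 5 and the star has at most 11 words, or there is exactly
  -- one and the sum is 6 + 1.
  have hE : I.card + ((S \ cluster S r).filter fun w => (c ∆ w).card = 5).card ≤ 11 := by
    rcases ((S \ cluster S r).filter fun w => (c ∆ w).card = 5).eq_empty_or_nonempty with h0 | ⟨w, hw⟩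
    · rw [h0]; simpa using hI11
    · have h1 : ((S \ cluster S r).filter fun w => (c ∆ w).card = 5).card ≤ 1 := by
        rw [card_le_one]
        intro u hu v hv
        rw [mem_filter] at hu hv
        exact symmDiff_right_injective c ((hfive u hu.1 hu.2).2.trans (hfive v hv.1 hv.2).2.symm)
      rw [mem_filter] at hw
      have := (hfive w hw.1 hw.2).1
      omega
  -- Translation by the complement of `c` complements `c ∆ w`, so the sizes 7, 9 and 11 become the
  -- weights 4, 2 and 0.
  have hW : ((S \ cluster S r).filter fun w => ¬ (c ∆ w).card = 5).card ≤ 21 := by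
    rw [← card_translate cᶜ]
    refine card_le_twentyOne ((hS.mono ((filter_subset _ _).trans sdiff_subset)).translate _) ?_
    intro s hs
    obtain ⟨w, hw, rfl⟩ := mem_translate.1 hs
    rw [mem_filter] at hw
    have h1 := hge w hw.1
    have h2 : cᶜ ∆ w = (c ∆ w)ᶜ := by
      ext x; simp only [mem_symmDiff, mem_compl]; tauto
    have h3 := (hout w hw.1).1
    have h4 : (c ∆ w).card ≤ 11 := (card_le_univ _).trans (Fintype.card_fin 11).le
    rw [h2, card_compl, Fintype.card_fin]
    rw [Nat.not_even_iff] at h3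
    have := hw.2
    omega
  have h1 := card_filter_add_card_filter_not (s := S \ cluster S r) fun w => (c ∆ w).card = 5
  have h2 := card_sdiff_add_card_eq_card (filter_subset (fun t => (r ∆ t).card ≤ 2) S)
  change (S \ cluster S r).card + (cluster S r).card = S.card at h2
  omega

/-- Clusters of six or more words are stars and are treated separately. In smaller clusters each
word accounts for at least 156/5 words of the ball. A star of five words attains this ratio: seen
from its centre, its ball has 11 words of weight 1 and 165 - 20 of weight 3. As `33 * 156 > 5 *
1024`, packing gives 32. -/
theorem card_le_thirtyTwo {S : Finset (Finset (Fin 11))} (hS : AvoidsFour S)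
    (heven : ∀ s ∈ S, Even s.card) : S.card ≤ 32 := by
  have hdist := fun r t ht u hu htu =>
    hS.dist_cluster heven (r := r) (s := t) (t := u) ht hu htu
  by_cases h : ∃ r ∈ S, 6 ≤ (cluster S r).card
  · obtain ⟨r, hr, h6⟩ := h
    rcases star_or_tetrahedron ⟨r, self_mem_cluster hr⟩ (hdist r) with
      ⟨c, hc⟩ | ⟨a, i, j, k, -, -, -, hK⟩
    · exact card_le_thirtyTwo_of_star hS heven hr hc h6
    · have : (cluster S r).card ≤ 4 := by rw [hK]; exact card_le_four
      omega
  · push Not at h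
    have hpack := hS.card_mul_le heven (p := 156) (q := 5) fun s hs => by
      have hpos : 0 < (cluster S s).card := card_pos.2 ⟨s, self_mem_cluster hs⟩
      have h1 := h s hs
      rcases star_or_tetrahedron ⟨s, self_mem_cluster hs⟩ (hdist s) with
        ⟨c, hc⟩ | ⟨a, i, j, k, hij, hik, hjk, hK⟩
      · have h2 := ballCard_star_le hc rfl
        generalize (cluster S s).card = m at *
        have h3 : ∀ m ∈ Finset.Icc 1 5,
            156 * m ≤ 5 * ballCard 11 ((List.range m).map (2 ^ ·)) := by decide +kernel
        have := h3 m (Finset.mem_Icc.2 ⟨by omega, by omega⟩)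
        omega
      · have h2 := ballCard_tetrahedron_le (by norm_num) hij hik hjk hK
        have h3 : (cluster S s).card ≤ 4 := by rw [hK]; exact card_le_four
        rw [show ballCard 11 [0, 3, 6, 5] = 148 by decide +kernel] at h2
        omega
    rw [card_even_eleven] at hpack
    omega

end Word

/-! ### Independence numbers, chromatic numbers and embeddings -/

namespace SimpleGraph

variable {V : Type*} {G : SimpleGraph V}

theorem indepNum_eq_of_forall_le [Finite V] {a : ℕ}
    (hle : ∀ s : Finset V, G.IsIndepSet s → s.card ≤ a)
    (hex : ∃ s : Finset V, G.IsIndepSet s ∧ s.card = a) : G.indepNum = a := by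
  obtain ⟨s, hs, rfl⟩ := hex
  obtain ⟨t, ht⟩ := G.exists_isNIndepSet_indepNum
  exact le_antisymm (ht.card_eq ▸ hle t ht.isIndepSet) hs.card_le_indepNum

/-- Colour classes are independent, so `m` of them cover at most `m * G.indepNum` vertices. -/
theorem lt_chromaticNumber_of_mul_indepNum_lt [Finite V] {m : ℕ} (h : m * G.indepNum < Nat.card V) :
    ((m + 1 : ℕ) : ℕ∞) ≤ G.chromaticNumber := by
  classical
  by_contra hlt
  have hm : G.chromaticNumber ≤ m := by
    rw [not_le, Nat.cast_add, Nat.cast_one] at hlt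
    exact Order.le_of_lt_add_one hlt
  obtain ⟨C⟩ := chromaticNumber_le_iff_colorable.1 hm
  have := Fintype.ofFinite V
  rw [Nat.card_eq_fintype_card, ← Finset.card_univ,
    Finset.card_eq_sum_card_fiberwise (f := C) (t := Finset.univ) (by simp)] at h
  refine absurd h (not_lt.2 ?_)
  refine (Finset.sum_le_card_nsmul _ _ G.indepNum fun c _ => ?_).trans (by simp)
  refine IsIndepSet.card_le_indepNum ?_
  intro x hx y hy _ hadj
  simp only [Finset.coe_filter, Finset.mem_univ, true_and, Set.mem_ofPred_eq] at hx hy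
  exact C.valid hadj (hx.trans hy.symm)

end SimpleGraph

theorem dist_eq_one_iff {d : ℕ} (p q : EuclideanSpace ℝ (Fin d)) :
    dist p q = 1 ↔ ∑ i, (p i - q i) ^ 2 = 1 := by
  rw [EuclideanSpace.dist_eq, Real.sqrt_eq_one]
  simp only [Real.dist_eq, sq_abs]

/-- A graph embeds in `ℝ^d` if its vertices can be placed at distances that are `1` exactly for
adjacent vertices. -/
theorem nonempty_embedding_unitDistanceGraph {V : Type*} {G : SimpleGraph V} {d : ℕ}
    (f : V → Fin d → ℝ) (D : V → V → ℝ) (hD : ∀ x y, ∑ i, (f x i - f y i) ^ 2 = D x y)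
    (h0 : ∀ x y, D x y = 0 → x = y) (h1 : ∀ x y, G.Adj x y ↔ D x y = 1) :
    Nonempty (G ↪g unitDistanceGraph d) := by
  refine ⟨⟨⟨fun x => WithLp.toLp 2 (f x), fun x y hxy => h0 x y ?_⟩, fun {x y} => ?_⟩⟩
  · have : f x = f y := by simpa using hxy
    rw [← hD, this]
    simp
  · rw [h1, ← hD]
    exact dist_eq_one_iff _ _

/-! ### The cube graphs: sizes, independence numbers and embeddings -/

namespace Word

open Finset
open scoped symmDiff

variable {n : ℕ}

/-- The support of a `0`-`1` vector. -/
def support (x : Fin n → Fin 2) : Finset (Fin n) := univ.filter fun i => x i = 1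

theorem support_injective : Function.Injective (support (n := n)) := by
  intro x y h
  funext i
  have := congrArg (fun s => i ∈ s) h
  simp only [support, mem_filter, mem_univ, true_and, eq_iff_iff] at this
  generalize x i = a at this ⊢
  generalize y i = b at this ⊢
  revert a b
  decide

theorem exists_support (s : Finset (Fin n)) : ∃ x, support x = s :=
  ⟨fun i => if i ∈ s then 1 else 0, by ext i; simp [support]⟩

theorem sum_eq_card_support (x : Fin n → Fin 2) : ∑ i, (x i : ℕ) = (support x).card := by
  rw [support, card_filter]
  refine sum_congr rfl fun i _ => ?_
  generalize x i = a
  revert a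
  decide

theorem hammingDist_eq (x y : Fin n → Fin 2) :
    hammingDist x y = (support x ∆ support y).card := by
  rw [hammingDist]
  congr 1
  ext i
  simp only [support, mem_filter, mem_univ, true_and, mem_symmDiff]
  generalize x i = a
  generalize y i = b
  revert a b
  decide

theorem hammingDist_eq_sum (x y : Fin n → Fin 2) :
    (hammingDist x y : ℝ) = ∑ i, ((x i : ℕ) - (y i : ℕ) : ℝ) ^ 2 := by
  rw [hammingDist, card_filter, Nat.cast_sum]
  refine sum_congr rfl fun i _ => ?_
  have : ∀ a b : Fin 2, ((if a ≠ b then 1 else 0 : ℕ) : ℝ) = ((a : ℕ) - (b : ℕ) : ℝ) ^ 2 := by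
    intro a b
    fin_cases a <;> fin_cases b <;> simp
  exact this _ _

variable {A : Set (Fin n → Fin 2)} {p : Finset (Fin n) → Prop}

theorem ncard_eq [DecidablePred p] (hA : ∀ x, x ∈ A ↔ p (support x)) :
    A.ncard = (univ.filter p).card := by
  rw [← Set.ncard_image_of_injective A support_injective, ← Set.ncard_coe_finset]
  congr 1
  ext s
  simp only [Set.mem_image, coe_filter, mem_univ, true_and, Set.mem_ofPred_eq]
  constructor
  · rintro ⟨x, hx, rfl⟩
    exact (hA x).1 hx
  · intro hs
    obtain ⟨x, rfl⟩ := exists_support s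
    exact ⟨x, (hA x).2 hs, rfl⟩

theorem adj_iff (x y : A) :
    ((hypercubeGraph n 4).induce A).Adj x y ↔ (support x.1 ∆ support y.1).card = 4 := by
  change x.1 ≠ y.1 ∧ hammingDist x.1 y.1 = 4 ↔ _
  rw [hammingDist_eq, and_iff_right_iff_imp]
  intro h hxy
  rw [hxy, symmDiff_self] at h
  simp at h

theorem card_le_of_isIndepSet {a : ℕ} (hA : ∀ x, x ∈ A ↔ p (support x))
    (hle : ∀ S : Finset (Finset (Fin n)), AvoidsFour S → (∀ s ∈ S, p s) → S.card ≤ a)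
    (I : Finset A) (hI : ((hypercubeGraph n 4).induce A).IsIndepSet I) : I.card ≤ a := by
  rw [← card_image_of_injective I (support_injective.comp Subtype.val_injective)]
  refine hle _ (fun s hs t ht h => ?_) fun s hs => ?_
  · obtain ⟨x, hx, rfl⟩ := mem_image.1 hs
    obtain ⟨y, hy, rfl⟩ := mem_image.1 ht
    have hadj := (adj_iff x y).2 h
    exact hI hx hy hadj.ne hadj
  · obtain ⟨x, hx, rfl⟩ := mem_image.1 hs
    exact (hA x.1).1 x.2

theorem exists_isIndepSet (hA : ∀ x, x ∈ A ↔ p (support x)) (L : Finset ℕ)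
    (hlt : ∀ x ∈ L, x < 2 ^ n) (hp : ∀ x ∈ L, p (ofNat n x))
    (hL : ∀ x ∈ L, ∀ y ∈ L, weight n (x ^^^ y) ≠ 4) :
    ∃ I : Finset A, ((hypercubeGraph n 4).induce A).IsIndepSet I ∧ I.card = L.card := by
  classical
  choose f hf using exists_support (n := n)
  let g : L → A := fun x => ⟨f (ofNat n x.1), (hA _).2 (by rw [hf]; exact hp x.1 x.2)⟩
  have hg : Function.Injective g := by
    intro x y h
    have h1 := congrArg (fun z : A => support z.1) h
    simp only [g, hf] at h1
    exact Subtype.ext (ofNat_injOn n (hlt x.1 x.2) (hlt y.1 y.2) h1)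
  refine ⟨univ.image g, ?_, by rw [card_image_of_injective _ hg, card_univ, Fintype.card_coe]⟩
  intro a ha b hb _ hadj
  obtain ⟨x, -, rfl⟩ := mem_image.1 (mem_coe.1 ha)
  obtain ⟨y, -, rfl⟩ := mem_image.1 (mem_coe.1 hb)
  rw [adj_iff] at hadj
  simp only [g, hf] at hadj
  rw [← ofNat_xor, card_ofNat] at hadj
  exact hL _ x.2 _ y.2 hadj

theorem mem_halfCube (x : Fin n → Fin 2) : x ∈ halfCube n ↔ Even (support x).card := by
  rw [← sum_eq_card_support]; rfl

theorem mem_cubeSlice (s : ℕ) (x : Fin n → Fin 2) :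
    x ∈ cubeSlice n s ↔ (support x).card = s := by
  rw [← sum_eq_card_support]; rfl

theorem ncard_halfCube_ten : (halfCube 10).ncard = 512 :=
  (ncard_eq mem_halfCube).trans card_even_ten

theorem ncard_halfCube_eleven : (halfCube 11).ncard = 1024 :=
  (ncard_eq mem_halfCube).trans card_even_eleven

theorem ncard_cubeSlice : (cubeSlice 10 5).ncard = 252 :=
  (ncard_eq (mem_cubeSlice 5)).trans card_five_ten

theorem indepNum_halfCubeGraph_ten : (halfCubeGraph 10 4).indepNum = 20 := by
  refine SimpleGraph.indepNum_eq_of_forall_le (card_le_of_isIndepSet mem_halfCube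
    fun S hS h => card_le_twenty hS h) ?_
  -- Two full stars whose centres 1 and 1022 are complementary; words of different stars are at
  -- least 8 apart.
  obtain ⟨I, hI, hcard⟩ := exists_isIndepSet (A := halfCube 10) (p := fun s => Even s.card)
    mem_halfCube
    ((range 10).image (fun i => 1 ^^^ 2 ^ i) ∪ (range 10).image fun i => 1022 ^^^ 2 ^ i)
    (by decide +kernel)
    (fun x hx => by
      rw [card_ofNat]; revert x; decide +kernel)
    (by decide +kernel)
  exact ⟨I, hI, hcard.trans (by decide +kernel)⟩

theorem indepNum_halfCubeGraph_eleven : (halfCubeGraph 11 4).indepNum = 32 := by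
  refine SimpleGraph.indepNum_eq_of_forall_le (card_le_of_isIndepSet mem_halfCube
    fun S hS h => card_le_thirtyTwo hS h) ?_
  -- The extremal case of the upper bound: a full star with centre 1, and 21 words of weights 2 and
  -- 4 translated by the complement 2046 of that centre.
  obtain ⟨I, hI, hcard⟩ := exists_isIndepSet (A := halfCube 11) (p := fun s => Even s.card)
    mem_halfCube
    ((range 11).image (fun i => 1 ^^^ 2 ^ i) ∪
      ({46, 60, 108, 129, 257, 384, 387, 389, 393, 401, 417, 449, 556, 594, 897, 1068, 1106, 1409,
        1554, 1602, 1616} : Finset ℕ).image fun u => 2046 ^^^ u)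
    (by decide +kernel)
    (fun x hx => by
      rw [card_ofNat]; revert x; decide +kernel)
    (by decide +kernel)
  exact ⟨I, hI, hcard.trans (by decide +kernel)⟩

theorem indepNum_cubeSliceGraph : (cubeSliceGraph 10 4 5).indepNum = 12 := by
  refine SimpleGraph.indepNum_eq_of_forall_le (card_le_of_isIndepSet (mem_cubeSlice 5)
    fun S hS h => card_le_twelve hS h) ?_
  -- Three stars: 480 with one of the bits 2, 3, 4 added, 540 with one of 5, 6, 7, and 771 with one
  -- of 2, ..., 7.
  obtain ⟨I, hI, hcard⟩ := exists_isIndepSet (A := cubeSlice 10 5) (p := fun s => s.card = 5)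
    (mem_cubeSlice 5)
    {484, 488, 496, 572, 604, 668, 775, 779, 787, 803, 835, 899} (by decide +kernel)
    (fun x hx => by
      rw [card_ofNat]; revert x; decide +kernel)
    (by decide +kernel)
  exact ⟨I, hI, hcard.trans (by decide +kernel)⟩

theorem adj_iff_hammingDist (x y : A) :
    ((hypercubeGraph n 4).induce A).Adj x y ↔ (hammingDist x.1 y.1 : ℝ) / 4 = 1 := by
  rw [adj_iff, ← hammingDist_eq, div_eq_one_iff_eq (by norm_num)]
  norm_cast

theorem eq_of_hammingDist_div {x y : A} (h : (hammingDist x.1 y.1 : ℝ) / 4 = 0) : x = y := by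
  rw [div_eq_zero_iff, or_iff_left (by norm_num)] at h
  exact Subtype.ext (hammingDist_eq_zero.1 (by exact_mod_cast h))

theorem nonempty_embedding_halfCubeGraph (n : ℕ) :
    Nonempty (halfCubeGraph n 4 ↪g unitDistanceGraph n) := by
  refine nonempty_embedding_unitDistanceGraph (fun x i => ((x.1 i : ℕ) : ℝ) / 2)
    (fun x y => (hammingDist x.1 y.1 : ℝ) / 4) (fun x y => ?_) (fun x y => eq_of_hammingDist_div)
    fun x y => adj_iff_hammingDist x y
  rw [hammingDist_eq_sum, sum_div]
  exact sum_congr rfl fun i _ => by ring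

theorem nonempty_embedding_halfCubeGraph_succ (n : ℕ) :
    Nonempty (halfCubeGraph n 4 ↪g unitDistanceGraph (n + 1)) := by
  refine nonempty_embedding_unitDistanceGraph
    (fun x => Fin.snoc (α := fun _ => ℝ) (fun i => ((x.1 i : ℕ) : ℝ) / 2) 0)
    (fun x y => (hammingDist x.1 y.1 : ℝ) / 4) (fun x y => ?_) (fun x y => eq_of_hammingDist_div)
    fun x y => adj_iff_hammingDist x y
  rw [hammingDist_eq_sum, sum_div, Fin.sum_univ_castSucc]
  simp only [Fin.snoc_castSucc, Fin.snoc_last, sub_self, ne_eq, OfNat.ofNat_ne_zero,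
    not_false_eq_true, zero_pow, add_zero]
  exact sum_congr rfl fun i _ => by ring

theorem nonempty_embedding_cubeSliceGraph :
    Nonempty (cubeSliceGraph 10 4 5 ↪g unitDistanceGraph 9) := by
  -- The slice lies in a hyperplane, so the last coordinate of a difference `d` is minus the sum of
  -- the other nine. Adding `l` times that sum to each of the nine coordinates raises their squared
  -- norm by `2 * l + 9 * l ^ 2` times the square of the sum, which has to replace the dropped
  -- coordinate.
  obtain ⟨l, hl⟩ : ∃ l : ℝ, 2 * l + 9 * l ^ 2 = 1 := by
    refine ⟨(√10 - 1) / 9, ?_⟩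
    have : √10 ^ 2 = (10 : ℝ) := Real.sq_sqrt (by norm_num)
    linear_combination this / 9
  refine nonempty_embedding_unitDistanceGraph
    (fun x i => (((x.1 i.castSucc : ℕ) : ℝ) + l * ∑ j : Fin 9, ((x.1 j.castSucc : ℕ) : ℝ)) / 2)
    (fun x y => (hammingDist x.1 y.1 : ℝ) / 4) (fun x y => ?_) (fun x y => eq_of_hammingDist_div)
    fun x y => adj_iff_hammingDist x y
  have hx : ∑ j : Fin 9, ((x.1 j.castSucc : ℕ) : ℝ) + ((x.1 (Fin.last 9) : ℕ) : ℝ) = 5 := by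
    have : ∑ i, (x.1 i : ℕ) = 5 := x.2
    rw [Fin.sum_univ_castSucc] at this
    exact_mod_cast this
  have hy : ∑ j : Fin 9, ((y.1 j.castSucc : ℕ) : ℝ) + ((y.1 (Fin.last 9) : ℕ) : ℝ) = 5 := by
    have : ∑ i, (y.1 i : ℕ) = 5 := y.2
    rw [Fin.sum_univ_castSucc] at this
    exact_mod_cast this
  rw [hammingDist_eq_sum, Fin.sum_univ_castSucc (n := 9)]
  set a : Fin 9 → ℝ := fun j => ((x.1 j.castSucc : ℕ) : ℝ)
  set b : Fin 9 → ℝ := fun j => ((y.1 j.castSucc : ℕ) : ℝ)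
  set s := ∑ j, a j
  set t := ∑ j, b j
  have hterm : ∀ i, ((a i + l * s) / 2 - (b i + l * t) / 2) ^ 2 = (a i - b i) ^ 2 / 4 +
      (a i - b i) * (l * (s - t) / 2) + (l * (s - t)) ^ 2 / 4 := fun i => by ring
  have hst : ∑ j, (a j - b j) = s - t := sum_sub_distrib _ _
  change ∑ i, ((a i + l * s) / 2 - (b i + l * t) / 2) ^ 2 = (∑ i, (a i - b i) ^ 2 + _) / 4
  simp only [hterm]
  rw [sum_add_distrib, sum_add_distrib, ← sum_div, ← sum_mul, hst]
  simp only [sum_const, card_univ, Fintype.card_fin, nsmul_eq_mul]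
  rw [show ((x.1 (Fin.last 9) : ℕ) : ℝ) - ((y.1 (Fin.last 9) : ℕ) : ℝ) = t - s by linarith]
  push_cast
  linear_combination (s - t) ^ 2 / 4 * hl

end Word

/-! ### The graph on the roots and the added points: independence number and embeddings -/

namespace ExtendedE8

theorem distSq_cast (x y : Fin 8 → ℤ) : (distSq x y : ℝ) = ∑ i, ((x i : ℝ) - y i) ^ 2 := by
  simp [distSq]

theorem distSq_eq_zero {x y : Fin 8 → ℤ} (h : distSq x y = 0) : x = y := by
  rw [distSq, Finset.sum_eq_zero_iff_of_nonneg fun i _ => sq_nonneg _] at h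
  funext i
  have := h i (Finset.mem_univ i)
  rw [sq_eq_zero_iff, sub_eq_zero] at this
  exact this

theorem finite_extendedE8 : Finite extendedE8 := by
  rw [← coe_points]
  exact inferInstance

theorem ncard_e8Roots : e8Roots.ncard = 240 := by
  rw [← coe_roots, Set.ncard_coe_finset, card_roots]

theorem ncard_extendedE8 : extendedE8.ncard = 289 := by
  rw [← coe_points, Set.ncard_coe_finset, card_points]

theorem indepNum_extendedE8Graph : extendedE8Graph.indepNum = 16 := by
  classical
  have := finite_extendedE8
  refine SimpleGraph.indepNum_eq_of_forall_le (fun I hI => ?_) ?_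
  · rw [← Finset.card_image_of_injective I Subtype.val_injective]
    refine card_le_of_indep _ (fun x hx => ?_) fun x hx y hy h => ?_
    · obtain ⟨z, -, rfl⟩ := Finset.mem_image.1 hx
      rw [← Finset.mem_coe, coe_points]
      exact z.2
    · obtain ⟨u, hu, rfl⟩ := Finset.mem_image.1 hx
      obtain ⟨v, hv, rfl⟩ := Finset.mem_image.1 hy
      have hadj : extendedE8Graph.Adj u v := h
      exact hI hu hv hadj.ne hadj
  -- Five antipodal pairs of roots (indices that differ by 169), three further roots and the three
  -- added points 31, 44 and 54.
  · let L : Finset ℕ := {3, 31, 44, 54, 57, 69, 75, 104, 134, 172, 226, 244, 273, 276, 303, 317}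
    have hL : ∀ z ∈ L, z ∈ rootIndices ∪ addedIndices := by decide +kernel
    have hconf : ∀ z ∈ L, ∀ z' ∈ L, distSq (point z) (point z') ≠ 16 := by decide +kernel
    let g : L → extendedE8 := fun z => ⟨point z.1, by
      rw [← coe_points]; exact Finset.mem_image_of_mem _ (hL z.1 z.2)⟩
    have hg : Function.Injective g := fun u v h =>
      Subtype.ext (injOn_point (hL u.1 u.2) (hL v.1 v.2) (congrArg Subtype.val h))
    refine ⟨Finset.univ.image g, ?_, ?_⟩
    · intro a ha b hb _ hadj
      obtain ⟨u, -, rfl⟩ := Finset.mem_image.1 (Finset.mem_coe.1 ha)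
      obtain ⟨v, -, rfl⟩ := Finset.mem_image.1 (Finset.mem_coe.1 hb)
      exact hconf u.1 u.2 v.1 v.2 hadj
    · rw [Finset.card_image_of_injective _ hg, Finset.card_univ, Fintype.card_coe]
      rfl

theorem adj_iff (x y : extendedE8) :
    extendedE8Graph.Adj x y ↔ (distSq x.1 y.1 : ℝ) / 16 = 1 := by
  change distSq x.1 y.1 = 16 ↔ _
  rw [div_eq_one_iff_eq (by norm_num)]
  norm_cast

theorem eq_of_distSq_div {x y : extendedE8} (h : (distSq x.1 y.1 : ℝ) / 16 = 0) : x = y := by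
  rw [div_eq_zero_iff, or_iff_left (by norm_num)] at h
  exact Subtype.ext (distSq_eq_zero (by exact_mod_cast h))

theorem nonempty_embedding_unitDistanceGraph :
    Nonempty (extendedE8Graph ↪g unitDistanceGraph 8) := by
  refine _root_.nonempty_embedding_unitDistanceGraph (fun x i => (x.1 i : ℝ) / 4)
    (fun x y => (distSq x.1 y.1 : ℝ) / 16) (fun x y => ?_) (fun x y => eq_of_distSq_div) adj_iff
  rw [distSq_cast, Finset.sum_div]
  exact Finset.sum_congr rfl fun i _ => by ring

theorem nonempty_embedding_rationalUnitDistanceGraph :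
    Nonempty (extendedE8Graph ↪g rationalUnitDistanceGraph 8) := by
  refine ⟨⟨⟨fun x i => (x.1 i : ℚ) / 4, fun x y h => Subtype.ext (funext fun i => ?_)⟩,
    fun {x y} => ?_⟩⟩
  · have := congrFun h i
    simp only [div_left_inj' (show (4 : ℚ) ≠ 0 by norm_num)] at this
    exact_mod_cast this
  · rw [adj_iff, distSq_cast, Finset.sum_div]
    refine (dist_eq_one_iff _ _).trans (Eq.congr_left (Finset.sum_congr rfl fun i _ => ?_))
    change ((((x.1 i : ℚ) / 4 : ℚ) : ℝ) - (((y.1 i : ℚ) / 4 : ℚ) : ℝ)) ^ 2 = _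
    push_cast
    ring

end ExtendedE8

theorem le_chromaticNumber_of_indepNum {α : Type*} {A : Set α} {G : SimpleGraph A}
    {N a m : ℕ} (hA : A.ncard = N) (hN : N ≠ 0) (ha : G.indepNum = a) (h : m * a < N) :
    ((m + 1 : ℕ) : ℕ∞) ≤ G.chromaticNumber := by
  have : Finite A := Set.finite_of_ncard_ne_zero (by rwa [hA])
  refine SimpleGraph.lt_chromaticNumber_of_mul_indepNum_lt ?_
  rwa [ha, Nat.card_coe_set_eq, hA]

theorem le_chromaticNumber_of_embedding {V W : Type*} {G : SimpleGraph V} {H : SimpleGraph W}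
    {k : ℕ∞} (h : k ≤ G.chromaticNumber) (f : Nonempty (G ↪g H)) : k ≤ H.chromaticNumber :=
  h.trans (SimpleGraph.chromaticNumber_mono_of_hom f.some.toHom)

end

theorem mainTheorem1 :
    -- the lower bounds for the unit-distance graphs on `ℝ^8, ..., ℝ^12` and `ℚ^8`
    (19 ≤ (unitDistanceGraph 8).chromaticNumber ∧
      21 ≤ (unitDistanceGraph 9).chromaticNumber ∧
      26 ≤ (unitDistanceGraph 10).chromaticNumber ∧
      32 ≤ (unitDistanceGraph 11).chromaticNumber ∧
      32 ≤ (unitDistanceGraph 12).chromaticNumber ∧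
      19 ≤ (rationalUnitDistanceGraph 8).chromaticNumber) ∧
    -- the half-cube graph `H(10,4)`
    ((halfCube 10).ncard = 512 ∧
      (halfCubeGraph 10 4).indepNum = 20 ∧
      26 ≤ (halfCubeGraph 10 4).chromaticNumber ∧
      Nonempty (halfCubeGraph 10 4 ↪g unitDistanceGraph 10)) ∧
    -- the half-cube graph `H(11,4)`
    ((halfCube 11).ncard = 1024 ∧
      (halfCubeGraph 11 4).indepNum = 32 ∧
      32 ≤ (halfCubeGraph 11 4).chromaticNumber ∧
      Nonempty (halfCubeGraph 11 4 ↪g unitDistanceGraph 11) ∧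
      Nonempty (halfCubeGraph 11 4 ↪g unitDistanceGraph 12)) ∧
    -- the slice `C(10,4,5)`
    ((cubeSlice 10 5).ncard = 252 ∧
      (cubeSliceGraph 10 4 5).indepNum = 12 ∧
      21 ≤ (cubeSliceGraph 10 4 5).chromaticNumber ∧
      Nonempty (cubeSliceGraph 10 4 5 ↪g unitDistanceGraph 9)) ∧
    -- the `E8` roots with the added points
    (e8Roots.ncard = 240 ∧
      addedPoints.card = 49 ∧
      extendedE8.ncard = 289 ∧
      extendedE8Graph.indepNum = 16 ∧
      19 ≤ extendedE8Graph.chromaticNumber ∧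
      Nonempty (extendedE8Graph ↪g unitDistanceGraph 8) ∧
      Nonempty (extendedE8Graph ↪g rationalUnitDistanceGraph 8)) := by
  -- The four counts are 25 · 20 < 512, 31 · 32 < 1024, 20 · 12 < 252 and 18 · 16 = 288 < 289.
  have h10 : 26 ≤ (halfCubeGraph 10 4).chromaticNumber :=
    le_chromaticNumber_of_indepNum (m := 25) Word.ncard_halfCube_ten (by norm_num)
      Word.indepNum_halfCubeGraph_ten (by norm_num)
  have h11 : 32 ≤ (halfCubeGraph 11 4).chromaticNumber :=
    le_chromaticNumber_of_indepNum (m := 31) Word.ncard_halfCube_eleven (by norm_num)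
      Word.indepNum_halfCubeGraph_eleven (by norm_num)
  have h9 : 21 ≤ (cubeSliceGraph 10 4 5).chromaticNumber :=
    le_chromaticNumber_of_indepNum (m := 20) Word.ncard_cubeSlice (by norm_num)
      Word.indepNum_cubeSliceGraph (by norm_num)
  have h8 : 19 ≤ extendedE8Graph.chromaticNumber :=
    le_chromaticNumber_of_indepNum (m := 18) ExtendedE8.ncard_extendedE8 (by norm_num)
      ExtendedE8.indepNum_extendedE8Graph (by norm_num)
  have e8 := ExtendedE8.nonempty_embedding_unitDistanceGraph
  have e8' := ExtendedE8.nonempty_embedding_rationalUnitDistanceGraph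
  have e9 := Word.nonempty_embedding_cubeSliceGraph
  have e10 := Word.nonempty_embedding_halfCubeGraph 10
  have e11 := Word.nonempty_embedding_halfCubeGraph 11
  have e12 := Word.nonempty_embedding_halfCubeGraph_succ 11
  exact ⟨⟨le_chromaticNumber_of_embedding h8 e8, le_chromaticNumber_of_embedding h9 e9,
      le_chromaticNumber_of_embedding h10 e10, le_chromaticNumber_of_embedding h11 e11,
      le_chromaticNumber_of_embedding h11 e12, le_chromaticNumber_of_embedding h8 e8'⟩,
    ⟨Word.ncard_halfCube_ten, Word.indepNum_halfCubeGraph_ten, h10, e10⟩,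
    ⟨Word.ncard_halfCube_eleven, Word.indepNum_halfCubeGraph_eleven, h11, e11, e12⟩,
    ⟨Word.ncard_cubeSlice, Word.indepNum_cubeSliceGraph, h9, e9⟩,
    ⟨ExtendedE8.ncard_e8Roots, ExtendedE8.card_addedPoints, ExtendedE8.ncard_extendedE8,
      ExtendedE8.indepNum_extendedE8Graph, h8, e8, e8'⟩⟩
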